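/- Let $m\ge 2$ and $n\ge 2$ be integers. For $x_0\in\mathbb R^n$ put $r=|x-x_0|$, let $\mathbb B_{R}(x_0)$ be the open ball of radius $R$ centred at $x_0$, and let $$\phi(r)=\log r+\log\big((\log r)^2\big).$$ Write $\|f\|_{L^p(r^{-n}dx)}=\big(\int_{\mathbb R^n}|f|^p\,r^{-n}dx\big)^{1/p}$ for $p<\infty$, let $\|f\|_{L^p}$ be the usual (unweighted) norm of $L^p(\mathbb R^n)$, and for a multi-index $\alpha\in\mathbb N^n$ put $\beta_\alpha=\frac{3m-2|\alpha|}{2}$. (I) Let $n>4m-2$ and $2\le p\le\frac{2n}{n-4m+2}$. There are constants $C>0$ and $R_0\in(0,1)$, depending only on $m,n,p$, such that for all $x_0\in\mathbb R^n$, all (real- or complex-valued) $u\in C_0^\infty(\mathbb B_{R_0}(x_0)\setminus\{x_0\})$ and all $\tau>1$, $$\tau^{\beta_0}\big\|e^{-\tau\phi(r)}(\log r)^{-m}u\big\|_{L^p(r^{-n}dx)}+\sum_{1\le|\alpha|\le 2m-1}\tau^{\beta_\alpha}\big\|e^{-\tau\phi(r)}(\log r)^{-m}r^{|\alpha|}D^\alpha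 u\big\|_{L^2(r^{-n}dx)}\le C\big\|e^{-\tau\phi(r)}r^{2m}\Delta^m u\big\|_{L^2(r^{-n}dx)},$$ where in the first term $\beta_0=\frac{3mp-n(p-2)}{2p}$. (II) Let $n=4m-2$, $2\le p<\infty$ and $0<\varepsilon<1$. There are constants $C>0$ and $R_0\in(0,1)$, depending only on $m,p,\varepsilon$, such that for all $x_0\in\mathbb R^n$, all (real- or complex-valued) $u\in C_0^\infty(\mathbb B_{R_0}(x_0)\setminus\{x_0\})$ and all $\tau>1$, $$\tau^{\tilde\beta_0}\big\|e^{-\tau\phi(r)}(\log r)^{-m}u\big\|_{L^p}+\sum_{0\le|\alpha|\le 2m-1}\tau^{\beta_\alpha}\big\|e^{-\tau\phi(r)}(\log r)^{-m}r^{|\alpha|}D^\alpha u\big\|_{L^2(r^{-n}dx)}\le C\big\|e^{-\tau\phi(r)}r^{2m}\Delta^m u\big\|_{L^2(r^{-n}dx)},$$ where $\tilde\beta_0=\frac{4m-2}{p}(1-\varepsilon)-\frac{m-2}{2}$. (III) Let $2\le n<4m-2$ and $2\le p\le\infty$. There are constants $C>0$ and $R_0\in(0,1)$, depending only on $m,n,p$,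 such that for all $x_0\in\mathbb R^n$, all (real- or complex-valued) $u\in C_0^\infty(\mathbb B_{R_0}(x_0)\setminus\{x_0\})$ and all $\tau>1$, $$\tau^{\bar\beta_0}\big\|e^{-\tau\phi(r)}(\log r)^{-m}u\big\|_{L^p}+\sum_{0\le|\alpha|\le 2m-1}\tau^{\beta_\alpha}\big\|e^{-\tau\phi(r)}(\log r)^{-m}r^{|\alpha|}D^\alpha u\big\|_{L^2(r^{-n}dx)}\le C\big\|e^{-\tau\phi(r)}r^{2m}\Delta^m u\big\|_{L^2(r^{-n}dx)},$$ where $\bar\beta_0=\frac{4m-2}{p}-\frac{m-2}{2}$ (with $\frac{4m-2}{p}=0$ if $p=\infty$). -/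

import Mathlib

open MeasureTheory
open scoped ENNReal ContDiff

namespace Carleman

/-- The log-linear weight function `φ(r) = log r + log ((log r)²)`. -/
noncomputable def phi (r : ℝ) : ℝ := Real.log r + Real.log (Real.log r ^ 2)

/-- The measure `r⁻ⁿ dx` on `ℝⁿ`, where `r = |x - x₀|`. -/
noncomputable def weightedMeasure {n : ℕ} (x₀ : EuclideanSpace ℝ (Fin n)) :
    Measure (EuclideanSpace ℝ (Fin n)) :=
  volume.withDensity fun x => ENNReal.ofReal ((‖x - x₀‖ ^ n)⁻¹)

/-- The partial derivative `∂u/∂xᵢ`. -/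
noncomputable def partialDeriv {n : ℕ} (i : Fin n) (u : EuclideanSpace ℝ (Fin n) → ℂ) :
    EuclideanSpace ℝ (Fin n) → ℂ :=
  fun x => fderiv ℝ u x (EuclideanSpace.single i 1)

/-- The derivative `D^α u = ∂₁^α₁ ⋯ ∂ₙ^αₙ u` for a multi-index `α`. -/
noncomputable def multiDeriv {n : ℕ} (α : Fin n → ℕ) (u : EuclideanSpace ℝ (Fin n) → ℂ) :
    EuclideanSpace ℝ (Fin n) → ℂ :=
  (List.finRange n).foldr (fun i f => (partialDeriv i)^[α i] f) u

/-- The multi-indices `α ∈ ℕⁿ` of length `|α| = α₁ + ⋯ + αₙ = j`. -/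
def multiIndices (n j : ℕ) : Finset (Fin n → ℕ) := Finset.piAntidiag Finset.univ j

/-- The iterated Laplacian `Δᵐ u`. -/
noncomputable def iterLaplacian {n : ℕ} (m : ℕ) (u : EuclideanSpace ℝ (Fin n) → ℂ) :
    EuclideanSpace ℝ (Fin n) → ℂ :=
  (fun v : EuclideanSpace ℝ (Fin n) → ℂ => Laplacian.laplacian v)^[m] u

/-- `u ∈ C₀^∞(B_R(x₀) ∖ {x₀})`, for functions extended by zero to the whole of `ℝⁿ`. -/
def IsTestFunction {n : ℕ} (x₀ : EuclideanSpace ℝ (Fin n)) (R : ℝ)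
    (u : EuclideanSpace ℝ (Fin n) → ℂ) : Prop :=
  ContDiff ℝ ∞ u ∧ HasCompactSupport u ∧ tsupport u ⊆ Metric.ball x₀ R \ {x₀}

/-- The function `e^{-τ φ(r)} (log r)^{-m} r^j f` with `r = |x - x₀|`. -/
noncomputable def weightedLower {n : ℕ} (m j : ℕ) (x₀ : EuclideanSpace ℝ (Fin n)) (τ : ℝ)
    (f : EuclideanSpace ℝ (Fin n) → ℂ) : EuclideanSpace ℝ (Fin n) → ℂ :=
  fun x => (Real.exp (-τ * phi ‖x - x₀‖) * (Real.log ‖x - x₀‖ ^ m)⁻¹ * ‖x - x₀‖ ^ j) • f x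

/-- The norm `‖e^{-τ φ(r)} r^{2m} Δᵐ u‖` in `L²(r⁻ⁿ dx)`. -/
noncomputable def laplacianNorm {n : ℕ} (m : ℕ) (x₀ : EuclideanSpace ℝ (Fin n)) (τ : ℝ)
    (u : EuclideanSpace ℝ (Fin n) → ℂ) : ℝ≥0∞ :=
  eLpNorm (fun x => (Real.exp (-τ * phi ‖x - x₀‖) * ‖x - x₀‖ ^ (2 * m)) • iterLaplacian m u x)
    2 (weightedMeasure x₀)

/-- The sum over all multi-indices `α` with `|α| ∈ J` of
`τ^{(3m - 2|α|)/2} ‖e^{-τ φ(r)} (log r)^{-m} r^{|α|} D^α u‖`, the norms being those of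
`L²(r⁻ⁿ dx)`. -/
noncomputable def derivativeSum {n : ℕ} (m : ℕ) (J : Finset ℕ) (x₀ : EuclideanSpace ℝ (Fin n))
    (τ : ℝ) (u : EuclideanSpace ℝ (Fin n) → ℂ) : ℝ≥0∞ :=
  ∑ j ∈ J, ∑ α ∈ multiIndices n j,
    ENNReal.ofReal (τ ^ ((3 * (m : ℝ) - 2 * (j : ℝ)) / 2)) *
      eLpNorm (weightedLower m j x₀ τ (multiDeriv α u)) 2 (weightedMeasure x₀)

end Carleman

namespace Carleman

open scoped RealInnerProductSpace

section AbstractCarleman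

/-- The algebra of the operators `r∂ᵣ`, multiplication by `1 / log r` and the spherical
Laplacian. -/
structure LogPolar {V : Type*} [SeminormedAddCommGroup V] [InnerProductSpace ℝ V]
    (D M L : V →ₗ[ℝ] V) (ε : ℝ) : Prop where
  skew : ∀ v w, ⟪D v, w⟫ = -⟪v, D w⟫
  symmM : ∀ v w, ⟪M v, w⟫ = ⟪v, M w⟫
  symmL : ∀ v w, ⟪L v, w⟫ = ⟪v, L w⟫
  nonposL : ∀ v, ⟪L v, v⟫ ≤ 0
  derivM : ∀ v, D (M v) = M (D v) - M (M v)
  commDL : ∀ v, D (L v) = L (D v)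
  commML : ∀ v, M (L v) = L (M v)
  smallM : ∀ v, ‖M v‖ ≤ ε * ‖v‖

section Operators

variable {V : Type*} [AddCommGroup V] [Module ℝ V]

/-- The operator `D + a + bM`. -/
def shiftOp (D M : V →ₗ[ℝ] V) (a b : ℝ) : V →ₗ[ℝ] V := D + a • LinearMap.id + b • M

/-- The operator `(D + a + bM)² + L - c`. -/
def conjOp (D M L : V →ₗ[ℝ] V) (c a b : ℝ) : V →ₗ[ℝ] V :=
  shiftOp D M a b ∘ₗ shiftOp D M a b + L - c • LinearMap.id

variable {D M L : V →ₗ[ℝ] V}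

lemma shiftOp_apply (a b : ℝ) (v : V) : shiftOp D M a b v = D v + a • v + b • M v := by
  simp [shiftOp]

lemma conjOp_apply (c a b : ℝ) (v : V) :
    conjOp D M L c a b v = shiftOp D M a b (shiftOp D M a b v) + L v - c • v := by
  simp [conjOp]

end Operators

variable {V : Type*} [SeminormedAddCommGroup V] [InnerProductSpace ℝ V]

variable {D M L : V →ₗ[ℝ] V} {ε : ℝ}

lemma pow_norm_chain {K : ℝ} (hK : 0 ≤ K) (w : ℕ → V) {m p : ℕ} (q : ℕ)
    (hw : ∀ k, p ≤ k → k < q → ∀ j ≤ m, ‖(M ^ (j + 1)) (w k)‖ ≤ K * ‖(M ^ j) (w (k + 1))‖)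
    (i : ℕ) : ∀ j, j + i ≤ m + 1 → ∀ k, p ≤ k → k + i = q →
      ‖(M ^ (j + i)) (w k)‖ ≤ K ^ i * ‖(M ^ j) (w q)‖ := by
  induction i with
  | zero => intro j _ k _ hk; simp_all
  | succ i ih =>
    intro j hj k hpk hk
    have h1 := hw k hpk (by omega) (j + i) (by omega)
    have h2 := ih j (by omega) (k + 1) (by omega) (by omega)
    calc ‖(M ^ (j + (i + 1))) (w k)‖ ≤ K * ‖(M ^ (j + i)) (w (k + 1))‖ := h1
      _ ≤ K * (K ^ i * ‖(M ^ j) (w q)‖) := by gcongr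
      _ = _ := by ring

namespace LogPolar

variable (h : LogPolar D M L ε)
include h

lemma mul_shiftOp (a b : ℝ) (v : V) : M (shiftOp D M a b v) = shiftOp D M a (b + 1) (M v) := by
  simp only [shiftOp_apply, map_add, map_smul, h.derivM]
  module

lemma mul_conjOp (c a b : ℝ) (v : V) :
    M (conjOp D M L c a b v) = conjOp D M L c a (b + 1) (M v) := by
  simp only [conjOp_apply, map_add, map_sub, map_smul, h.mul_shiftOp, h.commML]

lemma pow_mul_shiftOp (a b : ℝ) (j : ℕ) (v : V) :
    (M ^ j) (shiftOp D M a b v) = shiftOp D M a (b + j) ((M ^ j) v) := by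
  induction j generalizing v b with
  | zero => simp
  | succ j ih =>
    rw [pow_succ, Module.End.mul_apply, Module.End.mul_apply, h.mul_shiftOp, ih]
    push_cast; ring_nf

lemma pow_mul_conjOp (c a b : ℝ) (j : ℕ) (v : V) :
    (M ^ j) (conjOp D M L c a b v) = conjOp D M L c a (b + j) ((M ^ j) v) := by
  induction j generalizing v b with
  | zero => simp
  | succ j ih =>
    rw [pow_succ, Module.End.mul_apply, Module.End.mul_apply, h.mul_conjOp, ih]
    push_cast; ring_nf

lemma comm_shiftOp (a b : ℝ) (v : V) : L (shiftOp D M a b v) = shiftOp D M a b (L v) := by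
  simp only [shiftOp_apply, map_add, map_smul, h.commDL, h.commML]

lemma comm_conjOp (c a b : ℝ) (v : V) :
    L (conjOp D M L c a b v) = conjOp D M L c a b (L v) := by
  simp only [conjOp_apply, map_add, map_sub, map_smul, h.comm_shiftOp]

lemma comm_pow (j : ℕ) (v : V) : (M ^ j) (L v) = L ((M ^ j) v) := by
  induction j generalizing v with
  | zero => simp
  | succ j ih =>
    rw [pow_succ, Module.End.mul_apply, Module.End.mul_apply, h.commML, ih]

lemma inner_D_self (v : V) : ⟪D v, v⟫ = 0 := by
  have := h.skew v v
  rw [real_inner_comm (D v) v] at this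
  linarith

lemma inner_Mpow_D (v : V) : 2 * ⟪M v, D v⟫ = ‖M v‖ ^ 2 := by
  have h1 := h.skew (M v) v
  rw [h.derivM, inner_sub_left, real_inner_comm] at h1
  have h2 : ⟪M (M v), v⟫ = ‖M v‖ ^ 2 := by rw [h.symmM, real_inner_self_eq_norm_sq]
  have h3 : ⟪M (D v), v⟫ = ⟪M v, D v⟫ := by rw [h.symmM, real_inner_comm]
  have h4 : ⟪v, M (D v)⟫ = ⟪M v, D v⟫ := by rw [h.symmM]
  rw [h2, h4] at h1
  linarith

lemma inner_MMM_D (v : V) : 2 * ⟪M (M (M v)), D v⟫ = 3 * ‖M (M v)‖ ^ 2 := by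
  have h1 := h.inner_Mpow_D (M v)
  rw [h.derivM, inner_sub_right] at h1
  have h2 : ⟪M (M v), M (M v)⟫ = ‖M (M v)‖ ^ 2 := real_inner_self_eq_norm_sq _
  rw [← h.symmM, h2] at h1
  linarith

lemma inner_MM_D (v : V) : ⟪M (M v), D v⟫ = ⟪M (M v), M v⟫ := by
  have h1 := h.skew (M v) (M v)
  rw [real_inner_comm, h.derivM, inner_sub_right, ← h.symmM] at h1
  have h2 : ⟪M (M v), M v⟫ = ⟪M v, M (M v)⟫ := real_inner_comm _ _
  linarith

/-- Hardy's inequality. -/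
lemma hardy (v : V) : 3 * ‖M (M v)‖ ≤ 2 * ‖M (D v)‖ := by
  have h1 := h.inner_MMM_D v
  rw [h.symmM] at h1
  have h2 := real_inner_le_norm (M (M v)) (M (D v))
  by_contra! hc
  have : 0 < ‖M (M v)‖ := by
    have := norm_nonneg (M (D v)); linarith
  nlinarith

/-- The Carleman inequality for `(D + a + bM)² + L - c`. -/
lemma norm_conjOp_sq_ge (c a : ℝ) {b : ℝ} (hb : 0 ≤ b) (v : V) :
    4 / 3 * b * ‖M (D v)‖ ^ 2 + 4 * b * ‖M (a • v + b • M v)‖ ^ 2 ≤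
      ‖conjOp D M L c a b v‖ ^ 2 := by
  set x := D v with hx
  set S := D x + (a ^ 2) • v + (2 * a * b) • M v + (b ^ 2) • M (M v) + L v - c • v with hS
  set T := (2 * a) • x + (2 * b) • M x - b • M (M v) with hT
  have hP : conjOp D M L c a b v = S + T := by
    simp only [conjOp_apply, shiftOp_apply, map_add, map_smul, h.derivM, hS, hT, ← hx]
    module
  have e1 : ⟪D x, x⟫ = 0 := h.inner_D_self x
  have e2 : 2 * ⟪D x, M x⟫ = ‖M x‖ ^ 2 := by rw [real_inner_comm]; exact h.inner_Mpow_D x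
  have e3 : ⟪D x, M (M v)⟫ = -‖M x‖ ^ 2 + 3 * ‖M (M v)‖ ^ 2 := by
    rw [h.skew, h.derivM, h.derivM, map_sub, inner_sub_right, inner_sub_right, ← h.symmM x,
      ← h.symmM x (M (M v)), real_inner_self_eq_norm_sq]
    have := h.inner_MMM_D v
    have e : ⟪M x, M (M v)⟫ = ⟪M (M (M v)), D v⟫ := by
      rw [h.symmM (M (M v)), real_inner_comm]
    rw [e]; linarith
  have e4 : ⟪v, x⟫ = 0 := by rw [real_inner_comm]; exact h.inner_D_self v
  have e5 : 2 * ⟪v, M x⟫ = ‖M v‖ ^ 2 := by rw [← h.symmM]; exact h.inner_Mpow_D v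
  have e6 : ⟪v, M (M v)⟫ = ‖M v‖ ^ 2 := by rw [← h.symmM, real_inner_self_eq_norm_sq]
  have e7 : 2 * ⟪M v, x⟫ = ‖M v‖ ^ 2 := h.inner_Mpow_D v
  have e8 : ⟪M v, M x⟫ = ⟪M (M v), M v⟫ := by rw [← h.symmM]; exact h.inner_MM_D v
  have e9 : ⟪M v, M (M v)⟫ = ⟪M (M v), M v⟫ := real_inner_comm _ _
  have e10 : ⟪M (M v), x⟫ = ⟪M (M v), M v⟫ := h.inner_MM_D v
  have e11 : 2 * ⟪M (M v), M x⟫ = 3 * ‖M (M v)‖ ^ 2 := by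
    rw [← h.symmM]; exact h.inner_MMM_D v
  have e12 : ⟪M (M v), M (M v)⟫ = ‖M (M v)‖ ^ 2 := real_inner_self_eq_norm_sq _
  have e13 : ⟪L v, x⟫ = 0 := by
    have h1 := h.skew (L v) v
    rw [h.commDL, h.symmL, real_inner_comm, ← hx, h.symmL] at h1
    have h2 : ⟪v, L x⟫ = ⟪L v, x⟫ := (h.symmL _ _).symm
    have h3 : ⟪L x, v⟫ = ⟪v, L x⟫ := real_inner_comm _ _
    linarith
  have e14 : 2 * ⟪L v, M x⟫ = ⟪L v, M (M v)⟫ := by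
    have h1 := h.skew (L v) (M v)
    rw [h.derivM, inner_sub_right, h.commDL, h.symmL, ← hx, ← h.commML, ← h.symmM,
      real_inner_comm] at h1
    have h2 : ⟪L v, M x⟫ = ⟪M x, L v⟫ := real_inner_comm _ _
    have h3 : ⟪M x, L v⟫ = ⟪L v, M x⟫ := real_inner_comm _ _
    have h4 : ⟪M (L v), M x⟫ = ⟪M (L v), M x⟫ := rfl
    linarith
  have hST : 2 * ⟪S, T⟫ = 4 * b * ‖M x‖ ^ 2 - 6 * b * ‖M (M v)‖ ^ 2 +
      4 * b * (a ^ 2 * ‖M v‖ ^ 2 + 2 * a * b * ⟪M (M v), M v⟫ + b ^ 2 * ‖M (M v)‖ ^ 2) := by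
    simp only [hS, hT, inner_add_left, inner_sub_left, inner_add_right, inner_sub_right,
      real_inner_smul_left, real_inner_smul_right]
    rw [e1, e3, e4, e6, e8, e9, e10, e12, e13]
    linear_combination (2 * b) * e2 + 2 * (a ^ 2 * b - c * b) * e5 + 4 * a ^ 2 * b * e7 +
      2 * b ^ 3 * e11 + 2 * b * e14
  have hM : ‖M (a • v + b • M v)‖ ^ 2 =
      a ^ 2 * ‖M v‖ ^ 2 + 2 * a * b * ⟪M (M v), M v⟫ + b ^ 2 * ‖M (M v)‖ ^ 2 := by
    rw [map_add, map_smul, map_smul, norm_add_sq_real, norm_smul, norm_smul,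
      real_inner_smul_left, real_inner_smul_right, e9, mul_pow, mul_pow, Real.norm_eq_abs,
      Real.norm_eq_abs, sq_abs, sq_abs]
    ring
  have hH := h.hardy v
  have hH2 : 9 * ‖M (M v)‖ ^ 2 ≤ 4 * ‖M x‖ ^ 2 := by
    have := mul_self_le_mul_self (by positivity) hH
    nlinarith
  rw [hP, norm_add_sq_real, hST, ← hM]
  nlinarith [sq_nonneg ‖S‖, sq_nonneg ‖T‖, mul_le_mul_of_nonneg_left hH2 hb]

lemma norm_M_comb_le {a b : ℝ} (hb : 0 ≤ b) (v : V) :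
    ‖a • v + b • M v‖ ≤ (|a| + b * ε) * ‖v‖ := by
  calc ‖a • v + b • M v‖ ≤ |a| * ‖v‖ + b * ‖M v‖ := by
        refine (norm_add_le _ _).trans ?_
        rw [norm_smul, norm_smul, Real.norm_eq_abs, Real.norm_eq_abs, abs_of_nonneg hb]
    _ ≤ |a| * ‖v‖ + b * (ε * ‖v‖) := by gcongr; exact h.smallM v
    _ = _ := by ring

/-- The Carleman inequality away from the resonance `a = 0`. -/
lemma norm_M_le_of_nonresonant (c : ℝ) {a b : ℝ} (hb : 0 ≤ b) (hab : b * ε ≤ |a| / 2) (v : V) :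
    b * |a| ^ 2 * ‖M v‖ ^ 2 ≤ ‖conjOp D M L c a b v‖ ^ 2 := by
  have h1 := h.norm_conjOp_sq_ge c a hb v
  have h2 : |a| / 2 * ‖M v‖ ≤ ‖M (a • v + b • M v)‖ := by
    have h3 : ‖b • M (M v)‖ ≤ |a| / 2 * ‖M v‖ := by
      rw [norm_smul, Real.norm_eq_abs, abs_of_nonneg hb]
      calc b * ‖M (M v)‖ ≤ b * (ε * ‖M v‖) := by gcongr; exact h.smallM _
        _ = b * ε * ‖M v‖ := by ring
        _ ≤ _ := by gcongr
    have h4 : ‖a • M v‖ ≤ ‖M (a • v + b • M v)‖ + ‖b • M (M v)‖ := by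
      rw [map_add, map_smul, map_smul]
      exact norm_le_add_norm_add _ _
    rw [norm_smul, Real.norm_eq_abs] at h4
    linarith
  have h5 : (|a| / 2 * ‖M v‖) ^ 2 ≤ ‖M (a • v + b • M v)‖ ^ 2 := by gcongr
  have h6 := mul_le_mul_of_nonneg_left h5 hb
  have h7 : 0 ≤ b * ‖M (D v)‖ ^ 2 := by positivity
  nlinarith

lemma resonant_bounds (c : ℝ) {a b : ℝ} (hb : 1 ≤ b) (v : V) :
    ‖M (M v)‖ ≤ ‖conjOp D M L c a b v‖ ∧ ‖M (D v)‖ ≤ ‖conjOp D M L c a b v‖ ∧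
      ‖M (a • v + b • M v)‖ ≤ ‖conjOp D M L c a b v‖ := by
  have h1 := h.norm_conjOp_sq_ge c a (by linarith : 0 ≤ b) v
  have h2 := h.hardy v
  have hx : ‖M (D v)‖ ^ 2 ≤ ‖conjOp D M L c a b v‖ ^ 2 := by
    nlinarith [sq_nonneg ‖M (D v)‖, sq_nonneg ‖M (a • v + b • M v)‖]
  have hy : ‖M (a • v + b • M v)‖ ^ 2 ≤ ‖conjOp D M L c a b v‖ ^ 2 := by
    nlinarith [sq_nonneg ‖M (D v)‖, sq_nonneg ‖M (a • v + b • M v)‖]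
  have hx' := abs_le_of_sq_le_sq hx (norm_nonneg _)
  have hy' := abs_le_of_sq_le_sq hy (norm_nonneg _)
  rw [abs_of_nonneg (norm_nonneg _)] at hx' hy'
  exact ⟨by linarith [norm_nonneg (M (D v))], hx', hy'⟩

/-- At a resonance the spherical Laplacian is still controlled with a single logarithmic loss. -/
lemma norm_ML_le_of_resonant {c a b : ℝ} (hc : 0 ≤ c) (ha : |a| ≤ 1) (hb : 1 ≤ b)
    (hbε : b * ε ≤ 1) (v : V) :
    ‖M (L v)‖ ≤ 10 * ‖conjOp D M L c a b v‖ := by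
  obtain ⟨h1, h2, h3⟩ := h.resonant_bounds c (a := a) hb v
  have hb0 : 0 ≤ b := by linarith
  set p := ‖conjOp D M L c a b v‖ with hp
  set x := D v with hx
  set f := a • v + b • M v with hf
  set y := M (L v) with hy
  have hp0 : 0 ≤ p := norm_nonneg _
  have hMle : ∀ w, ‖M w‖ ≤ ‖w‖ := fun w => (h.smallM w).trans (by
    nlinarith [norm_nonneg w])
  have hcomb : ∀ w, ‖a • w + b • M w‖ ≤ 2 * ‖w‖ := fun w => (h.norm_M_comb_le hb0 w).trans (by
    gcongr; linarith)
  have hP : conjOp D M L c a b v =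
      D x + (2 : ℝ) • (a • x + b • M x) - b • M (M v) + (a • f + b • M f) + L v - c • v := by
    simp only [conjOp_apply, shiftOp_apply, map_add, map_smul, h.derivM, hf, ← hx]
    module
  have t1 : ⟪conjOp D M L c a b v, M y⟫ ≤ p * ‖y‖ :=
    (real_inner_le_norm _ _).trans (by gcongr; exact hMle y)
  have t2 : ⟪L v, M y⟫ = ‖y‖ ^ 2 := by rw [← h.symmM, real_inner_self_eq_norm_sq]
  have t3 : ⟪v, M y⟫ ≤ 0 := by
    have : ⟪v, M y⟫ = ⟪L (M v), M v⟫ := by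
      rw [← h.symmM, hy, h.commML, real_inner_comm]
    rw [this]; exact h.nonposL _
  have t4 : -⟪D x, M y⟫ ≤ 2 * p * ‖y‖ := by
    have e : -⟪D x, M y⟫ = ⟪L (M x), M x⟫ - 2 * ⟪M (M x), y⟫ := by
      rw [h.skew, hy, h.derivM, h.derivM, h.commDL, map_sub, inner_sub_right, inner_sub_right,
        ← h.symmM x, h.commML (D v), ← hx, h.symmM (M x), h.symmM x (M (M (L v)))]
      rw [real_inner_comm (M x) (L (M x))]
      ring
    have h5 := h.nonposL (M x)
    have h6 : -⟪M (M x), y⟫ ≤ p * ‖y‖ := by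
      refine (neg_le_abs _).trans ((abs_real_inner_le_norm _ _).trans ?_)
      gcongr
      exact (hMle _).trans h2
    linarith
  have t5 : -⟪a • x + b • M x, M y⟫ ≤ 2 * p * ‖y‖ := by
    rw [← h.symmM]
    refine (neg_le_abs _).trans ((abs_real_inner_le_norm _ _).trans ?_)
    gcongr
    rw [map_add, map_smul, map_smul]
    exact (hcomb _).trans (by linarith)
  have t6 : b * ⟪M (M v), M y⟫ ≤ p * ‖y‖ := by
    rw [← h.symmM]
    have h5 : b * ‖M (M (M v))‖ ≤ p := by
      calc b * ‖M (M (M v))‖ ≤ b * (ε * ‖M (M v)‖) := by gcongr; exact h.smallM _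
        _ = b * ε * ‖M (M v)‖ := by ring
        _ ≤ 1 * ‖M (M v)‖ := by gcongr
        _ ≤ p := by linarith
    calc b * ⟪M (M (M v)), y⟫ ≤ b * (‖M (M (M v))‖ * ‖y‖) := by
          gcongr; exact real_inner_le_norm _ _
      _ = b * ‖M (M (M v))‖ * ‖y‖ := by ring
      _ ≤ _ := by gcongr
  have t7 : -⟪a • f + b • M f, M y⟫ ≤ 2 * p * ‖y‖ := by
    rw [← h.symmM]
    refine (neg_le_abs _).trans ((abs_real_inner_le_norm _ _).trans ?_)
    gcongr
    rw [map_add, map_smul, map_smul]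
    exact (hcomb _).trans (by linarith)
  have key : ‖y‖ ^ 2 ≤ 10 * p * ‖y‖ := by
    have e := congrArg (fun z => ⟪z, M y⟫) hP
    simp only [inner_sub_left, inner_add_left (D x + _ - _ + _), inner_add_left (D x + _ - _),
      inner_add_left (D x), real_inner_smul_left] at e
    rw [t2] at e
    nlinarith [mul_nonneg hc (neg_nonneg.2 t3)]
  by_contra! hcon
  have : 0 < ‖y‖ := by linarith
  nlinarith

lemma norm_le_shiftOp {a b : ℝ} (ha : 1 ≤ a) (hb : 0 ≤ b) (hbε : b * ε ≤ 1 / 2) (v : V) :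
    ‖v‖ ≤ 2 * ‖shiftOp D M a b v‖ := by
  have e : ⟪shiftOp D M a b v, v⟫ = a * ‖v‖ ^ 2 + b * ⟪M v, v⟫ := by
    rw [shiftOp_apply, inner_add_left, inner_add_left, h.inner_D_self, real_inner_smul_left,
      real_inner_smul_left, real_inner_self_eq_norm_sq, zero_add]
  have h1 : -⟪M v, v⟫ ≤ ε * ‖v‖ * ‖v‖ :=
    (neg_le_abs _).trans ((abs_real_inner_le_norm _ _).trans (by gcongr; exact h.smallM v))
  have h2 := real_inner_le_norm (shiftOp D M a b v) v
  by_contra! hcon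
  have h0 : 0 < ‖v‖ := (by positivity : 0 ≤ 2 * ‖shiftOp D M a b v‖).trans_lt hcon
  have h3 := mul_le_mul_of_nonneg_left h1 hb
  have h4 : b * (ε * ‖v‖ * ‖v‖) ≤ 1 / 2 * ‖v‖ ^ 2 := by
    have := mul_le_mul_of_nonneg_right hbε (sq_nonneg ‖v‖); nlinarith
  nlinarith [mul_le_mul_of_nonneg_right ha (sq_nonneg ‖v‖)]

lemma pow_antitone (hε : ε ≤ 1) {i j : ℕ} (hij : i ≤ j) (v : V) :
    ‖(M ^ j) v‖ ≤ ‖(M ^ i) v‖ := by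
  induction j, hij using Nat.le_induction with
  | base => rfl
  | succ j _ ih =>
    rw [pow_succ', Module.End.mul_apply]
    refine (h.smallM _).trans (le_trans ?_ ih)
    nlinarith [norm_nonneg ((M ^ j) v)]

/-- One factor of the iterated operator, away from resonance. -/
lemma step_nonresonant {m : ℕ} (hm : 1 ≤ m) (hε0 : 0 ≤ ε) (hε : ε * (16 * m * (m + 2)) ≤ 1)
    {τ a : ℝ} (hτ : 1 < τ) (ha : τ ≤ 8 * m * |a|) (c : ℝ) {j : ℕ} (hj : j ≤ m) (v : V) :
    ‖(M ^ (j + 1)) v‖ ≤ 6 * m / τ ^ (3 / 2 : ℝ) * ‖(M ^ j) (conjOp D M L c a (2 * τ) v)‖ := by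
  have hm' : (1 : ℝ) ≤ m := by exact_mod_cast hm
  have hj' : (j : ℝ) ≤ m := by exact_mod_cast hj
  have hτ0 : 0 < τ := by linarith
  rw [h.pow_mul_conjOp, pow_succ', Module.End.mul_apply]
  have hb : (2 * τ + j) * ε ≤ |a| / 2 := by
    have h1 : (2 * τ + j) ≤ (m + 2) * τ := by nlinarith
    have h2 : (2 * τ + j) * ε ≤ (m + 2) * τ * ε := by gcongr
    have h3 : (m + 2) * τ * ε * (16 * m) ≤ τ := by nlinarith
    have h4 : (2 * τ + j) * ε * (16 * m) ≤ |a| / 2 * (16 * m) := by nlinarith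
    exact le_of_mul_le_mul_right h4 (by linarith)
  have h1 := h.norm_M_le_of_nonresonant c (by positivity) hb ((M ^ j) v)
  set x := ‖M ((M ^ j) v)‖
  set p := ‖conjOp D M L c a (2 * τ + j) ((M ^ j) v)‖
  have h2 : τ ^ 2 ≤ 64 * m ^ 2 * |a| ^ 2 := by
    calc τ ^ 2 ≤ (8 * m * |a|) ^ 2 := by gcongr
      _ = _ := by ring
  have hsq : (τ ^ (3 / 2 : ℝ)) ^ 2 = τ ^ 3 := by
    rw [← Real.rpow_natCast, ← Real.rpow_mul hτ0.le, ← Real.rpow_natCast]; norm_num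
  have h3 : (τ ^ (3 / 2 : ℝ) * x) ^ 2 ≤ (6 * m * p) ^ 2 := by
    rw [mul_pow, hsq]
    calc τ ^ 3 * x ^ 2 = τ ^ 2 * (τ * x ^ 2) := by ring
      _ ≤ 64 * m ^ 2 * |a| ^ 2 * (τ * x ^ 2) := by gcongr
      _ = 32 * m ^ 2 * ((2 * τ) * |a| ^ 2 * x ^ 2) := by ring
      _ ≤ 32 * m ^ 2 * ((2 * τ + j) * |a| ^ 2 * x ^ 2) := by
        gcongr; linarith [(Nat.cast_nonneg j : (0 : ℝ) ≤ j)]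
      _ ≤ 32 * m ^ 2 * p ^ 2 := by gcongr
      _ ≤ _ := by nlinarith [sq_nonneg (m * p)]
  have h4 := abs_le_of_sq_le_sq h3 (by positivity)
  have h5 : 0 < τ ^ (3 / 2 : ℝ) := by positivity
  rw [div_mul_eq_mul_div, le_div_iff₀ h5]
  linarith [le_abs_self (τ ^ (3 / 2 : ℝ) * x)]

/-- The iterated Carleman inequality: the iterated operator controls all intermediate stages with a
logarithmic loss of order `m`. -/
theorem iterated_carleman {m : ℕ} (hm : 1 ≤ m) (hε0 : 0 ≤ ε) (hε : ε * (16 * m * (m + 2)) ≤ 1)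
    {κ : ℝ} (hκ : 0 ≤ κ) {τ : ℝ} (hτ : 1 < τ) (v : ℕ → V)
    (hv : ∀ k < m, v (k + 1) = conjOp D M L (κ ^ 2) (τ - 2 * k + κ) (2 * τ) (v k))
    {k : ℕ} (hk : k ≤ m) :
    τ ^ ((3 * m - 4 * k) / 2 : ℝ) * ‖(M ^ m) (v k)‖ ≤
      (44 * (6 * m) ^ m * (2 * m) ^ (2 * m)) * ‖v m‖ := by
  have hm' : (1 : ℝ) ≤ m := by exact_mod_cast hm
  have hτ0 : 0 < τ := by linarith
  have hε1 : ε ≤ 1 := by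
    have : (1 : ℝ) ≤ 16 * m * (m + 2) := by nlinarith
    nlinarith
  have hbig : (1 : ℝ) ≤ (2 * m) ^ (2 * m) := one_le_pow₀ (by linarith)
  have hK1 : (1 : ℝ) ≤ 6 * m := by linarith
  have hstep : ∀ k < m, 1 / 2 ≤ |τ - 2 * k + κ| → ∀ j ≤ m,
      ‖(M ^ (j + 1)) (v k)‖ ≤ 6 * m / τ ^ (3 / 2 : ℝ) * ‖(M ^ j) (v (k + 1))‖ := by
    intro k hk ha j hj
    rw [hv k hk]
    refine h.step_nonresonant hm hε0 hε hτ ?_ _ hj _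
    have hk' : (k : ℝ) ≤ m := by exact_mod_cast hk.le
    rcases le_total τ (4 * m) with h1 | h1
    · nlinarith
    · have := le_abs_self (τ - 2 * k + κ)
      nlinarith [abs_nonneg (τ - 2 * k + κ)]
  have hτ32 : 1 ≤ τ ^ (3 / 2 : ℝ) := Real.one_le_rpow hτ.le (by norm_num)
  by_cases hres : ∃ k₀ < m, |τ - 2 * k₀ + κ| < 1 / 2
  · obtain ⟨q, hq, hqa⟩ := hres
    have hqm : (q : ℝ) + 1 ≤ m := by exact_mod_cast hq
    have hqa' := abs_lt.1 hqa
    have hq1 : 1 ≤ q := by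
      rcases Nat.eq_zero_or_pos q with h0 | h0
      · subst h0; norm_num at hqa'; linarith
      · exact h0
    have hτm : τ ≤ 2 * m := by linarith
    have hother : ∀ k, k ≠ q → 1 / 2 ≤ |τ - 2 * k + κ| := by
      intro k hkq
      rcases lt_or_gt_of_ne hkq with h1 | h1
      · have : (k : ℝ) + 1 ≤ q := by exact_mod_cast h1
        rw [le_abs]; left; linarith
      · have : (q : ℝ) + 1 ≤ k := by exact_mod_cast h1
        rw [le_abs]; right; linarith
    have hKτ : 6 * m / τ ^ (3 / 2 : ℝ) ≤ 6 * m := div_le_self (by linarith) hτ32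
    have hb : ∀ j ≤ m, (2 * τ + j) * ε ≤ 1 / 2 := by
      intro j hj
      have hj' : (j : ℝ) ≤ m := by exact_mod_cast hj
      have h1 : (2 * τ + j) ≤ (m + 2) * (2 * m) := by nlinarith
      have h2 : (2 * τ + j) * ε ≤ (m + 2) * (2 * m) * ε := by gcongr
      nlinarith
    have habove : ∀ k, q < k → k ≤ m → ‖(M ^ (m - k)) (v k)‖ ≤ (6 * m) ^ (m - k) * ‖v m‖ := by
      intro k hqk hkm
      have := pow_norm_chain (M := M) (by linarith : (0 : ℝ) ≤ 6 * m) v (m := m) (p := k) m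
        (fun k' h1 h2 j hj => (hstep k' h2 (hother k' (by omega)) j hj).trans (by gcongr))
        (m - k) 0 (by omega) k le_rfl (by omega)
      simpa using this
    have hq' := habove (q + 1) (by omega) (by omega)
    have hcast := hv q hq
    have hres1 : ‖(M ^ (m - (q + 1) + 2)) (v q)‖ ≤ (6 * m) ^ (m - (q + 1)) * ‖v m‖ := by
      refine le_trans ?_ hq'
      rw [hcast, h.pow_mul_conjOp, add_comm _ 2, pow_add, pow_two, Module.End.mul_apply,
        Module.End.mul_apply]
      exact (h.resonant_bounds _ (by
        linarith [(Nat.cast_nonneg (m - (q + 1)) : (0 : ℝ) ≤ _)]) _).1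
    have hres2 : ‖(M ^ (m - (q + 1) + 1)) (L (v q))‖ ≤
        10 * ((6 * m) ^ (m - (q + 1)) * ‖v m‖) := by
      refine le_trans ?_ (mul_le_mul_of_nonneg_left hq' (by norm_num))
      rw [hcast, h.pow_mul_conjOp, pow_succ', Module.End.mul_apply, h.comm_pow]
      refine h.norm_ML_le_of_resonant (by positivity) (by linarith) ?_ ?_ _
      · linarith [(Nat.cast_nonneg (m - (q + 1)) : (0 : ℝ) ≤ _)]
      · linarith [hb (m - (q + 1)) (by omega)]
    have hbelow : ∀ k ≤ q, ‖(M ^ (m - k + 1)) (v k)‖ ≤ (6 * m) ^ m * ‖v m‖ := by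
      intro k hkq
      have := pow_norm_chain (M := M) (by linarith : (0 : ℝ) ≤ 6 * m) v (m := m) (p := k) q
        (fun k' h1 h2 j hj => (hstep k' (by omega) (hother k' (by omega)) j hj).trans
          (by gcongr)) (q - k) (m - (q + 1) + 2) (by omega) k le_rfl (by omega)
      rw [show m - (q + 1) + 2 + (q - k) = m - k + 1 by omega] at this
      calc _ ≤ _ := this
        _ ≤ (6 * m) ^ (q - k) * ((6 * m) ^ (m - (q + 1)) * ‖v m‖) := by gcongr
        _ = (6 * m) ^ (q - k + (m - (q + 1))) * ‖v m‖ := by rw [pow_add]; ring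
        _ ≤ _ := by gcongr; omega
    have hL : ‖(M ^ m) (L (v 0))‖ ≤ 10 * ((6 * m) ^ m * ‖v m‖) := by
      have := pow_norm_chain (M := M) (by linarith : (0 : ℝ) ≤ 6 * m) (fun k => L (v k)) (m := m)
        (p := 0) q (fun k' h1 h2 j hj => by
          have hk' : k' < m := by omega
          have h5 := h.step_nonresonant hm hε0 hε hτ (a := τ - 2 * k' + κ) (by
            have h6 := hother k' (by omega)
            have h7 : (k' : ℝ) ≤ m := by exact_mod_cast hk'.le
            nlinarith) (κ ^ 2) hj (L (v k'))
          rw [← h.comm_conjOp, ← hv k' hk'] at h5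
          exact h5.trans (by gcongr)) q (m - (q + 1) + 1) (by omega) 0 le_rfl (by omega)
      rw [show m - (q + 1) + 1 + q = m by omega] at this
      calc _ ≤ _ := this
        _ ≤ (6 * m) ^ q * (10 * ((6 * m) ^ (m - (q + 1)) * ‖v m‖)) := by gcongr
        _ = 10 * ((6 * m) ^ (q + (m - (q + 1))) * ‖v m‖) := by rw [pow_add]; ring
        _ ≤ _ := by gcongr; omega
    have hall : ∀ k, 1 ≤ k → k ≤ m → ‖(M ^ m) (v k)‖ ≤ (6 * m) ^ m * ‖v m‖ := by
      intro k h1 hkm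
      rcases le_or_gt k q with h2 | h2
      · exact (h.pow_antitone hε1 (by omega) _).trans (hbelow k h2)
      · refine (h.pow_antitone hε1 (Nat.sub_le m k) _).trans ((habove k h2 hkm).trans ?_)
        gcongr; omega
    have hzero : ‖(M ^ m) (v 0)‖ ≤ 44 * (6 * m) ^ m * ‖v m‖ := by
      have e : shiftOp D M τ (2 * τ) (shiftOp D M (τ + 2 * κ) (2 * τ) (v 0)) =
          v 1 - L (v 0) := by
        rw [hv 0 (by omega)]
        simp only [conjOp_apply, shiftOp_apply, map_add, map_smul, h.derivM]
        push_cast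
        module
      have e' := congrArg (M ^ m) e
      rw [h.pow_mul_shiftOp, h.pow_mul_shiftOp, map_sub] at e'
      have h1 := h.norm_le_shiftOp (a := τ + 2 * κ) (b := 2 * τ + m) (by linarith)
        (by positivity) (hb m le_rfl) ((M ^ m) (v 0))
      have h2 := h.norm_le_shiftOp (a := τ) (b := 2 * τ + m) (by linarith)
        (by positivity) (hb m le_rfl)
        (shiftOp D M (τ + 2 * κ) (2 * τ + m) ((M ^ m) (v 0)))
      rw [e'] at h2
      have h3 := norm_sub_le ((M ^ m) (v 1)) ((M ^ m) (L (v 0)))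
      have h4 := hall 1 le_rfl (by omega)
      linarith
    have hp : τ ^ ((3 * m - 4 * k) / 2 : ℝ) ≤ (2 * m) ^ (2 * m) := by
      calc τ ^ ((3 * m - 4 * k) / 2 : ℝ) ≤ τ ^ ((2 * m : ℕ) : ℝ) := by
            apply Real.rpow_le_rpow_of_exponent_le hτ.le
            push_cast; linarith [(Nat.cast_nonneg k : (0 : ℝ) ≤ k)]
        _ = τ ^ (2 * m) := Real.rpow_natCast _ _
        _ ≤ _ := by gcongr
    have hM : ‖(M ^ m) (v k)‖ ≤ 44 * (6 * m) ^ m * ‖v m‖ := by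
      rcases Nat.eq_zero_or_pos k with h0 | h0
      · rw [h0]; exact hzero
      · refine (hall k h0 hk).trans ?_
        have : 0 ≤ (6 * m : ℝ) ^ m * ‖v m‖ := by positivity
        linarith
    calc _ ≤ (2 * m : ℝ) ^ (2 * m) * (44 * (6 * m) ^ m * ‖v m‖) := by gcongr
      _ = _ := by ring
  · push Not at hres
    have h1 := pow_norm_chain (M := M) (by positivity : (0 : ℝ) ≤ 6 * m / τ ^ (3 / 2 : ℝ)) v
      (m := m) (p := k) m (fun k' h1 h2 j hj => hstep k' h2 (hres k' h2) j hj)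
      (m - k) 0 (by omega) k le_rfl (by omega)
    simp only [zero_add, pow_zero, Module.End.one_apply] at h1
    have h2 := (h.pow_antitone hε1 (Nat.sub_le m k) (v k)).trans h1
    have h3 : τ ^ ((3 * m - 4 * k) / 2 : ℝ) ≤ (τ ^ (3 / 2 : ℝ)) ^ (m - k) := by
      rw [← Real.rpow_natCast, ← Real.rpow_mul hτ0.le]
      apply Real.rpow_le_rpow_of_exponent_le hτ.le
      rw [Nat.cast_sub hk]
      linarith [(Nat.cast_nonneg k : (0 : ℝ) ≤ k)]
    have h4 : (6 * m : ℝ) ^ (m - k) ≤ (6 * m) ^ m := pow_le_pow_right₀ hK1 (by omega)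
    calc _ ≤ (τ ^ (3 / 2 : ℝ)) ^ (m - k) * ((6 * m / τ ^ (3 / 2 : ℝ)) ^ (m - k) * ‖v m‖) := by
          gcongr
      _ = (6 * m) ^ (m - k) * ‖v m‖ := by
          rw [div_pow]; field_simp
      _ ≤ (6 * m) ^ m * ‖v m‖ := by gcongr
      _ ≤ _ := by
        gcongr
        have : (0 : ℝ) < (6 * m) ^ m := by positivity
        nlinarith

end LogPolar

end AbstractCarleman

section TestSpace

variable {n : ℕ} {R : ℝ}

/-- The punctured ball. -/
def punctured (n : ℕ) (R : ℝ) : Set (EuclideanSpace ℝ (Fin n)) := Metric.ball 0 R \ {0}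

lemma isOpen_punctured : IsOpen (punctured n R) := Metric.isOpen_ball.sdiff isClosed_singleton

/-- The space of test functions supported in the punctured ball. -/
def testSpace (n : ℕ) (R : ℝ) : Submodule ℝ (EuclideanSpace ℝ (Fin n) → ℂ) where
  carrier := {u | IsTestFunction 0 R u}
  add_mem' {u v} hu hv := ⟨hu.1.add hv.1, hu.2.1.add hv.2.1,
    (tsupport_add u v).trans (Set.union_subset hu.2.2 hv.2.2)⟩
  zero_mem' := ⟨contDiff_const, HasCompactSupport.zero, by simp [tsupport]⟩
  smul_mem' c u hu := ⟨contDiff_const.smul hu.1, hu.2.1.smul_left (f := fun _ => c),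
    (tsupport_smul_subset_right (fun _ => c) u).trans hu.2.2⟩

lemma testSpace_contDiff (u : testSpace n R) : ContDiff ℝ ∞ (u : EuclideanSpace ℝ (Fin n) → ℂ) :=
  u.2.1

lemma testSpace_compact (u : testSpace n R) :
    HasCompactSupport (u : EuclideanSpace ℝ (Fin n) → ℂ) := u.2.2.1

lemma testSpace_tsupport (u : testSpace n R) :
    tsupport (u : EuclideanSpace ℝ (Fin n) → ℂ) ⊆ punctured n R := u.2.2.2

lemma testSpace_apply_eq_zero (u : testSpace n R) {x : EuclideanSpace ℝ (Fin n)}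
    (hx : x ∉ punctured n R) : u.1 x = 0 :=
  image_eq_zero_of_notMem_tsupport fun h => hx (testSpace_tsupport u h)

lemma testSpace_differentiable (u : testSpace n R) : Differentiable ℝ u.1 :=
  (testSpace_contDiff u).differentiable (by simp)

/-- The partial derivative on test functions. -/
noncomputable def pderiv (i : Fin n) : testSpace n R →ₗ[ℝ] testSpace n R where
  toFun u := ⟨partialDeriv i u,
    ((testSpace_contDiff u).fderiv_right (m := ∞) (by simp)).clm_apply contDiff_const,
    (testSpace_compact u).fderiv_apply ℝ _,
    (tsupport_fderiv_apply_subset ℝ _).trans (testSpace_tsupport u)⟩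
  map_add' u v := by
    ext x
    simp [partialDeriv, fderiv_add (testSpace_differentiable u x) (testSpace_differentiable v x)]
  map_smul' c u := by
    ext x
    simp [partialDeriv, fderiv_const_smul (testSpace_differentiable u x)]

lemma pderiv_comm (i j : Fin n) (u : testSpace n R) :
    pderiv i (pderiv j u) = pderiv j (pderiv i u) := by
  ext x
  have hd : Differentiable ℝ (fderiv ℝ u.1) :=
    ((testSpace_contDiff u).fderiv_right (m := ∞) (by simp)).differentiable (by simp)
  have hs : IsSymmSndFDerivAt ℝ u.1 x :=
    (testSpace_contDiff u).contDiffAt.isSymmSndFDerivAt (by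
      rw [minSmoothness_of_isRCLikeNormedField]
      exact WithTop.coe_le_coe.2 (le_top : (2 : ℕ∞) ≤ ⊤))
  have e : ∀ v w : EuclideanSpace ℝ (Fin n),
      fderiv ℝ (fun y => fderiv ℝ u.1 y v) x w = fderiv ℝ (fderiv ℝ u.1) x w v := by
    intro v w
    rw [fderiv_clm_apply (hd x) (differentiableAt_const v)]
    simp
  exact (e _ _).trans ((hs.eq _ _).trans (e _ _).symm)

/-- A function which is smooth on the punctured ball. -/
def IsMultiplier (R : ℝ) (g : EuclideanSpace ℝ (Fin n) → ℝ) : Prop :=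
  ContDiffOn ℝ ∞ g (punctured n R)

lemma IsMultiplier.contDiffAt {g : EuclideanSpace ℝ (Fin n) → ℝ} (hg : IsMultiplier R g)
    {x : EuclideanSpace ℝ (Fin n)} (hx : x ∈ punctured n R) : ContDiffAt ℝ ∞ g x :=
  ContDiffOn.contDiffAt hg (isOpen_punctured.mem_nhds hx)

lemma IsMultiplier.differentiableAt {g : EuclideanSpace ℝ (Fin n) → ℝ} (hg : IsMultiplier R g)
    {x : EuclideanSpace ℝ (Fin n)} (hx : x ∈ punctured n R) : DifferentiableAt ℝ g x :=
  (hg.contDiffAt hx).differentiableAt (by simp)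

lemma IsMultiplier.mul {f g : EuclideanSpace ℝ (Fin n) → ℝ} (hf : IsMultiplier R f)
    (hg : IsMultiplier R g) : IsMultiplier R (fun x => f x * g x) := ContDiffOn.mul hf hg

/-- Multiplication of a test function by a smooth function. -/
noncomputable def mulOp (g : EuclideanSpace ℝ (Fin n) → ℝ) (hg : IsMultiplier R g) :
    testSpace n R →ₗ[ℝ] testSpace n R where
  toFun u := ⟨fun x => g x • u.1 x, by
    rw [contDiff_iff_contDiffAt]
    intro x
    by_cases hx : x ∈ tsupport u.1
    · exact (hg.contDiffAt (testSpace_tsupport u hx)).smul (testSpace_contDiff u).contDiffAt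
    · refine (contDiffAt_const (c := (0 : ℂ))).congr_of_eventuallyEq ?_
      filter_upwards [notMem_tsupport_iff_eventuallyEq.1 hx] with y hy
      simp [hy],
    (testSpace_compact u).mono fun x hx hu => hx (by
      simp [Function.notMem_support.1 (not_not.2 hu)]),
    (tsupport_smul_subset_right g u.1).trans (testSpace_tsupport u)⟩
  map_add' u v := by ext x; simp
  map_smul' c u := by ext x; simp; ring

lemma mulOp_apply (g : EuclideanSpace ℝ (Fin n) → ℝ) (hg : IsMultiplier R g) (u : testSpace n R)
    (x : EuclideanSpace ℝ (Fin n)) : (mulOp g hg u).1 x = g x • u.1 x := rfl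

lemma mulOp_congr {f g : EuclideanSpace ℝ (Fin n) → ℝ} (hf : IsMultiplier R f)
    (hg : IsMultiplier R g) (h : ∀ x ∈ punctured n R, f x = g x) : mulOp f hf = mulOp g hg := by
  ext u x
  simp only [mulOp_apply]
  by_cases hx : x ∈ punctured n R
  · rw [h x hx]
  · simp [testSpace_apply_eq_zero u hx]

lemma mulOp_mulOp {f g : EuclideanSpace ℝ (Fin n) → ℝ} (hf : IsMultiplier R f)
    (hg : IsMultiplier R g) (u : testSpace n R) :
    mulOp f hf (mulOp g hg u) = mulOp (fun x => f x * g x) (hf.mul hg) u := by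
  ext x; simp [mulOp_apply, mul_assoc]

lemma mulOp_comm {f g : EuclideanSpace ℝ (Fin n) → ℝ} (hf : IsMultiplier R f)
    (hg : IsMultiplier R g) (u : testSpace n R) :
    mulOp f hf (mulOp g hg u) = mulOp g hg (mulOp f hf u) := by
  ext x; simp [mulOp_apply]; ring

/-- The product rule. -/
lemma pderiv_mulOp {g g' : EuclideanSpace ℝ (Fin n) → ℝ} (hg : IsMultiplier R g)
    (hg' : IsMultiplier R g') (i : Fin n)
    (h : ∀ x ∈ punctured n R, fderiv ℝ g x (EuclideanSpace.single i 1) = g' x)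
    (u : testSpace n R) :
    pderiv i (mulOp g hg u) = mulOp g hg (pderiv i u) + mulOp g' hg' u := by
  ext x
  change fderiv ℝ (fun x => g x • u.1 x) x _ = g x • fderiv ℝ u.1 x _ + g' x • u.1 x
  by_cases hx : x ∈ punctured n R
  · rw [fderiv_fun_smul (hg.differentiableAt hx) (testSpace_differentiable u x)]
    simp [h x hx]
  · have h1 : x ∉ tsupport (mulOp g hg u).1 := fun h => hx (testSpace_tsupport _ h)
    have h2 : x ∉ tsupport (pderiv i u).1 := fun h => hx (testSpace_tsupport _ h)
    have h3 : x ∉ tsupport (pderiv i (mulOp g hg u)).1 := fun h => hx (testSpace_tsupport _ h)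
    have h4 := image_eq_zero_of_notMem_tsupport h2
    have h5 := image_eq_zero_of_notMem_tsupport h3
    rw [testSpace_apply_eq_zero u hx]
    change fderiv ℝ u.1 x _ = 0 at h4
    change fderiv ℝ (fun x => g x • u.1 x) x _ = 0 at h5
    rw [h4, h5]; simp

/-- The unweighted real inner product of test functions. -/
noncomputable def l2form (n : ℕ) (R : ℝ) : testSpace n R →ₗ[ℝ] testSpace n R →ₗ[ℝ] ℝ :=
  have hint : ∀ u v : testSpace n R, Integrable (fun x => inner ℝ (u.1 x) (v.1 x)) volume :=
    fun u v => ((testSpace_contDiff u).continuous.inner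
      (testSpace_contDiff v).continuous).integrable_of_hasCompactSupport
        ((testSpace_compact u).mono (by
          intro x hx hu
          simp_all))
  LinearMap.mk₂ ℝ (fun u v => ∫ x, inner ℝ (u.1 x) (v.1 x))
    (fun u u' v => by
      rw [← integral_add (hint u v) (hint u' v)]
      simp [inner_add_left])
    (fun c u v => by
      rw [smul_eq_mul, ← integral_const_mul]
      simp only [Submodule.coe_smul, Pi.smul_apply, real_inner_smul_left])
    (fun u v v' => by
      rw [← integral_add (hint u v) (hint u v')]
      simp [inner_add_right])
    (fun c u v => by
      rw [smul_eq_mul, ← integral_const_mul]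
      simp only [Submodule.coe_smul, Pi.smul_apply, real_inner_smul_right])

lemma l2form_apply (u v : testSpace n R) :
    l2form n R u v = ∫ x, inner ℝ (u.1 x) (v.1 x) := rfl

lemma l2form_integrable (u v : testSpace n R) :
    Integrable (fun x => inner ℝ (u.1 x) (v.1 x)) volume :=
  ((testSpace_contDiff u).continuous.inner
      (testSpace_contDiff v).continuous).integrable_of_hasCompactSupport
        ((testSpace_compact u).mono (by
          intro x hx hu
          simp_all))

lemma l2form_comm (u v : testSpace n R) : l2form n R u v = l2form n R v u := by
  simp only [l2form_apply, real_inner_comm]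

lemma l2form_self_nonneg (u : testSpace n R) : 0 ≤ l2form n R u u := by
  rw [l2form_apply]
  exact integral_nonneg fun x => real_inner_self_nonneg

lemma l2form_mulOp {g : EuclideanSpace ℝ (Fin n) → ℝ} (hg : IsMultiplier R g)
    (u v : testSpace n R) : l2form n R (mulOp g hg u) v = l2form n R u (mulOp g hg v) := by
  simp only [l2form_apply, mulOp_apply, real_inner_smul_left, real_inner_smul_right]

/-- Integration by parts. -/
lemma l2form_pderiv (i : Fin n) (u v : testSpace n R) :
    l2form n R (pderiv i u) v = -l2form n R u (pderiv i v) := by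
  have := integral_bilinear_fderiv_right_eq_neg_left_of_integrable
    (μ := (volume : Measure (EuclideanSpace ℝ (Fin n)))) (f := u.1) (g := v.1)
    (v := EuclideanSpace.single i (1 : ℝ)) (B := innerSL ℝ)
    (l2form_integrable (pderiv i u) v) (l2form_integrable u (pderiv i v))
    (l2form_integrable u v) (fun x _ => testSpace_differentiable u x)
    (fun x _ => testSpace_differentiable v x)
  have h2 : l2form n R u (pderiv i v) = -l2form n R (pderiv i u) v := this
  rw [h2, neg_neg]

/-- The function `G (log r)`. -/
noncomputable def radial (G : ℝ → ℝ) (x : EuclideanSpace ℝ (Fin n)) : ℝ := G (Real.log ‖x‖)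

lemma norm_pos_of_punctured {x : EuclideanSpace ℝ (Fin n)} (hx : x ∈ punctured n R) : 0 < ‖x‖ :=
  norm_pos_iff.2 hx.2

lemma norm_lt_of_punctured {x : EuclideanSpace ℝ (Fin n)} (hx : x ∈ punctured n R) : ‖x‖ < R := by
  simpa using hx.1

lemma log_neg_of_punctured (hR : R ≤ 1) {x : EuclideanSpace ℝ (Fin n)} (hx : x ∈ punctured n R) :
    Real.log ‖x‖ < 0 :=
  Real.log_neg (norm_pos_of_punctured hx) ((norm_lt_of_punctured hx).trans_le hR)

lemma hasFDerivAt_log_norm {x : EuclideanSpace ℝ (Fin n)} (hx : x ≠ 0) :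
    HasFDerivAt (fun y : EuclideanSpace ℝ (Fin n) => Real.log ‖y‖)
      ((‖x‖ ^ 2)⁻¹ • innerSL ℝ x) x := by
  have h1 := ((hasStrictFDerivAt_norm_sq x).hasFDerivAt.log (by
    have := norm_pos_iff.2 hx; positivity)).const_mul (1 / 2 : ℝ)
  have e : (fun y : EuclideanSpace ℝ (Fin n) => Real.log ‖y‖) =
      fun y => 1 / 2 * Real.log (‖y‖ ^ 2) := by
    ext y; rw [Real.log_pow]; push_cast; ring
  rw [e]
  refine h1.congr_fderiv ?_
  ext y
  simp
  ring

/-- A function which is smooth on the negative half line. -/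
def SmoothNeg (G : ℝ → ℝ) : Prop := ContDiffOn ℝ ∞ G (Set.Iio 0)

lemma SmoothNeg.mul {F G : ℝ → ℝ} (hF : SmoothNeg F) (hG : SmoothNeg G) :
    SmoothNeg fun t => F t * G t := ContDiffOn.mul hF hG

lemma smoothNeg_exp (c : ℝ) : SmoothNeg fun t => Real.exp (c * t) :=
  (Real.contDiff_exp.comp (contDiff_const.mul contDiff_id)).contDiffOn

lemma SmoothNeg.isMultiplier {G : ℝ → ℝ} (hG : SmoothNeg G) (hR : R ≤ 1) :
    IsMultiplier R (radial G : EuclideanSpace ℝ (Fin n) → ℝ) := by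
  intro x hx
  refine ContDiffAt.contDiffWithinAt ?_
  refine (ContDiffOn.contDiffAt hG (Iio_mem_nhds (log_neg_of_punctured hR hx))).comp x ?_
  exact (contDiffAt_norm ℝ hx.2).log (norm_pos_of_punctured hx).ne'

lemma isMultiplier_coord (i : Fin n) :
    IsMultiplier R (fun x : EuclideanSpace ℝ (Fin n) => x i) :=
  (contDiff_piLp_apply (p := 2) (i := i)).contDiffOn

/-- Multiplication by a coordinate. -/
noncomputable def coordOp (i : Fin n) : testSpace n R →ₗ[ℝ] testSpace n R :=
  mulOp (fun x => x i) (isMultiplier_coord i)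

/-- Multiplication by a radial function. -/
noncomputable def radOp (hR : R ≤ 1) (G : ℝ → ℝ) (hG : SmoothNeg G) :
    testSpace n R →ₗ[ℝ] testSpace n R := mulOp (radial G) (hG.isMultiplier hR)

lemma radOp_apply (hR : R ≤ 1) {G : ℝ → ℝ} (hG : SmoothNeg G) (u : testSpace n R)
    (x : EuclideanSpace ℝ (Fin n)) : (radOp hR G hG u).1 x = G (Real.log ‖x‖) • u.1 x := rfl

lemma radOp_congr (hR : R ≤ 1) {F G : ℝ → ℝ} (hF : SmoothNeg F) (hG : SmoothNeg G)
    (h : ∀ t < 0, F t = G t) : radOp (n := n) hR F hF = radOp hR G hG :=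
  mulOp_congr _ _ fun _ hx => h _ (log_neg_of_punctured hR hx)

lemma radOp_radOp (hR : R ≤ 1) {F G : ℝ → ℝ} (hF : SmoothNeg F) (hG : SmoothNeg G)
    (u : testSpace n R) :
    radOp hR F hF (radOp hR G hG u) = radOp hR (fun t => F t * G t) (hF.mul hG) u :=
  mulOp_mulOp _ _ u

lemma radOp_eq_self (hR : R ≤ 1) {F : ℝ → ℝ} (hF : SmoothNeg F) (h : ∀ t < 0, F t = 1)
    (u : testSpace n R) : radOp hR F hF u = u := by
  ext x
  rw [radOp_apply]
  by_cases hx : x ∈ punctured n R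
  · rw [h _ (log_neg_of_punctured hR hx), one_smul]
  · simp [testSpace_apply_eq_zero u hx]

lemma pderiv_coordOp (i j : Fin n) (u : testSpace n R) :
    pderiv i (coordOp j u) = coordOp j (pderiv i u) + (if i = j then u else 0) := by
  have h := pderiv_mulOp (R := R) (g' := fun _ => if i = j then 1 else 0) (isMultiplier_coord j)
    (show IsMultiplier R _ from contDiffOn_const) i (fun x _ => by
      have : (fun x : EuclideanSpace ℝ (Fin n) => x j) =
        (EuclideanSpace.proj j : EuclideanSpace ℝ (Fin n) →L[ℝ] ℝ) := rfl
      rw [this, ContinuousLinearMap.fderiv]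
      simp [eq_comm]) u
  rw [coordOp, h]
  congr 1
  ext x
  split_ifs with hij <;> simp [mulOp_apply]

lemma pderiv_radOp (hR : R ≤ 1) {G G' : ℝ → ℝ} (hG : SmoothNeg G) (hG' : SmoothNeg G')
    (hd : ∀ t < 0, HasDerivAt G (G' t) t) (i : Fin n) (u : testSpace n R) :
    pderiv i (radOp hR G hG u) = radOp hR G hG (pderiv i u) +
      coordOp i (radOp hR (fun t => Real.exp (-2 * t)) (smoothNeg_exp _) (radOp hR G' hG' u)) := by
  rw [radOp_radOp]
  have h := pderiv_mulOp (hG.isMultiplier hR)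
    ((isMultiplier_coord i).mul (((smoothNeg_exp (-2)).mul hG').isMultiplier hR)) i
    (fun x hx => by
      have h1 := (hd _ (log_neg_of_punctured hR hx)).comp_hasFDerivAt x (hasFDerivAt_log_norm hx.2)
      have h2 : fderiv ℝ (radial G) x = _ := h1.fderiv
      rw [h2]
      have h3 : Real.exp (-2 * Real.log ‖x‖) = (‖x‖ ^ 2)⁻¹ := by
        rw [neg_mul, Real.exp_neg, two_mul, Real.exp_add, Real.exp_log (norm_pos_of_punctured hx),
          pow_two]
      simp only [radial, h3]
      simp [EuclideanSpace.inner_single_right]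
      ring) u
  rw [radOp, h, coordOp, radOp, mulOp_mulOp]

lemma coordOp_radOp (hR : R ≤ 1) {G : ℝ → ℝ} (hG : SmoothNeg G) (i : Fin n) (u : testSpace n R) :
    coordOp i (radOp hR G hG u) = radOp hR G hG (coordOp i u) := mulOp_comm _ _ u

lemma radOp_comm (hR : R ≤ 1) {F G : ℝ → ℝ} (hF : SmoothNeg F) (hG : SmoothNeg G)
    (u : testSpace n R) : radOp hR F hF (radOp hR G hG u) = radOp hR G hG (radOp hR F hF u) :=
  mulOp_comm _ _ u

lemma exp_two_log {x : EuclideanSpace ℝ (Fin n)} (hx : x ∈ punctured n R) :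
    Real.exp (2 * Real.log ‖x‖) = ‖x‖ ^ 2 := by
  rw [two_mul, Real.exp_add, Real.exp_log (norm_pos_of_punctured hx), pow_two]

lemma sum_coordOp_coordOp (hR : R ≤ 1) (u : testSpace n R) :
    ∑ i, coordOp i (coordOp i u) =
      radOp hR (fun t => Real.exp (2 * t)) (smoothNeg_exp _) u := by
  ext x
  rw [radOp_apply]
  by_cases hx : x ∈ punctured n R
  · rw [exp_two_log hx, EuclideanSpace.real_norm_sq_eq, Submodule.coe_sum, Finset.sum_apply,
      Finset.sum_smul]
    refine Finset.sum_congr rfl fun i _ => ?_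
    simp [coordOp, mulOp_apply]; ring
  · rw [testSpace_apply_eq_zero u hx, testSpace_apply_eq_zero _ hx, smul_zero]

/-- The Euler operator `r∂ᵣ`. -/
noncomputable def euler (n : ℕ) (R : ℝ) : testSpace n R →ₗ[ℝ] testSpace n R :=
  ∑ i, coordOp i ∘ₗ pderiv i

/-- The Laplacian. -/
noncomputable def lap (n : ℕ) (R : ℝ) : testSpace n R →ₗ[ℝ] testSpace n R :=
  ∑ i, pderiv i ∘ₗ pderiv i

lemma euler_apply (u : testSpace n R) : euler n R u = ∑ i, coordOp i (pderiv i u) := by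
  simp [euler]

lemma lap_apply (u : testSpace n R) : lap n R u = ∑ i, pderiv i (pderiv i u) := by
  simp [lap]

lemma exp_cancel (hR : R ≤ 1) (a b : ℝ) (hab : a + b = 0) (u : testSpace n R) :
    radOp hR (fun t => Real.exp (a * t)) (smoothNeg_exp _)
      (radOp hR (fun t => Real.exp (b * t)) (smoothNeg_exp _) u) = u := by
  rw [radOp_radOp]
  refine radOp_eq_self hR _ (fun t _ => ?_) u
  rw [← Real.exp_add, ← add_mul, hab]; simp

lemma euler_radOp (hR : R ≤ 1) {G G' : ℝ → ℝ} (hG : SmoothNeg G) (hG' : SmoothNeg G')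
    (hd : ∀ t < 0, HasDerivAt G (G' t) t) (u : testSpace n R) :
    euler n R (radOp hR G hG u) = radOp hR G hG (euler n R u) + radOp hR G' hG' u := by
  simp only [euler_apply, pderiv_radOp hR hG hG' hd, map_add, Finset.sum_add_distrib, map_sum]
  congr 1
  · exact Finset.sum_congr rfl fun i _ => coordOp_radOp hR hG i _
  · rw [sum_coordOp_coordOp hR, exp_cancel hR 2 (-2) (by norm_num)]

lemma pderiv_euler (i : Fin n) (u : testSpace n R) :
    pderiv i (euler n R u) = euler n R (pderiv i u) + pderiv i u := by
  simp only [euler_apply, map_sum, pderiv_coordOp, Finset.sum_add_distrib]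
  congr 1
  · exact Finset.sum_congr rfl fun j _ => by rw [pderiv_comm]
  · simp

lemma lap_euler (u : testSpace n R) :
    lap n R (euler n R u) = euler n R (lap n R u) + (2 : ℝ) • lap n R u := by
  simp only [lap_apply, pderiv_euler, map_add, map_sum, Finset.smul_sum, ← Finset.sum_add_distrib]
  refine Finset.sum_congr rfl fun i _ => ?_
  module

lemma sum_pderiv_coordOp (u : testSpace n R) :
    ∑ i, pderiv i (coordOp i u) = (n : ℝ) • u + euler n R u := by
  simp only [pderiv_coordOp, Finset.sum_add_distrib, euler_apply]
  simp [add_comm, ← Nat.cast_smul_eq_nsmul ℝ]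

lemma hasDerivAt_exp_mul (c t : ℝ) :
    HasDerivAt (fun t => Real.exp (c * t)) (c * Real.exp (c * t)) t := by
  have := ((hasDerivAt_id t).const_mul c).exp
  simpa [mul_comm] using this

lemma euler_radOp_exp (hR : R ≤ 1) (c : ℝ) (u : testSpace n R) :
    euler n R (radOp hR (fun t => Real.exp (c * t)) (smoothNeg_exp _) u) =
      radOp hR (fun t => Real.exp (c * t)) (smoothNeg_exp _) (euler n R u) +
        c • radOp hR (fun t => Real.exp (c * t)) (smoothNeg_exp _) u := by
  have hs : SmoothNeg fun t => c * Real.exp (c * t) :=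
    SmoothNeg.mul contDiffOn_const (smoothNeg_exp c)
  rw [euler_radOp hR _ hs fun t _ => hasDerivAt_exp_mul c t]
  congr 1
  ext x
  simp [radOp_apply]; ring

lemma lap_radOp (hR : R ≤ 1) {G G' : ℝ → ℝ} (hG : SmoothNeg G) (hG' : SmoothNeg G')
    (hd : ∀ t < 0, HasDerivAt G (G' t) t) (u : testSpace n R) :
    radOp hR (fun t => Real.exp (2 * t)) (smoothNeg_exp _) (lap n R (radOp hR G hG u)) =
      radOp hR G hG (radOp hR (fun t => Real.exp (2 * t)) (smoothNeg_exp _) (lap n R u)) +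
        radOp hR G' hG' (euler n R u) + ((n : ℝ) - 2) • radOp hR G' hG' u +
        euler n R (radOp hR G' hG' u) := by
  set W := radOp (n := n) hR (fun t => Real.exp (-2 * t)) (smoothNeg_exp _) with hW
  set R2 := radOp (n := n) hR (fun t => Real.exp (2 * t)) (smoothNeg_exp _) with hR2
  have h1 : lap n R (radOp hR G hG u) = radOp hR G hG (lap n R u) +
      W (radOp hR G' hG' (euler n R u)) + ((n : ℝ) • W (radOp hR G' hG' u) +
        euler n R (W (radOp hR G' hG' u))) := by
    rw [← sum_pderiv_coordOp]
    simp only [lap_apply, pderiv_radOp hR hG hG' hd, map_add, Finset.sum_add_distrib, map_sum,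
      euler_apply]
    congr 2
    refine Finset.sum_congr rfl fun i _ => ?_
    rw [hW, coordOp_radOp, coordOp_radOp]
  have hc : ∀ w, R2 (W w) = w := fun w => exp_cancel hR _ _ (by norm_num) w
  rw [h1, hW, euler_radOp_exp, ← hW]
  simp only [map_add, map_smul, hc]
  rw [hR2, radOp_comm]
  module

/-- The Laplace operator of the sphere. -/
noncomputable def sphLap (n : ℕ) (hR : R ≤ 1) : testSpace n R →ₗ[ℝ] testSpace n R :=
  radOp hR (fun t => Real.exp (2 * t)) (smoothNeg_exp _) ∘ₗ lap n R -
    euler n R ∘ₗ euler n R - ((n : ℝ) - 2) • euler n R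

lemma sphLap_apply (hR : R ≤ 1) (u : testSpace n R) : sphLap n hR u =
    radOp hR (fun t => Real.exp (2 * t)) (smoothNeg_exp _) (lap n R u) -
      euler n R (euler n R u) - ((n : ℝ) - 2) • euler n R u := rfl

lemma sphLap_radOp (hR : R ≤ 1) {G G' : ℝ → ℝ} (hG : SmoothNeg G) (hG' : SmoothNeg G')
    (hd : ∀ t < 0, HasDerivAt G (G' t) t) (u : testSpace n R) :
    sphLap n hR (radOp hR G hG u) = radOp hR G hG (sphLap n hR u) := by
  rw [sphLap_apply, sphLap_apply, lap_radOp hR hG hG' hd, euler_radOp hR hG hG' hd, map_add,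
    euler_radOp hR hG hG' hd]
  simp only [map_sub, map_smul]
  module

lemma euler_sphLap (hR : R ≤ 1) (u : testSpace n R) :
    euler n R (sphLap n hR u) = sphLap n hR (euler n R u) := by
  simp only [sphLap_apply, map_sub, map_smul, lap_euler, euler_radOp_exp, map_add]

end TestSpace

section WeightedForm

variable {n : ℕ} {R : ℝ}

lemma l2form_radOp (hR : R ≤ 1) {G : ℝ → ℝ} (hG : SmoothNeg G) (u v : testSpace n R) :
    l2form n R (radOp hR G hG u) v = l2form n R u (radOp hR G hG v) := l2form_mulOp _ u v

lemma l2form_coordOp (i : Fin n) (u v : testSpace n R) :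
    l2form n R (coordOp i u) v = l2form n R u (coordOp i v) := l2form_mulOp _ u v

/-- Multiplication by `r ^ c`. -/
noncomputable def powOp (hR : R ≤ 1) (c : ℝ) : testSpace n R →ₗ[ℝ] testSpace n R :=
  radOp hR (fun t => Real.exp (c * t)) (smoothNeg_exp c)

lemma powOp_powOp (hR : R ≤ 1) (a b : ℝ) (u : testSpace n R) :
    powOp hR a (powOp hR b u) = powOp hR (a + b) u := by
  rw [powOp, powOp, radOp_radOp, powOp]
  congr 1
  exact radOp_congr hR _ _ fun t _ => by rw [← Real.exp_add, add_mul]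

lemma powOp_radOp (hR : R ≤ 1) (a : ℝ) {G : ℝ → ℝ} (hG : SmoothNeg G) (u : testSpace n R) :
    powOp hR a (radOp hR G hG u) = radOp hR G hG (powOp hR a u) := radOp_comm hR _ _ u

lemma l2form_powOp (hR : R ≤ 1) (c : ℝ) (u v : testSpace n R) :
    l2form n R (powOp hR c u) v = l2form n R u (powOp hR c v) := l2form_radOp hR _ u v

lemma euler_powOp (hR : R ≤ 1) (c : ℝ) (u : testSpace n R) :
    euler n R (powOp hR c u) = powOp hR c (euler n R u) + c • powOp hR c u :=
  euler_radOp_exp hR c u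

lemma pderiv_powOp (hR : R ≤ 1) (c : ℝ) (i : Fin n) (u : testSpace n R) :
    pderiv i (powOp hR c u) = powOp hR c (pderiv i u) + c • coordOp i (powOp hR (c - 2) u) := by
  have hs : SmoothNeg fun t => c * Real.exp (c * t) :=
    SmoothNeg.mul contDiffOn_const (smoothNeg_exp c)
  rw [powOp, pderiv_radOp hR _ hs fun t _ => hasDerivAt_exp_mul c t, ← map_smul]
  congr 2
  ext x
  have : Real.exp ((c - 2) * Real.log ‖x‖) =
      Real.exp (-2 * Real.log ‖x‖) * Real.exp (c * Real.log ‖x‖) := by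
    rw [← Real.exp_add]; ring_nf
  simp [radOp_apply, powOp, this]; ring

/-- The inner product of `L²(r⁻ⁿ dx)`. -/
noncomputable def wform (hR : R ≤ 1) (u v : testSpace n R) : ℝ := l2form n R u (powOp hR (-n) v)

lemma wform_comm (hR : R ≤ 1) (u v : testSpace n R) : wform hR u v = wform hR v u := by
  rw [wform, wform, ← l2form_powOp, l2form_comm]

lemma powOp_half (hR : R ≤ 1) (c : ℝ) (u : testSpace n R) :
    powOp hR (c / 2) (powOp hR (c / 2) u) = powOp hR c u := by
  rw [powOp_powOp]; ring_nf

lemma wform_eq (hR : R ≤ 1) (u v : testSpace n R) :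
    wform hR u v = l2form n R (powOp hR (-n / 2) u) (powOp hR (-n / 2) v) := by
  rw [wform, l2form_powOp, powOp_half]

lemma wform_self_nonneg (hR : R ≤ 1) (u : testSpace n R) : 0 ≤ wform hR u u := by
  rw [wform_eq]; exact l2form_self_nonneg _

lemma wform_euler (hR : R ≤ 1) (u v : testSpace n R) :
    wform hR (euler n R u) v = -wform hR u (euler n R v) := by
  have h1 : wform hR (euler n R u) v =
      -l2form n R u (∑ i, pderiv i (coordOp i (powOp hR (-n) v))) := by
    rw [wform, euler_apply]
    simp only [map_sum, LinearMap.sum_apply, l2form_coordOp, l2form_pderiv, Finset.sum_neg_distrib]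
  rw [h1, sum_pderiv_coordOp, euler_powOp, wform]
  congr 2
  module

/-- The Dirichlet form. -/
noncomputable def dirichlet (hR : R ≤ 1) (u v : testSpace n R) : ℝ :=
  ∑ i, l2form n R (pderiv i u) (powOp hR (2 - n) (pderiv i v))

lemma dirichlet_comm (hR : R ≤ 1) (u v : testSpace n R) :
    dirichlet hR u v = dirichlet hR v u := by
  refine Finset.sum_congr rfl fun i _ => ?_
  rw [← l2form_powOp, l2form_comm]

lemma wform_lap (hR : R ≤ 1) (u v : testSpace n R) :
    wform hR (powOp hR 2 (lap n R u)) v =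
      -dirichlet hR u v + ((n : ℝ) - 2) * wform hR (euler n R u) v := by
  rw [wform, l2form_powOp, powOp_powOp, lap_apply, map_sum, LinearMap.sum_apply]
  have h1 : ∀ i, l2form n R (pderiv i (pderiv i u)) (powOp hR (2 + -n) v) =
      -l2form n R (pderiv i u) (powOp hR (2 - n) (pderiv i v)) +
        ((n : ℝ) - 2) * l2form n R (coordOp i (pderiv i u)) (powOp hR (-n) v) := by
    intro i
    rw [l2form_pderiv, ← sub_eq_add_neg, pderiv_powOp, map_add, map_smul, smul_eq_mul,
      l2form_coordOp, show (2 : ℝ) - n - 2 = -n by ring]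
    ring
  simp only [h1, Finset.sum_add_distrib, Finset.sum_neg_distrib, ← Finset.mul_sum, dirichlet,
    wform, euler_apply, map_sum, LinearMap.sum_apply]

lemma wform_sphLap (hR : R ≤ 1) (u v : testSpace n R) :
    wform hR (sphLap n hR u) v = -dirichlet hR u v + wform hR (euler n R u) (euler n R v) := by
  have h1 : wform hR (sphLap n hR u) v = wform hR (powOp hR 2 (lap n R u)) v -
      wform hR (euler n R (euler n R u)) v - ((n : ℝ) - 2) * wform hR (euler n R u) v := by
    rw [sphLap_apply]
    simp only [wform, map_sub, map_smul, LinearMap.sub_apply, LinearMap.smul_apply, smul_eq_mul]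
    rfl
  rw [h1, wform_lap, wform_euler hR (euler n R u)]
  ring

lemma wform_sphLap_symm (hR : R ≤ 1) (u v : testSpace n R) :
    wform hR (sphLap n hR u) v = wform hR u (sphLap n hR v) := by
  rw [wform_sphLap, wform_comm hR u, wform_sphLap, dirichlet_comm, wform_comm]

lemma l2form_mono {u v : testSpace n R} (h : ∀ x, ‖u.1 x‖ ≤ ‖v.1 x‖) :
    l2form n R u u ≤ l2form n R v v := by
  rw [l2form_apply, l2form_apply]
  refine integral_mono (l2form_integrable u u) (l2form_integrable v v) fun x => ?_
  simp only [real_inner_self_eq_norm_sq]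
  exact pow_le_pow_left₀ (norm_nonneg _) (h x) 2

lemma wform_sphLap_nonpos (hR : R ≤ 1) (u : testSpace n R) : wform hR (sphLap n hR u) u ≤ 0 := by
  rw [wform_sphLap, wform_eq]
  have h1 : dirichlet hR u u =
      ∑ i, l2form n R (powOp hR ((2 - n) / 2) (pderiv i u))
        (powOp hR ((2 - n) / 2) (pderiv i u)) := by
    refine Finset.sum_congr rfl fun i _ => ?_
    rw [l2form_powOp, powOp_half]
  rw [h1]
  simp only [l2form_apply]
  rw [← integral_finsetSum _ fun i _ => l2form_integrable _ _, ← sub_eq_neg_add, sub_nonpos]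
  refine integral_mono (l2form_integrable _ _)
    (integrable_finsetSum _ fun i _ => l2form_integrable _ _) fun x => ?_
  simp only [real_inner_self_eq_norm_sq, powOp, radOp_apply, norm_smul, Real.norm_eq_abs,
    Real.abs_exp, mul_pow]
  by_cases hx : x ∈ punctured n R
  · have e : Real.exp ((2 - n) / 2 * Real.log ‖x‖) =
        ‖x‖ * Real.exp (-n / 2 * Real.log ‖x‖) := by
      conv_rhs => rw [← Real.exp_log (norm_pos_of_punctured hx)]
      rw [← Real.exp_add, Real.exp_log (norm_pos_of_punctured hx)]
      ring_nf
    rw [e]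
    have h2 : ‖(euler n R u).1 x‖ ^ 2 ≤ ‖x‖ ^ 2 * ∑ i, ‖(pderiv i u).1 x‖ ^ 2 := by
      have h3 : ‖(euler n R u).1 x‖ ≤ ∑ i, |x i| * ‖(pderiv i u).1 x‖ := by
        rw [euler_apply, Submodule.coe_sum, Finset.sum_apply]
        refine (norm_sum_le _ _).trans_eq (Finset.sum_congr rfl fun i _ => ?_)
        simp [coordOp, mulOp_apply]
      calc _ ≤ (∑ i, |x i| * ‖(pderiv i u).1 x‖) ^ 2 := by gcongr
        _ ≤ (∑ i, |x i| ^ 2) * ∑ i, ‖(pderiv i u).1 x‖ ^ 2 :=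
          Finset.sum_mul_sq_le_sq_mul_sq _ _ _
        _ = _ := by rw [EuclideanSpace.real_norm_sq_eq]; simp only [sq_abs]
    rw [← Finset.mul_sum]
    calc _ ≤ Real.exp (-n / 2 * Real.log ‖x‖) ^ 2 *
          (‖x‖ ^ 2 * ∑ i, ‖(pderiv i u).1 x‖ ^ 2) := by gcongr
      _ = _ := by ring
  · rw [testSpace_apply_eq_zero _ hx]
    simp only [norm_zero, ne_eq, OfNat.ofNat_ne_zero, not_false_eq_true, zero_pow, mul_zero]
    exact Finset.sum_nonneg fun i _ => by positivity

/-- The inner product space structure of `L²(r⁻ⁿ dx)` on test functions. -/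
@[reducible] noncomputable def weightedCore (n : ℕ) (hR : R ≤ 1) :
    PreInnerProductSpace.Core ℝ (testSpace n R) where
  inner := wform hR
  conj_inner_symm u v := by simpa using wform_comm hR v u
  re_inner_nonneg u := by simpa using wform_self_nonneg hR u
  add_left u v w := by simp [wform]
  smul_left u v c := by simp [wform]

lemma smoothNeg_inv : SmoothNeg fun t => t⁻¹ := fun _ ht =>
  (contDiffAt_inv ℝ (ne_of_lt ht)).contDiffWithinAt

/-- Multiplication by `1 / log r`. -/
noncomputable def invLogOp (n : ℕ) (hR : R ≤ 1) : testSpace n R →ₗ[ℝ] testSpace n R :=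
  radOp hR (fun t => t⁻¹) smoothNeg_inv

lemma smoothNeg_neg_inv_sq : SmoothNeg fun t => -(t⁻¹ * t⁻¹) :=
  (smoothNeg_inv.mul smoothNeg_inv).neg

lemma hasDerivAt_inv_neg (t : ℝ) (ht : t < 0) :
    HasDerivAt (fun t : ℝ => t⁻¹) (-(t⁻¹ * t⁻¹)) t := by
  rw [← mul_inv, ← pow_two]
  exact hasDerivAt_inv ht.ne

/-- The inner product space structure on test functions satisfies the log-polar calculus. -/
theorem logPolar_testSpace (hR : R ≤ 1) {ε : ℝ} (hε0 : 0 < ε) (hε : R ≤ Real.exp (-ε⁻¹)) :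
    letI := @InnerProductSpace.Core.toSeminormedAddCommGroup ℝ _ _ _ _ (weightedCore n hR)
    letI := InnerProductSpace.ofCore (weightedCore n hR)
    LogPolar (euler n R) (invLogOp n hR) (sphLap n hR) ε := by
  let i1 := @InnerProductSpace.Core.toSeminormedAddCommGroup ℝ _ _ _ _ (weightedCore n hR)
  let i2 := InnerProductSpace.ofCore (weightedCore n hR)
  refine ⟨wform_euler hR, fun u v => ?_, wform_sphLap_symm hR, wform_sphLap_nonpos hR, fun u => ?_,
    euler_sphLap hR, fun u => ?_, fun u => ?_⟩
  · change wform hR _ _ = wform hR _ _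
    rw [wform, invLogOp, l2form_radOp, ← powOp_radOp, wform]
  · rw [invLogOp, euler_radOp hR _ smoothNeg_neg_inv_sq hasDerivAt_inv_neg, radOp_radOp,
      sub_eq_add_neg]
    congr 1
    ext x
    simp [radOp_apply]
  · rw [invLogOp, sphLap_radOp hR _ smoothNeg_neg_inv_sq hasDerivAt_inv_neg]
  · have h1 : ‖invLogOp n hR u‖ ^ 2 ≤ ‖ε • u‖ ^ 2 := by
      rw [← real_inner_self_eq_norm_sq, ← real_inner_self_eq_norm_sq]
      change wform hR _ _ ≤ wform hR _ _
      rw [wform_eq, wform_eq]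
      refine l2form_mono fun x => ?_
      simp only [powOp, invLogOp, radOp_apply, Submodule.coe_smul, Pi.smul_apply, norm_smul]
      by_cases hx : x ∈ punctured n R
      · gcongr
        have h2 : Real.log ‖x‖ ≤ -ε⁻¹ := by
          rw [Real.log_le_iff_le_exp (norm_pos_of_punctured hx)]
          exact (norm_lt_of_punctured hx).le.trans hε
        rw [norm_inv, Real.norm_eq_abs, Real.norm_eq_abs, abs_of_pos hε0]
        refine inv_le_of_inv_le₀ hε0 (le_trans ?_ (neg_le_abs _))
        linarith
      · simp [testSpace_apply_eq_zero u hx]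
    have h2 := abs_le_of_sq_le_sq h1 (norm_nonneg _)
    rw [abs_of_nonneg (norm_nonneg _), norm_smul, Real.norm_eq_abs, abs_of_pos hε0] at h2
    exact h2

end WeightedForm

section ZeroOrder

variable {n : ℕ} {R : ℝ}

/-- The weight `e^{-τφ} r^a (log r)^{-j}` as a function of `t = log r`. -/
noncomputable def wt (τ : ℝ) (j : ℕ) (a t : ℝ) : ℝ :=
  Real.exp (-τ * (t + Real.log (t ^ 2))) * Real.exp (a * t) * (t⁻¹) ^ j

lemma smoothNeg_wt (τ : ℝ) (j : ℕ) (a : ℝ) : SmoothNeg (wt τ j a) := by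
  refine SmoothNeg.mul (SmoothNeg.mul ?_ (smoothNeg_exp a)) (ContDiffOn.pow smoothNeg_inv j)
  refine Real.contDiff_exp.comp_contDiffOn (contDiffOn_const.mul (contDiffOn_id.add ?_))
  exact (contDiffOn_id.pow 2).log fun t ht => pow_ne_zero 2 (ne_of_lt ht)

lemma hasDerivAt_wt (τ : ℝ) (j : ℕ) (a : ℝ) {t : ℝ} (ht : t < 0) :
    HasDerivAt (wt τ j a) (-((τ - a) + (2 * τ + j) * t⁻¹) * wt τ j a t) t := by
  have h1 : HasDerivAt (fun t : ℝ => Real.exp (-τ * (t + Real.log (t ^ 2)))) _ t :=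
    (((hasDerivAt_id t).add ((hasDerivAt_pow 2 t).log (pow_ne_zero 2 ht.ne))).const_mul (-τ)).exp
  have h2 := (hasDerivAt_inv_neg t ht).pow j
  refine ((h1.mul (hasDerivAt_exp_mul a t)).mul h2).congr_deriv ?_
  simp only [wt, Pi.add_apply, id_eq]
  have h0 : t ≠ 0 := ht.ne
  rcases Nat.eq_zero_or_pos j with hj | hj
  · subst hj; simp; field_simp; ring
  · obtain ⟨i, rfl⟩ : ∃ i, j = i + 1 := ⟨j - 1, by omega⟩
    simp only [Nat.add_sub_cancel, Pi.pow_apply, Pi.mul_apply, pow_succ]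
    push_cast
    field_simp
    ring

lemma wt_mul_exp (τ : ℝ) (j : ℕ) (a b t : ℝ) :
    wt τ j a t * Real.exp (b * t) = wt τ j (a + b) t := by
  rw [wt, wt, add_mul, Real.exp_add]; ring

lemma wt_mul_inv (τ : ℝ) (j : ℕ) (a t : ℝ) : t⁻¹ * wt τ j a t = wt τ (j + 1) a t := by
  rw [wt, wt, pow_succ]; ring

/-- Multiplication by the weight `e^{-τφ} r^a (log r)^{-j}`. -/
noncomputable def wtOp (hR : R ≤ 1) (τ : ℝ) (j : ℕ) (a : ℝ) :
    testSpace n R →ₗ[ℝ] testSpace n R := radOp hR (wt τ j a) (smoothNeg_wt τ j a)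

lemma powOp_wtOp (hR : R ≤ 1) (τ : ℝ) (j : ℕ) (a b : ℝ) (u : testSpace n R) :
    powOp hR b (wtOp hR τ j a u) = wtOp hR τ j (a + b) u := by
  rw [wtOp, wtOp, powOp, radOp_radOp]
  congr 1
  exact radOp_congr hR _ _ fun t _ => by rw [mul_comm, wt_mul_exp]

lemma wtOp_powOp (hR : R ≤ 1) (τ : ℝ) (j : ℕ) (a b : ℝ) (u : testSpace n R) :
    wtOp hR τ j a (powOp hR b u) = wtOp hR τ j (a + b) u := by
  rw [← powOp_wtOp, wtOp, powOp_radOp]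

lemma invLogOp_pow_wtOp (hR : R ≤ 1) (τ : ℝ) (j i : ℕ) (a : ℝ) (u : testSpace n R) :
    (invLogOp n hR ^ i) (wtOp hR τ j a u) = wtOp hR τ (j + i) a u := by
  induction i with
  | zero => simp
  | succ i ih =>
    rw [pow_succ', Module.End.mul_apply, ih, wtOp, wtOp, invLogOp, radOp_radOp]
    congr 1
    exact radOp_congr hR _ _ fun t _ => by rw [wt_mul_inv]; rfl

lemma wtOp_euler (hR : R ≤ 1) (τ a : ℝ) (u : testSpace n R) :
    wtOp hR τ 0 a (euler n R u) =
      shiftOp (euler n R) (invLogOp n hR) (τ - a) (2 * τ) (wtOp hR τ 0 a u) := by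
  have hs : SmoothNeg fun t => -((τ - a) + (2 * τ + (0 : ℕ)) * t⁻¹) * wt τ 0 a t :=
    SmoothNeg.mul (ContDiffOn.neg (contDiffOn_const.add (contDiffOn_const.mul smoothNeg_inv)))
      (smoothNeg_wt τ 0 a)
  rw [shiftOp_apply, wtOp, euler_radOp hR _ hs fun t ht => hasDerivAt_wt τ 0 a ht, add_assoc,
    add_assoc, left_eq_add]
  ext x
  simp [invLogOp, radOp_apply]
  ring

lemma sphLap_wtOp (hR : R ≤ 1) (τ a : ℝ) (u : testSpace n R) :
    sphLap n hR (wtOp hR τ 0 a u) = wtOp hR τ 0 a (sphLap n hR u) := by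
  have hs : SmoothNeg fun t => -((τ - a) + (2 * τ + (0 : ℕ)) * t⁻¹) * wt τ 0 a t :=
    SmoothNeg.mul (ContDiffOn.neg (contDiffOn_const.add (contDiffOn_const.mul smoothNeg_inv)))
      (smoothNeg_wt τ 0 a)
  rw [wtOp, sphLap_radOp hR _ hs fun t ht => hasDerivAt_wt τ 0 a ht]

lemma wtOp_lap (hR : R ≤ 1) (τ a : ℝ) (u : testSpace n R) :
    wtOp hR τ 0 (a + 2) (lap n R u) =
      conjOp (euler n R) (invLogOp n hR) (sphLap n hR) ((((n : ℝ) - 2) / 2) ^ 2)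
        (τ - a + ((n : ℝ) - 2) / 2) (2 * τ) (wtOp hR τ 0 a u) := by
  have h1 : powOp hR 2 (lap n R u) =
      sphLap n hR u + euler n R (euler n R u) + ((n : ℝ) - 2) • euler n R u := by
    rw [sphLap_apply, powOp]; module
  have hsh : ∀ v, shiftOp (euler n R) (invLogOp n hR) (τ - a + ((n : ℝ) - 2) / 2) (2 * τ) v =
      shiftOp (euler n R) (invLogOp n hR) (τ - a) (2 * τ) v + (((n : ℝ) - 2) / 2) • v := by
    intro v; simp only [shiftOp_apply]; module
  rw [← wtOp_powOp, h1, map_add, map_add, map_smul, ← sphLap_wtOp, wtOp_euler, wtOp_euler,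
    conjOp_apply, hsh, hsh, map_add, map_smul]
  module

/-- The unweighted `L²` norm of a test function. -/
noncomputable def lnorm (u : testSpace n R) : ℝ := √(l2form n R u u)

/-- The `L²` Carleman estimate for the powers of the Laplacian. -/
theorem carleman_powers {m : ℕ} (hm : 1 ≤ m) (hn : 2 ≤ n) :
    ∃ C R₀ : ℝ, 0 < C ∧ 0 < R₀ ∧ R₀ < 1 ∧ R₀ ≤ Real.exp (-1) ∧ ∀ (hR : R₀ ≤ 1) (τ : ℝ), 1 < τ →
      ∀ u : testSpace n R₀, ∀ k ≤ m,
      τ ^ ((3 * m - 4 * k) / 2 : ℝ) * lnorm (wtOp hR τ m (2 * k - n / 2) ((lap n R₀ ^ k) u)) ≤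
        C * lnorm (wtOp hR τ 0 (2 * m - n / 2) ((lap n R₀ ^ m) u)) := by
  have hm' : (1 : ℝ) ≤ m := by exact_mod_cast hm
  have hn' : (2 : ℝ) ≤ n := by exact_mod_cast hn
  set ε : ℝ := (16 * m * (m + 2))⁻¹ with hε
  have hpos : (1 : ℝ) ≤ 16 * m * (m + 2) := by nlinarith
  have hε0 : 0 < ε := by positivity
  have hexp : Real.exp (-ε⁻¹) ≤ Real.exp (-1) := by
    rw [Real.exp_le_exp, hε, inv_inv]; linarith
  refine ⟨44 * (6 * m) ^ m * (2 * m) ^ (2 * m), Real.exp (-ε⁻¹), by positivity,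
    Real.exp_pos _, hexp.trans_lt (by simp), hexp, ?_⟩
  intro hR τ hτ u k hk
  let i1 := @InnerProductSpace.Core.toSeminormedAddCommGroup ℝ _ _ _ _ (weightedCore n hR)
  let i2 := InnerProductSpace.ofCore (weightedCore n hR)
  have h := (logPolar_testSpace (n := n) hR hε0 le_rfl).iterated_carleman hm hε0.le
    (by rw [hε, inv_mul_cancel₀ (by positivity)])
    (κ := ((n : ℝ) - 2) / 2) (by linarith) hτ
    (fun k => wtOp hR τ 0 (2 * k) ((lap n _ ^ k) u)) (fun k _ => by
      rw [pow_succ', Module.End.mul_apply, ← wtOp_lap]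
      congr 2
      push_cast; ring) hk
  have hnorm : ∀ v : testSpace n (Real.exp (-ε⁻¹)), ‖v‖ = lnorm (powOp hR (-n / 2) v) := by
    intro v
    rw [lnorm, ← wform_eq]
    rfl
  simp only [invLogOp_pow_wtOp, hnorm, powOp_wtOp] at h
  convert h using 4 <;> ring_nf

end ZeroOrder

section WeightedElliptic

variable {n : ℕ} {R : ℝ}

/-- The inner product space structure of `L²(dx)` on test functions. -/
@[reducible] noncomputable def l2Core (n : ℕ) (R : ℝ) :
    PreInnerProductSpace.Core ℝ (testSpace n R) where
  inner u v := l2form n R u v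
  conj_inner_symm u v := by simpa using l2form_comm v u
  re_inner_nonneg u := by simpa using l2form_self_nonneg u
  add_left u v w := by simp
  smul_left u v c := by simp

lemma abs_l2form_le (u v : testSpace n R) : |l2form n R u v| ≤ lnorm u * lnorm v := by
  let i1 := @InnerProductSpace.Core.toSeminormedAddCommGroup ℝ _ _ _ _ (l2Core n R)
  let i2 := InnerProductSpace.ofCore (l2Core n R)
  exact abs_real_inner_le_norm u v

lemma lnorm_nonneg (u : testSpace n R) : 0 ≤ lnorm u := Real.sqrt_nonneg _

lemma lnorm_sq (u : testSpace n R) : lnorm u ^ 2 = l2form n R u u :=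
  Real.sq_sqrt (l2form_self_nonneg u)

lemma lnorm_smul (c : ℝ) (u : testSpace n R) : lnorm (c • u) = |c| * lnorm u := by
  let i1 := @InnerProductSpace.Core.toSeminormedAddCommGroup ℝ _ _ _ _ (l2Core n R)
  let i2 := InnerProductSpace.ofCore (l2Core n R)
  exact norm_smul c u

lemma lnorm_mono {u v : testSpace n R} (h : ∀ x, ‖u.1 x‖ ≤ ‖v.1 x‖) : lnorm u ≤ lnorm v :=
  Real.sqrt_le_sqrt (l2form_mono h)

/-- The directional derivative of a multiplier. -/
noncomputable def dmul (g : EuclideanSpace ℝ (Fin n) → ℝ) (l : Fin n)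
    (x : EuclideanSpace ℝ (Fin n)) : ℝ := fderiv ℝ g x (EuclideanSpace.single l 1)

lemma IsMultiplier.dmul {g : EuclideanSpace ℝ (Fin n) → ℝ} (hg : IsMultiplier R g) (l : Fin n) :
    IsMultiplier R (dmul g l) :=
  (ContDiffOn.fderiv_of_isOpen hg isOpen_punctured (m := ∞) (by simp)).clm_apply contDiffOn_const

lemma pderiv_mulOp' {g : EuclideanSpace ℝ (Fin n) → ℝ} (hg : IsMultiplier R g) (l : Fin n)
    (u : testSpace n R) :
    pderiv l (mulOp g hg u) = mulOp g hg (pderiv l u) + mulOp (dmul g l) (hg.dmul l) u :=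
  pderiv_mulOp hg (hg.dmul l) l (fun _ _ => rfl) u

/-- A sequence of weights of increasing order, each controlling the gradient of the next. -/
structure WeightFamily (R : ℝ) (K : ℕ → ℝ) (w : ℕ → EuclideanSpace ℝ (Fin n) → ℝ) : Prop where
  mult : ∀ i, IsMultiplier R (w i)
  nonneg : ∀ i, 0 ≤ K i
  grad : ∀ i l, ∀ x ∈ punctured n R, |dmul (w (i + 1)) l x| ≤ K i * |w i x|
  sq : ∀ i, ∀ x ∈ punctured n R, w (i + 1) x * w (i + 1) x = w i x * w (i + 2) x

namespace WeightFamily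

variable {K : ℕ → ℝ} {w : ℕ → EuclideanSpace ℝ (Fin n) → ℝ}

lemma lnorm_dmul_le (h : WeightFamily R K w) (i : ℕ) (l : Fin n) (u : testSpace n R) :
    lnorm (mulOp _ ((h.mult (i + 1)).dmul l) u) ≤ K i * lnorm (mulOp _ (h.mult i) u) := by
  rw [← abs_of_nonneg (h.nonneg i), ← lnorm_smul]
  refine lnorm_mono fun x => ?_
  by_cases hx : x ∈ punctured n R
  · simp only [Submodule.coe_smul, Pi.smul_apply, mulOp_apply, norm_smul, Real.norm_eq_abs]
    rw [← mul_assoc, abs_of_nonneg (h.nonneg i)]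
    gcongr
    exact h.grad i l x hx
  · rw [testSpace_apply_eq_zero _ hx, testSpace_apply_eq_zero _ hx]

/-- Integration by parts against the square of a weight. -/
lemma sum_lnorm_sq_pderiv (h : WeightFamily R K w) (i : ℕ) (u : testSpace n R) :
    ∑ l, lnorm (mulOp _ (h.mult i) (pderiv l u)) ^ 2 =
      -l2form n R (mulOp _ (h.mult i) u) (mulOp _ (h.mult i) (lap n R u)) -
        2 * ∑ l, l2form n R (mulOp _ ((h.mult i).dmul l) u) (mulOp _ (h.mult i) (pderiv l u)) := by
  rw [lap_apply, map_sum, map_sum, ← Finset.sum_neg_distrib, Finset.mul_sum,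
    ← Finset.sum_sub_distrib]
  refine Finset.sum_congr rfl fun l _ => ?_
  rw [lnorm_sq, l2form_mulOp, l2form_pderiv, pderiv_mulOp', pderiv_mulOp', map_add, map_add,
    map_add, l2form_mulOp (h.mult i) u,
    l2form_mulOp ((h.mult i).dmul l) u, mulOp_comm ((h.mult i).dmul l) (h.mult i)]
  ring

/-- The interpolation inequality for first derivatives. -/
lemma first_order (h : WeightFamily R K w) (i : ℕ) (u : testSpace n R) :
    ∑ l, lnorm (mulOp _ (h.mult (i + 1)) (pderiv l u)) ^ 2 ≤
      (1 + 4 * n * K i ^ 2) * (lnorm (mulOp _ (h.mult i) u) ^ 2 +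
        lnorm (mulOp _ (h.mult (i + 2)) (lap n R u)) ^ 2) := by
  set a := lnorm (mulOp _ (h.mult i) u)
  set b := lnorm (mulOp _ (h.mult (i + 2)) (lap n R u))
  set S := ∑ l, lnorm (mulOp _ (h.mult (i + 1)) (pderiv l u)) ^ 2 with hS
  have h1 : -l2form n R (mulOp _ (h.mult (i + 1)) u) (mulOp _ (h.mult (i + 1)) (lap n R u)) ≤
      a * b := by
    have e : l2form n R (mulOp _ (h.mult (i + 1)) u) (mulOp _ (h.mult (i + 1)) (lap n R u)) =
        l2form n R (mulOp _ (h.mult i) u) (mulOp _ (h.mult (i + 2)) (lap n R u)) := by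
      rw [l2form_mulOp, l2form_mulOp, mulOp_mulOp, mulOp_mulOp]
      congr 1
      rw [mulOp_congr _ _ (h.sq i)]
    rw [e]
    exact (neg_le_abs _).trans (abs_l2form_le _ _)
  have h2 : ∀ l, -2 * l2form n R (mulOp _ ((h.mult (i + 1)).dmul l) u)
      (mulOp _ (h.mult (i + 1)) (pderiv l u)) ≤
      2 * K i ^ 2 * a ^ 2 + 1 / 2 * lnorm (mulOp _ (h.mult (i + 1)) (pderiv l u)) ^ 2 := by
    intro l
    have h3 := (neg_le_abs _).trans (abs_l2form_le (mulOp _ ((h.mult (i + 1)).dmul l) u)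
      (mulOp _ (h.mult (i + 1)) (pderiv l u)))
    have h4 := h.lnorm_dmul_le i l u
    have h5 := mul_le_mul_of_nonneg_right h4 (lnorm_nonneg (mulOp _ (h.mult (i + 1)) (pderiv l u)))
    nlinarith [sq_nonneg (2 * (K i * a) - lnorm (mulOp _ (h.mult (i + 1)) (pderiv l u)))]
  have h3 := Finset.sum_le_sum fun l (_ : l ∈ Finset.univ) => h2 l
  simp only [Finset.sum_add_distrib, ← Finset.mul_sum, Finset.sum_const, Finset.card_univ,
    Fintype.card_fin, nsmul_eq_mul] at h3
  rw [← hS] at h3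
  have h4 := h.sum_lnorm_sq_pderiv (i + 1) u
  rw [← hS] at h4
  have h5 : 0 ≤ 4 * n * K i ^ 2 * b ^ 2 := by positivity
  nlinarith [sq_nonneg (a - b)]

/-- The interior estimate for second derivatives. -/
lemma second_order (h : WeightFamily R K w) (i : ℕ) (u : testSpace n R) :
    ∑ k, ∑ l, lnorm (mulOp _ (h.mult (i + 2)) (pderiv l (pderiv k u))) ^ 2 ≤
      (2 + 2 * n + (2 + 4 * n) * K (i + 1) ^ 2) *
        (lnorm (mulOp _ (h.mult (i + 2)) (lap n R u)) ^ 2 +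
        ∑ k, lnorm (mulOp _ (h.mult (i + 1)) (pderiv k u)) ^ 2) := by
  set b := lnorm (mulOp _ (h.mult (i + 2)) (lap n R u)) with hb
  set S := ∑ k, ∑ l, lnorm (mulOp _ (h.mult (i + 2)) (pderiv l (pderiv k u))) ^ 2 with hS
  set T := ∑ k, lnorm (mulOp _ (h.mult (i + 1)) (pderiv k u)) ^ 2 with hT
  have e1 : S = ∑ k, (-l2form n R (mulOp _ (h.mult (i + 2)) (pderiv k u))
        (mulOp _ (h.mult (i + 2)) (lap n R (pderiv k u))) -
        2 * ∑ l, l2form n R (mulOp _ ((h.mult (i + 2)).dmul l) (pderiv k u))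
          (mulOp _ (h.mult (i + 2)) (pderiv l (pderiv k u)))) :=
    Finset.sum_congr rfl fun k _ => h.sum_lnorm_sq_pderiv (i + 2) (pderiv k u)
  have hcomm : ∀ k, lap n R (pderiv k u) = pderiv k (lap n R u) := by
    intro k
    simp only [lap_apply, map_sum]
    exact Finset.sum_congr rfl fun l _ => by rw [pderiv_comm l k, pderiv_comm l k]
  have e2 : ∀ k, -l2form n R (mulOp _ (h.mult (i + 2)) (pderiv k u))
        (mulOp _ (h.mult (i + 2)) (lap n R (pderiv k u))) =
      l2form n R (mulOp _ (h.mult (i + 2)) (pderiv k (pderiv k u)))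
        (mulOp _ (h.mult (i + 2)) (lap n R u)) +
      2 * l2form n R (mulOp _ ((h.mult (i + 2)).dmul k) (pderiv k u))
        (mulOp _ (h.mult (i + 2)) (lap n R u)) := by
    intro k
    rw [hcomm, ← l2form_mulOp (h.mult (i + 2)) (mulOp _ (h.mult (i + 2)) (pderiv k u)), l2form_comm,
      l2form_pderiv, neg_neg, pderiv_mulOp', pderiv_mulOp', l2form_comm]
    simp only [map_add, LinearMap.add_apply]
    rw [l2form_mulOp (h.mult (i + 2)) (mulOp _ (h.mult (i + 2)) _),
      l2form_mulOp (h.mult (i + 2)) (mulOp _ ((h.mult (i + 2)).dmul k) _),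
      mulOp_comm ((h.mult (i + 2)).dmul k) (h.mult (i + 2)),
      l2form_mulOp (h.mult (i + 2)) (mulOp _ ((h.mult (i + 2)).dmul k) _)]
    ring
  have e3 : ∑ k, l2form n R (mulOp _ (h.mult (i + 2)) (pderiv k (pderiv k u)))
        (mulOp _ (h.mult (i + 2)) (lap n R u)) = b ^ 2 := by
    rw [hb, lnorm_sq, ← LinearMap.sum_apply, ← map_sum, ← map_sum, ← lap_apply]
  have h1 : ∀ k, 2 * l2form n R (mulOp _ ((h.mult (i + 2)).dmul k) (pderiv k u))
        (mulOp _ (h.mult (i + 2)) (lap n R u)) ≤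
      b ^ 2 + K (i + 1) ^ 2 * lnorm (mulOp _ (h.mult (i + 1)) (pderiv k u)) ^ 2 := by
    intro k
    have h3 := (le_abs_self _).trans (abs_l2form_le (mulOp _ ((h.mult (i + 2)).dmul k) (pderiv k u))
      (mulOp _ (h.mult (i + 2)) (lap n R u)))
    have h5 := mul_le_mul_of_nonneg_right (h.lnorm_dmul_le (i + 1) k (pderiv k u))
      (lnorm_nonneg (mulOp _ (h.mult (i + 2)) (lap n R u)))
    rw [← hb] at h3 h5
    nlinarith [sq_nonneg (K (i + 1) * lnorm (mulOp _ (h.mult (i + 1)) (pderiv k u)) - b)]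
  have h2 : ∀ k l, -2 * l2form n R (mulOp _ ((h.mult (i + 2)).dmul l) (pderiv k u))
          (mulOp _ (h.mult (i + 2)) (pderiv l (pderiv k u))) ≤
      2 * K (i + 1) ^ 2 * lnorm (mulOp _ (h.mult (i + 1)) (pderiv k u)) ^ 2 +
        1 / 2 * lnorm (mulOp _ (h.mult (i + 2)) (pderiv l (pderiv k u))) ^ 2 := by
    intro k l
    have h3 := (neg_le_abs _).trans (abs_l2form_le (mulOp _ ((h.mult (i + 2)).dmul l) (pderiv k u))
      (mulOp _ (h.mult (i + 2)) (pderiv l (pderiv k u))))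
    have h5 := mul_le_mul_of_nonneg_right (h.lnorm_dmul_le (i + 1) l (pderiv k u))
      (lnorm_nonneg (mulOp _ (h.mult (i + 2)) (pderiv l (pderiv k u))))
    nlinarith [sq_nonneg (2 * (K (i + 1) * lnorm (mulOp _ (h.mult (i + 1)) (pderiv k u))) -
      lnorm (mulOp _ (h.mult (i + 2)) (pderiv l (pderiv k u))))]
  have h3 : ∑ k, 2 * l2form n R (mulOp _ ((h.mult (i + 2)).dmul k) (pderiv k u))
        (mulOp _ (h.mult (i + 2)) (lap n R u)) ≤ n * b ^ 2 + K (i + 1) ^ 2 * T := by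
    refine (Finset.sum_le_sum fun k _ => h1 k).trans_eq ?_
    rw [hT, Finset.sum_add_distrib, Finset.mul_sum]
    simp
  have h4 : ∑ k, ∑ l, -2 * l2form n R (mulOp _ ((h.mult (i + 2)).dmul l) (pderiv k u))
          (mulOp _ (h.mult (i + 2)) (pderiv l (pderiv k u))) ≤
        2 * n * K (i + 1) ^ 2 * T + 1 / 2 * S := by
    refine (Finset.sum_le_sum fun k _ => Finset.sum_le_sum fun l _ => h2 k l).trans_eq ?_
    rw [hT, hS, Finset.mul_sum, Finset.mul_sum, ← Finset.sum_add_distrib]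
    refine Finset.sum_congr rfl fun k _ => ?_
    rw [Finset.sum_add_distrib, Finset.mul_sum]
    simp
    ring
  have e4 : S = b ^ 2 + ∑ k, 2 * l2form n R (mulOp _ ((h.mult (i + 2)).dmul k) (pderiv k u))
        (mulOp _ (h.mult (i + 2)) (lap n R u)) +
      ∑ k, ∑ l, -2 * l2form n R (mulOp _ ((h.mult (i + 2)).dmul l) (pderiv k u))
          (mulOp _ (h.mult (i + 2)) (pderiv l (pderiv k u))) := by
    rw [e1, ← e3, ← Finset.sum_add_distrib, ← Finset.sum_add_distrib]
    refine Finset.sum_congr rfl fun k _ => ?_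
    rw [e2, ← Finset.mul_sum]
    ring
  have hT0 : 0 ≤ T := Finset.sum_nonneg fun k _ => by positivity
  clear_value T S b
  generalize (∑ k, 2 * l2form n R (mulOp _ ((h.mult (i + 2)).dmul k) (pderiv k u))
        (mulOp _ (h.mult (i + 2)) (lap n R u))) = X at *
  generalize (∑ k, ∑ l, -2 * l2form n R (mulOp _ ((h.mult (i + 2)).dmul l) (pderiv k u))
          (mulOp _ (h.mult (i + 2)) (pderiv l (pderiv k u)))) = Y at *
  have h6 : 0 ≤ K (i + 1) ^ 2 * b ^ 2 := by positivity
  have h7 : 0 ≤ (n : ℝ) * (K (i + 1) ^ 2 * b ^ 2) := by positivity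
  have h8 : 0 ≤ (n : ℝ) * T := by positivity
  clear h1 h2 e1 e2 e3 hS hT hb
  linarith

end WeightFamily

end WeightedElliptic

section Levels

variable {n : ℕ} {R : ℝ}

lemma lap_pderiv (k : Fin n) (u : testSpace n R) :
    lap n R (pderiv k u) = pderiv k (lap n R u) := by
  simp only [lap_apply, map_sum]
  exact Finset.sum_congr rfl fun l _ => by rw [pderiv_comm l k, pderiv_comm l k]

/-- The sum of the squared weighted `L²` norms of all iterated derivatives of a given order. -/
noncomputable def levelSq (g : EuclideanSpace ℝ (Fin n) → ℝ) (hg : IsMultiplier R g) :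
    ℕ → testSpace n R → ℝ
  | 0, u => lnorm (mulOp g hg u) ^ 2
  | j + 1, u => ∑ l, levelSq g hg j (pderiv l u)

lemma levelSq_nonneg (g : EuclideanSpace ℝ (Fin n) → ℝ) (hg : IsMultiplier R g) (j : ℕ)
    (u : testSpace n R) : 0 ≤ levelSq g hg j u := by
  induction j generalizing u with
  | zero => exact sq_nonneg _
  | succ j ih => exact Finset.sum_nonneg fun l _ => ih _

lemma levelSq_pderiv_le (g : EuclideanSpace ℝ (Fin n) → ℝ) (hg : IsMultiplier R g) (j : ℕ)
    (l : Fin n) (u : testSpace n R) : levelSq g hg j (pderiv l u) ≤ levelSq g hg (j + 1) u :=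
  Finset.single_le_sum (f := fun l => levelSq g hg j (pderiv l u))
    (fun _ _ => levelSq_nonneg g hg j _) (Finset.mem_univ l)

namespace WeightFamily

variable {K : ℕ → ℝ} {w : ℕ → EuclideanSpace ℝ (Fin n) → ℝ}

lemma levelSq_add_two (h : WeightFamily R K w) (s j : ℕ) (u : testSpace n R) :
    levelSq _ (h.mult (s + 2)) (j + 2) u ≤ (2 + 2 * n + (2 + 4 * n) * K (s + 1) ^ 2) *
      (levelSq _ (h.mult (s + 2)) j (lap n R u) + levelSq _ (h.mult (s + 1)) (j + 1) u) := by
  induction j generalizing u with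
  | zero => simpa [levelSq] using h.second_order s u
  | succ j ih =>
    refine (Finset.sum_le_sum fun k _ => ih (pderiv k u)).trans_eq ?_
    simp only [lap_pderiv]
    rw [← Finset.mul_sum, Finset.sum_add_distrib]
    rfl

/-- Weighted elliptic regularity: iterated derivatives are controlled by powers of the Laplacian. -/
lemma levelSq_le (R : ℝ) (K : ℕ → ℝ) (j : ℕ) : ∀ i s : ℕ, s = i + j → ∃ C : ℝ, 0 ≤ C ∧
    ∀ (w : ℕ → EuclideanSpace ℝ (Fin n) → ℝ) (h : WeightFamily R K w) (u : testSpace n R),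
      levelSq _ (h.mult s) j u ≤ C * ∑ k ∈ Finset.range ((j + 1) / 2 + 1),
        lnorm (mulOp _ (h.mult (i + 2 * k)) ((lap n R ^ k) u)) ^ 2 := by
  induction j using Nat.twoStepInduction with
  | zero =>
    rintro i s rfl
    exact ⟨1, zero_le_one, fun w h u => by simp [levelSq]⟩
  | one =>
    rintro i s rfl
    refine ⟨1 + 4 * n * K i ^ 2, by positivity, fun w h u => ?_⟩
    simpa [levelSq, Finset.sum_range_succ] using h.first_order i u
  | more j ih1 ih2 =>
    rintro i s rfl
    obtain ⟨C1, hC1, h1⟩ := ih1 (i + 2) (i + j + 2) (by omega)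
    obtain ⟨C2, hC2, h2⟩ := ih2 i (i + j + 1) (by omega)
    have hD : 0 ≤ 2 + 2 * (n : ℝ) + (2 + 4 * n) * K (i + j + 1) ^ 2 := by positivity
    refine ⟨(2 + 2 * n + (2 + 4 * n) * K (i + j + 1) ^ 2) * (C1 + C2), by positivity,
      fun w h u => (h.levelSq_add_two (i + j) j u).trans ?_⟩
    rw [mul_assoc, add_mul C1]
    refine mul_le_mul_of_nonneg_left (add_le_add ((h1 w h _).trans ?_) ((h2 w h u).trans ?_)) hD
    · refine mul_le_mul_of_nonneg_left ?_ hC1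
      rw [show (j + 2 + 1) / 2 + 1 = ((j + 1) / 2 + 1) + 1 by omega,
        Finset.sum_range_succ' _ ((j + 1) / 2 + 1)]
      apply le_add_of_le_of_nonneg
      · refine Finset.sum_le_sum fun k _ => le_of_eq ?_
        rw [pow_succ (lap n R), Module.End.mul_apply]
        simp only [show i + 2 + 2 * k = i + 2 * (k + 1) by ring]
      · exact sq_nonneg _
    · refine mul_le_mul_of_nonneg_left ?_ hC2
      exact Finset.sum_le_sum_of_subset_of_nonneg
        (Finset.range_subset_range.2 (by omega)) fun _ _ _ => sq_nonneg _

end WeightFamily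

end Levels

section SobolevChain

open scoped NNReal

variable {n : ℕ} {R : ℝ}

lemma testSpace_aestronglyMeasurable (u : testSpace n R)
    (μ : Measure (EuclideanSpace ℝ (Fin n))) : AEStronglyMeasurable u.1 μ :=
  (testSpace_contDiff u).continuous.aestronglyMeasurable

lemma eLpNorm_two_eq (u : testSpace n R) :
    eLpNorm u.1 2 volume = ENNReal.ofReal (lnorm u) := by
  have h1 : ∫⁻ x, ‖u.1 x‖ₑ ^ (2 : ℝ) = ENNReal.ofReal (l2form n R u u) := by
    rw [l2form_apply, ofReal_integral_eq_lintegral_ofReal (l2form_integrable u u)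
      (Filter.Eventually.of_forall fun x => real_inner_self_nonneg)]
    refine lintegral_congr fun x => ?_
    rw [real_inner_self_eq_norm_sq, ← ofReal_norm,
      ENNReal.ofReal_rpow_of_nonneg (norm_nonneg _) (by norm_num)]
    norm_num
  rw [eLpNorm_eq_lintegral_rpow_enorm_toReal (by norm_num) (by norm_num)]
  simp only [ENNReal.toReal_ofNat]
  rw [h1, ENNReal.ofReal_rpow_of_nonneg (l2form_self_nonneg u) (by norm_num), lnorm,
    Real.sqrt_eq_rpow]

lemma norm_fderiv_le_sum (u : testSpace n R) (x : EuclideanSpace ℝ (Fin n)) :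
    ‖fderiv ℝ u.1 x‖ ≤ ∑ l, ‖(pderiv l u).1 x‖ := by
  refine ContinuousLinearMap.opNorm_le_bound _ (Finset.sum_nonneg fun _ _ => norm_nonneg _)
    fun v => ?_
  have hv : v = ∑ l, v l • EuclideanSpace.single l (1 : ℝ) := by
    ext j
    simp [Finset.sum_apply, Pi.single_apply]
  conv_lhs => rw [hv]
  rw [map_sum, Finset.sum_mul]
  refine (norm_sum_le _ _).trans (Finset.sum_le_sum fun l _ => ?_)
  rw [map_smul, norm_smul, mul_comm]
  exact mul_le_mul_of_nonneg_left (PiLp.norm_apply_le v l) (norm_nonneg _)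

/-- The Gagliardo-Nirenberg-Sobolev inequality in terms of partial derivatives. -/
lemma sobolev_step (hn : 0 < n) {p p' : ℝ≥0} (hp : 1 ≤ p)
    (hp' : (p' : ℝ)⁻¹ = (p : ℝ)⁻¹ - (n : ℝ)⁻¹) : ∃ C : ℝ≥0, ∀ u : testSpace n R,
    eLpNorm u.1 p' volume ≤ C * ∑ l, eLpNorm (pderiv l u).1 p volume := by
  refine ⟨SNormLESNormFDerivOfEqConst ℂ (volume : Measure (EuclideanSpace ℝ (Fin n))) p,
    fun u => ?_⟩
  refine (eLpNorm_le_eLpNorm_fderiv_of_eq (μ := volume)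
    ((testSpace_contDiff u).of_le (by exact_mod_cast le_top)) (testSpace_compact u) hp
    (by simpa using hn) (by simpa using hp')).trans ?_
  gcongr
  refine (eLpNorm_mono_real (g := ∑ l, fun x => ‖(pderiv l u).1 x‖) fun x => ?_).trans ?_
  · rw [Finset.sum_apply]; exact norm_fderiv_le_sum u x
  · refine (eLpNorm_sum_le (fun l _ => ?_) (by exact_mod_cast hp)).trans ?_
    · exact (testSpace_aestronglyMeasurable _ _).norm
    · simp only [eLpNorm_norm]; rfl

namespace WeightFamily

variable {K : ℕ → ℝ} {w : ℕ → EuclideanSpace ℝ (Fin n) → ℝ}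

lemma eLpNorm_dmul_le (h : WeightFamily R K w) (i : ℕ) (l : Fin n) (p : ℝ≥0∞)
    (u : testSpace n R) : eLpNorm (mulOp _ ((h.mult (i + 1)).dmul l) u).1 p volume ≤
      ENNReal.ofReal (K i) * eLpNorm (mulOp _ (h.mult i) u).1 p volume := by
  refine eLpNorm_le_mul_eLpNorm_of_ae_le_mul (Filter.Eventually.of_forall fun x => ?_) p
  by_cases hx : x ∈ punctured n R
  · simp only [mulOp_apply, norm_smul, Real.norm_eq_abs]
    rw [← mul_assoc]
    gcongr
    exact h.grad i l x hx
  · rw [testSpace_apply_eq_zero _ hx, testSpace_apply_eq_zero _ hx]; simp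

/-- The sum of the weighted `L^q` norms of the derivatives of order at most `s`. -/
noncomputable def chainSum (h : WeightFamily R K w) (q : ℝ≥0∞) :
    ℕ → ℕ → testSpace n R → ℝ≥0∞
  | 0, i, u => eLpNorm (mulOp _ (h.mult i) u).1 q volume
  | s + 1, i, u => chainSum h q s i u + ∑ l, chainSum h q s (i + 1) (pderiv l u)

lemma sobolev_chain (hn : 0 < n) (R : ℝ) (K : ℕ → ℝ) {q : ℝ≥0} (hq : 1 ≤ q) (s : ℕ) :
    ∀ i t : ℕ, t = i + s → (s : ℝ) / n < (q : ℝ)⁻¹ → ∃ C : ℝ≥0,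
    ∀ (w : ℕ → EuclideanSpace ℝ (Fin n) → ℝ) (h : WeightFamily R K w) (u : testSpace n R),
      eLpNorm (mulOp _ (h.mult t) u).1 ((((q : ℝ)⁻¹ - s / n)⁻¹).toNNReal : ℝ≥0∞) volume ≤
        C * h.chainSum q s i u := by
  induction s with
  | zero =>
    rintro i t rfl _
    exact ⟨1, fun w h u => by simp [chainSum]⟩
  | succ s ih =>
    rintro i t rfl hlt
    have hn' : (0 : ℝ) < n := by exact_mod_cast hn
    have hs : (s : ℝ) / n < (q : ℝ)⁻¹ := by
      refine lt_trans ?_ hlt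
      push_cast
      gcongr
      linarith
    obtain ⟨C1, h1⟩ := ih (i + 1) (i + s + 1) (by omega) hs
    obtain ⟨C2, h2⟩ := ih i (i + s) rfl hs
    set a : ℝ := (q : ℝ)⁻¹ - s / n with ha
    have ha0 : 0 < a := sub_pos.2 hs
    have ha1 : a ≤ 1 := by
      have : (q : ℝ)⁻¹ ≤ 1 := inv_le_one_of_one_le₀ (by exact_mod_cast hq)
      have : 0 ≤ (s : ℝ) / n := by positivity
      linarith
    set b : ℝ := (q : ℝ)⁻¹ - (s + 1 : ℕ) / n with hb
    have hb0 : 0 < b := sub_pos.2 hlt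
    obtain ⟨C3, h3⟩ := sobolev_step (n := n) (R := R) hn (p := a⁻¹.toNNReal) (p' := b⁻¹.toNNReal)
      (by rw [← Real.toNNReal_one]; exact Real.toNNReal_le_toNNReal ((one_le_inv₀ ha0).2 ha1))
      (by
        rw [Real.coe_toNNReal _ (by positivity), Real.coe_toNNReal _ (by positivity), inv_inv,
          inv_inv, ha, hb]
        push_cast
        field_simp
        ring)
    refine ⟨C3 * (C1 + n * (K (i + s)).toNNReal * C2), fun w h u => (h3 _).trans ?_⟩
    have hp1 : (1 : ℝ≥0∞) ≤ (a⁻¹.toNNReal : ℝ≥0∞) := by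
      rw [← ENNReal.coe_one, ENNReal.coe_le_coe, ← Real.toNNReal_one]
      exact Real.toNNReal_le_toNNReal ((one_le_inv₀ ha0).2 ha1)
    have h4 : ∀ l, eLpNorm (pderiv l (mulOp _ (h.mult (i + s + 1)) u)).1 a⁻¹.toNNReal volume ≤
        C1 * h.chainSum q s (i + 1) (pderiv l u) +
          (K (i + s)).toNNReal * (C2 * h.chainSum q s i u) := by
      intro l
      rw [pderiv_mulOp']
      refine (eLpNorm_add_le (testSpace_aestronglyMeasurable _ _)
        (testSpace_aestronglyMeasurable _ _) hp1).trans ?_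
      refine add_le_add (h1 w h _) ((h.eLpNorm_dmul_le (i + s) l _ u).trans ?_)
      exact mul_le_mul_right (h2 w h u) _
    rw [ENNReal.coe_mul, mul_assoc]
    refine mul_le_mul_right ((Finset.sum_le_sum fun l _ => h4 l).trans ?_) _
    rw [Finset.sum_add_distrib, ← Finset.mul_sum]
    simp only [Finset.sum_const, Finset.card_univ, Fintype.card_fin, nsmul_eq_mul, chainSum]
    push_cast
    set X := h.chainSum q s i u
    set Y := ∑ l, h.chainSum q s (i + 1) (pderiv l u)
    calc C1 * Y + n * ((K (i + s)).toNNReal * (C2 * X))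
        ≤ (C1 * Y + n * ((K (i + s)).toNNReal * (C2 * X))) +
          (C1 * X + n * ((K (i + s)).toNNReal * (C2 * Y))) := le_self_add
      _ = _ := by ring

lemma chainSum_le (h : WeightFamily R K w) {q : ℝ≥0∞} {V : ℝ≥0∞}
    (hV : ∀ u : testSpace n R, eLpNorm u.1 q volume ≤ V * eLpNorm u.1 2 volume) {B : ℝ}
    (hB : 0 ≤ B) (s : ℕ) : ∀ (i : ℕ) (u : testSpace n R),
      (∀ j ≤ s, ∀ t, t = i + j → levelSq _ (h.mult t) j u ≤ B ^ 2) →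
        h.chainSum q s i u ≤ (n + 1) ^ s * (V * ENNReal.ofReal B) := by
  induction s with
  | zero =>
    intro i u hu
    have h1 := hu 0 le_rfl i rfl
    simp only [levelSq] at h1
    simp only [chainSum, pow_zero, one_mul]
    refine (hV _).trans ?_
    rw [eLpNorm_two_eq]
    gcongr
    exact abs_le_of_sq_le_sq' h1 hB |>.2
  | succ s ih =>
    intro i u hu
    have h1 := ih i u fun j hj t ht => hu j (by omega) t ht
    have h2 : ∀ l, h.chainSum q s (i + 1) (pderiv l u) ≤ (n + 1) ^ s * (V * ENNReal.ofReal B) :=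
      fun l => ih (i + 1) (pderiv l u) fun j hj t ht =>
        (levelSq_pderiv_le _ _ j l u).trans (hu (j + 1) (by omega) t (by omega))
    have h3 := add_le_add h1 (Finset.sum_le_sum fun l (_ : l ∈ Finset.univ) => h2 l)
    simp only [Finset.sum_const, Finset.card_univ, Fintype.card_fin, nsmul_eq_mul] at h3
    refine h3.trans_eq ?_
    ring

end WeightFamily

end SobolevChain

section EnergyBound

variable {n : ℕ} {R : ℝ}

lemma dmul_radial (hR : R ≤ 1) {G G' : ℝ → ℝ} (hd : ∀ t < 0, HasDerivAt G (G' t) t) (l : Fin n)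
    {x : EuclideanSpace ℝ (Fin n)} (hx : x ∈ punctured n R) :
    dmul (radial G) l x = G' (Real.log ‖x‖) * (x l / ‖x‖ ^ 2) := by
  have h1 := (hd _ (log_neg_of_punctured hR hx)).comp_hasFDerivAt x (hasFDerivAt_log_norm hx.2)
  have h2 : fderiv ℝ (radial G) x = _ := h1.fderiv
  rw [dmul, h2]
  simp [EuclideanSpace.inner_single_right]
  left
  ring

lemma abs_dmul_radial_le (hR : R ≤ 1) {G G' : ℝ → ℝ} (hd : ∀ t < 0, HasDerivAt G (G' t) t)
    (l : Fin n) {x : EuclideanSpace ℝ (Fin n)} (hx : x ∈ punctured n R) :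
    |dmul (radial G) l x| ≤ |G' (Real.log ‖x‖)| / ‖x‖ := by
  have hr := norm_pos_of_punctured hx
  rw [dmul_radial hR hd l hx, abs_mul, div_eq_mul_inv _ ‖x‖]
  gcongr
  rw [abs_div, abs_of_pos (by positivity : 0 < ‖x‖ ^ 2), div_le_iff₀ (by positivity)]
  calc |x l| ≤ ‖x‖ := PiLp.norm_apply_le x l
    _ = ‖x‖⁻¹ * ‖x‖ ^ 2 := by field_simp

/-- The weight `(r / τ)^i e^{-τφ} (log r)^{-m} r^{-n/2}`. -/
noncomputable def carlW (n m : ℕ) (τ : ℝ) (i : ℕ) : EuclideanSpace ℝ (Fin n) → ℝ :=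
  radial fun t => (τ ^ i)⁻¹ * wt τ m (i - n / 2) t

lemma carlW_apply (m : ℕ) (τ : ℝ) (i : ℕ) (x : EuclideanSpace ℝ (Fin n)) :
    carlW n m τ i x = (τ ^ i)⁻¹ * wt τ m (i - n / 2) (Real.log ‖x‖) := rfl

lemma wt_add_one (τ : ℝ) (j : ℕ) (a : ℝ) {x : EuclideanSpace ℝ (Fin n)} (hx : 0 < ‖x‖) :
    wt τ j (a + 1) (Real.log ‖x‖) = wt τ j a (Real.log ‖x‖) * ‖x‖ := by
  rw [← wt_mul_exp, one_mul, Real.exp_log hx]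

lemma log_le_neg_one (hR : R ≤ Real.exp (-1)) {x : EuclideanSpace ℝ (Fin n)}
    (hx : x ∈ punctured n R) : Real.log ‖x‖ ≤ -1 := by
  rw [Real.log_le_iff_le_exp (norm_pos_of_punctured hx)]
  exact (norm_lt_of_punctured hx).le.trans hR

lemma carlW_isMultiplier (hR : R ≤ 1) (m : ℕ) (τ : ℝ) (i : ℕ) :
    IsMultiplier R (carlW n m τ i) :=
  (SmoothNeg.mul contDiffOn_const (smoothNeg_wt τ m _)).isMultiplier hR

/-- A bound for the logarithmic gradients of the Carleman weights. -/
noncomputable def carlK (n m i : ℕ) : ℝ := 3 + m + |(i : ℝ) + 1 - n / 2|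

lemma carlW_family (hR : R ≤ Real.exp (-1)) (m : ℕ) {τ : ℝ} (hτ : 1 < τ) :
    WeightFamily R (carlK n m) (carlW n m τ) := by
  have hR1 : R ≤ 1 := hR.trans (by simp)
  have hτ0 : 0 < τ := by linarith
  refine ⟨carlW_isMultiplier hR1 m τ, fun i => by unfold carlK; positivity,
    fun i l x hx => ?_, fun i x hx => ?_⟩
  · have hr := norm_pos_of_punctured hx
    have ht := log_le_neg_one hR hx
    refine (abs_dmul_radial_le hR1 (G := fun t => (τ ^ (i + 1))⁻¹ * wt τ m ((i + 1 : ℕ) - n / 2) t)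
      (fun t ht => (hasDerivAt_wt τ m _ ht).const_mul _) l hx).trans ?_
    have e1 : wt τ m ((i + 1 : ℕ) - n / 2) (Real.log ‖x‖) =
        wt τ m (i - n / 2) (Real.log ‖x‖) * ‖x‖ := by
      rw [← wt_add_one _ _ _ hr]; push_cast; ring_nf
    rw [carlW_apply, e1]
    set W := wt τ m (i - n / 2) (Real.log ‖x‖)
    set t := Real.log ‖x‖
    have h3 : |-(τ - ((i + 1 : ℕ) - (n : ℝ) / 2) + (2 * τ + m) * t⁻¹)| ≤ carlK n m i * τ := by
      rw [abs_neg]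
      have h4 : |(2 * τ + m) * t⁻¹| ≤ 2 * τ + m := by
        rw [abs_mul, abs_of_nonneg (by positivity : 0 ≤ 2 * τ + m), abs_inv]
        refine mul_le_of_le_one_right (by positivity) (inv_le_one_of_one_le₀ ?_)
        rw [abs_of_neg (by linarith)]; linarith
      have h5 : |τ - ((i + 1 : ℕ) - (n : ℝ) / 2)| ≤ τ + |(i : ℝ) + 1 - n / 2| := by
        refine (abs_sub _ _).trans ?_
        rw [abs_of_pos hτ0]; push_cast; rfl
      have h6 := abs_add_le (τ - ((i + 1 : ℕ) - (n : ℝ) / 2)) ((2 * τ + m) * t⁻¹)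
      have h7 : (0 : ℝ) ≤ m := Nat.cast_nonneg m
      have h8 := abs_nonneg ((i : ℝ) + 1 - n / 2)
      rw [carlK]
      nlinarith
    rw [abs_mul, abs_mul, abs_mul, abs_mul, abs_of_pos hr, abs_inv, abs_inv, abs_pow, abs_pow,
      abs_of_pos hτ0, pow_succ, mul_inv]
    calc _ = |-(τ - ((i + 1 : ℕ) - (n : ℝ) / 2) + (2 * τ + m) * t⁻¹)| *
          ((τ ^ i)⁻¹ * τ⁻¹ * |W|) := by field_simp
      _ ≤ carlK n m i * τ * ((τ ^ i)⁻¹ * τ⁻¹ * |W|) := by gcongr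
      _ = _ := by field_simp
  · have hr := norm_pos_of_punctured hx
    have e1 : wt τ m ((i + 1 : ℕ) - n / 2) (Real.log ‖x‖) =
        wt τ m (i - n / 2) (Real.log ‖x‖) * ‖x‖ := by
      rw [← wt_add_one _ _ _ hr]; push_cast; ring_nf
    have e2 : wt τ m ((i + 2 : ℕ) - n / 2) (Real.log ‖x‖) =
        wt τ m (i - n / 2) (Real.log ‖x‖) * ‖x‖ * ‖x‖ := by
      rw [← wt_add_one _ _ _ hr, ← wt_add_one _ _ _ hr]; push_cast; ring_nf
    rw [carlW_apply, carlW_apply, carlW_apply, e1, e2]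
    field_simp
    ring

lemma mulOp_carlW (hR : R ≤ 1) (m : ℕ) (τ : ℝ) (i : ℕ) (u : testSpace n R) :
    mulOp _ (carlW_isMultiplier hR m τ i) u = (τ ^ i)⁻¹ • wtOp hR τ m (i - n / 2) u := by
  ext x
  simp [mulOp_apply, carlW_apply, wtOp, radOp_apply, mul_assoc]

/-- All weighted derivatives of order less than `2m` are controlled by `Δᵐ u`. -/
theorem energy_bound {m : ℕ} (hm : 1 ≤ m) (hn : 2 ≤ n) :
    ∃ C R₀ : ℝ, 0 < C ∧ 0 < R₀ ∧ R₀ ≤ Real.exp (-1) ∧ ∀ (hR : R₀ ≤ 1) (τ : ℝ), 1 < τ →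
      ∀ u : testSpace n R₀, ∀ j < 2 * m,
        levelSq _ (carlW_isMultiplier hR m τ j) j u ≤
        (C * (τ ^ (3 * m / 2 : ℝ))⁻¹ *
          lnorm (wtOp hR τ 0 (2 * m - n / 2) ((lap n R₀ ^ m) u))) ^ 2 := by
  obtain ⟨C, R₀, hC, hR0, _, hRe, hmain⟩ := carleman_powers hm hn
  choose D hD0 hD using fun j => WeightFamily.levelSq_le (n := n) R₀ (carlK n m) j 0 j (by simp)
  set S := ∑ j ∈ Finset.range (2 * m), D j with hS
  have hS0 : 0 ≤ S := Finset.sum_nonneg fun j _ => hD0 j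
  refine ⟨(S * (m + 1) + 1) * C, R₀, by positivity, hR0, hRe, fun hR τ hτ u j hj => ?_⟩
  have hτ0 : 0 < τ := by linarith
  set F := lnorm (wtOp hR τ 0 (2 * m - n / 2) ((lap n R₀ ^ m) u))
  set B := C * (τ ^ (3 * m / 2 : ℝ))⁻¹ * F with hB
  have hB0 : 0 ≤ B := mul_nonneg (by positivity) (lnorm_nonneg _)
  have h1 := hD j _ (carlW_family hRe m hτ) u
  have h2 : ∀ k ∈ Finset.range ((j + 1) / 2 + 1),
      lnorm (mulOp _ ((carlW_family (n := n) hRe m hτ).mult (0 + 2 * k)) ((lap n R₀ ^ k) u)) ^ 2 ≤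
        B ^ 2 := by
    intro k hk
    have hkm : k ≤ m := by have := Finset.mem_range.1 hk; omega
    have h3 := hmain hR τ hτ u k hkm
    refine pow_le_pow_left₀ (lnorm_nonneg _) ?_ 2
    rw [mulOp_carlW hR, lnorm_smul, abs_of_pos (by positivity)]
    simp only [zero_add]
    have e : τ ^ ((3 * m - 4 * k) / 2 : ℝ) = τ ^ (3 * m / 2 : ℝ) * (τ ^ (2 * k))⁻¹ := by
      rw [← Real.rpow_natCast, ← Real.rpow_neg hτ0.le, ← Real.rpow_add hτ0]
      congr 1
      push_cast; ring
    rw [e] at h3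
    have hp : 0 < τ ^ (3 * m / 2 : ℝ) := by positivity
    rw [hB, mul_assoc, mul_comm _ F, ← mul_assoc, ← div_eq_mul_inv, le_div_iff₀ hp]
    refine le_trans (le_of_eq ?_) h3
    push_cast; ring
  have h3 : D j ≤ S := Finset.single_le_sum (f := D) (fun i _ => hD0 i) (Finset.mem_range.2 hj)
  have h4 : (((j + 1) / 2 + 1 : ℕ) : ℝ) ≤ m + 1 := by
    have : (j + 1) / 2 + 1 ≤ m + 1 := by omega
    exact_mod_cast this
  calc _ ≤ D j * ∑ k ∈ Finset.range ((j + 1) / 2 + 1), B ^ 2 :=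
        h1.trans (mul_le_mul_of_nonneg_left (Finset.sum_le_sum h2) (hD0 j))
    _ = D j * ((((j + 1) / 2 + 1 : ℕ) : ℝ) * B ^ 2) := by simp
    _ ≤ S * ((m + 1) * B ^ 2) := by gcongr
    _ = S * (m + 1) * B ^ 2 := by ring
    _ ≤ (S * (m + 1) + 1) ^ 2 * B ^ 2 := by
        gcongr
        have : 0 ≤ S * (m + 1) := by positivity
        nlinarith
    _ = _ := by rw [hB]; ring

end EnergyBound

section RayEstimate

open Polynomial in
lemma integral_pow_smul_by_parts (p : Polynomial ℝ) (i : ℕ) : ∃ q r : Polynomial ℝ,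
    ∀ f f' : ℝ → ℂ, (∀ x, HasDerivAt f (f' x) x) → Continuous f' →
      ∫ x in (0 : ℝ)..1, (x ^ i * p.eval x) • f x =
        (∫ x in (0 : ℝ)..1, (x ^ (i + 1) * q.eval x) • f x) -
          ∫ x in (0 : ℝ)..1, (x ^ (i + 1) * r.eval x) • f' x := by
  set r : Polynomial ℝ := C ((i : ℝ) + 1)⁻¹ * ((1 - X) * p) with hr
  refine ⟨p - derivative r, r, fun f f' hf hf' => ?_⟩
  have hfc : Continuous f := continuous_iff_continuousAt.2 fun x => (hf x).continuousAt
  have hpc : ∀ p : Polynomial ℝ, Continuous fun x : ℝ => p.eval x := fun p => p.continuous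
  have hr' : ∀ x : ℝ, ((i : ℝ) + 1) * r.eval x = (1 - x) * p.eval x := by
    intro x
    simp [hr]
    field_simp
  have hd : ∀ x, HasDerivAt (fun x : ℝ => (x ^ (i + 1) * r.eval x) • f x)
      ((x ^ i * p.eval x) • f x - (x ^ (i + 1) * (p - derivative r).eval x) • f x +
        (x ^ (i + 1) * r.eval x) • f' x) x := by
    intro x
    refine (((hasDerivAt_pow (i + 1) x).mul (r.hasDerivAt x)).smul (hf x)).congr_deriv ?_
    simp only [Pi.mul_apply]
    rw [add_comm, ← sub_smul]
    congr 2
    have := hr' x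
    simp only [eval_sub, Nat.add_sub_cancel]
    push_cast
    linear_combination x ^ i * this
  have hi : ∀ (j : ℕ) (p : Polynomial ℝ) (g : ℝ → ℂ), Continuous g →
      IntervalIntegrable (fun x : ℝ => (x ^ j * p.eval x) • g x) volume 0 1 := fun j p g hg =>
    (((continuous_pow j).mul (hpc p)).smul hg).intervalIntegrable _ _
  have h1 := intervalIntegral.integral_eq_sub_of_hasDerivAt (a := 0) (b := 1) (fun x _ => hd x)
    (((hi i p f hfc).sub (hi (i + 1) _ f hfc)).add (hi (i + 1) r f' hf'))
  rw [intervalIntegral.integral_add ((hi i p f hfc).sub (hi (i + 1) _ f hfc))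
    (hi (i + 1) r f' hf'), intervalIntegral.integral_sub (hi i p f hfc) (hi (i + 1) _ f hfc)] at h1
  have h2 : r.eval 1 = 0 := by simp [hr]
  rw [h2] at h1
  simp only [mul_zero, zero_smul, ne_eq, Nat.succ_ne_zero, not_false_eq_true, zero_pow, zero_mul,
    sub_zero] at h1
  linear_combination h1

variable {n : ℕ} {R : ℝ}

/-- The sum of the absolute values of all iterated derivatives of a given order. -/
noncomputable def absLevel : ℕ → testSpace n R → EuclideanSpace ℝ (Fin n) → ℝ
  | 0, u => fun y => ‖u.1 y‖
  | j + 1, u => fun y => ∑ l, absLevel j (pderiv l u) y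

lemma absLevel_nonneg (j : ℕ) (u : testSpace n R) (y : EuclideanSpace ℝ (Fin n)) :
    0 ≤ absLevel j u y := by
  induction j generalizing u with
  | zero => exact norm_nonneg _
  | succ j ih => exact Finset.sum_nonneg fun l _ => ih _

lemma absLevel_eq_zero (j : ℕ) (u : testSpace n R) {y : EuclideanSpace ℝ (Fin n)}
    (hy : y ∉ punctured n R) : absLevel j u y = 0 := by
  induction j generalizing u with
  | zero => simp [absLevel, testSpace_apply_eq_zero u hy]
  | succ j ih => simp [absLevel, ih]

lemma continuous_absLevel (j : ℕ) (u : testSpace n R) : Continuous (absLevel j u) := by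
  induction j generalizing u with
  | zero => exact (testSpace_contDiff u).continuous.norm
  | succ j ih => exact continuous_finsetSum _ fun l _ => ih _

/-- The weighted integral of the derivatives of order `j` along a ray. -/
noncomputable def rayInt (x z : EuclideanSpace ℝ (Fin n)) (h : ℝ) (i j : ℕ)
    (u : testSpace n R) : ℝ :=
  ∫ t in (0 : ℝ)..1, t ^ i * absLevel j u (x + (t * h) • z)

lemma continuous_ray (x z : EuclideanSpace ℝ (Fin n)) (h : ℝ) :
    Continuous fun t : ℝ => x + (t * h) • z := by fun_prop

lemma rayInt_nonneg (x z : EuclideanSpace ℝ (Fin n)) (h : ℝ) (i j : ℕ) (u : testSpace n R) :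
    0 ≤ rayInt x z h i j u :=
  intervalIntegral.integral_nonneg zero_le_one fun _ ht =>
    mul_nonneg (pow_nonneg ht.1 _) (absLevel_nonneg j u _)

lemma rayInt_intervalIntegrable (x z : EuclideanSpace ℝ (Fin n)) (h : ℝ) (i j : ℕ)
    (u : testSpace n R) : IntervalIntegrable
      (fun t => t ^ i * absLevel j u (x + (t * h) • z)) volume 0 1 :=
  ((continuous_pow i).mul ((continuous_absLevel j u).comp
    (continuous_ray x z h))).intervalIntegrable _ _

lemma rayInt_succ (x z : EuclideanSpace ℝ (Fin n)) (h : ℝ) (i j : ℕ) (u : testSpace n R) :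
    rayInt x z h i (j + 1) u = ∑ l, rayInt x z h i j (pderiv l u) := by
  simp only [rayInt]
  rw [← intervalIntegral.integral_finsetSum fun l _ => rayInt_intervalIntegrable x z h i j _]
  simp only [absLevel, Finset.mul_sum]

lemma fderiv_eq_sum (u : testSpace n R) (x v : EuclideanSpace ℝ (Fin n)) :
    fderiv ℝ u.1 x v = ∑ l, v l • (pderiv l u).1 x := by
  have hv : v = ∑ l, v l • EuclideanSpace.single l (1 : ℝ) := by
    ext j
    simp [Finset.sum_apply, Pi.single_apply]
  conv_lhs => rw [hv]
  rw [map_sum]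
  exact Finset.sum_congr rfl fun l _ => by rw [map_smul]; rfl

lemma hasDerivAt_ray (u : testSpace n R) (x z : EuclideanSpace ℝ (Fin n)) (h t : ℝ) :
    HasDerivAt (fun t : ℝ => u.1 (x + (t * h) • z))
      (∑ l, (h * z l) • (pderiv l u).1 (x + (t * h) • z)) t := by
  have h1 : HasDerivAt (fun t : ℝ => x + (t * h) • z) (h • z) t := by
    have := (((hasDerivAt_id t).mul_const h).smul_const z).const_add x
    simpa using this
  have h2 := ((testSpace_differentiable u _).hasFDerivAt).comp_hasDerivAt t h1
  refine h2.congr_deriv ?_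
  rw [fderiv_eq_sum]
  simp

lemma continuous_comp_ray (u : testSpace n R) (x z : EuclideanSpace ℝ (Fin n)) (h : ℝ) :
    Continuous fun t : ℝ => u.1 (x + (t * h) • z) :=
  (testSpace_contDiff u).continuous.comp (continuous_ray x z h)

lemma continuous_ray_deriv (u : testSpace n R) (x z : EuclideanSpace ℝ (Fin n)) (h : ℝ) :
    Continuous fun t : ℝ => ∑ l, (h * z l) • (pderiv l u).1 (x + (t * h) • z) :=
  continuous_finsetSum _ fun l _ => (continuous_comp_ray (pderiv l u) x z h).const_smul (h * z l)

lemma norm_integral_ray_deriv_le (g : ℝ → ℝ) (hg : Continuous g) (u : testSpace n R)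
    {x z : EuclideanSpace ℝ (Fin n)} (hz : ‖z‖ ≤ 1) {h : ℝ} (hh : 0 ≤ h) :
    ‖∫ t in (0 : ℝ)..1, g t • ∑ l, (h * z l) • (pderiv l u).1 (x + (t * h) • z)‖ ≤
      h * ∑ l, ‖∫ t in (0 : ℝ)..1, g t • (pderiv l u).1 (x + (t * h) • z)‖ := by
  have e : ∫ t in (0 : ℝ)..1, g t • ∑ l, (h * z l) • (pderiv l u).1 (x + (t * h) • z) =
      ∑ l, (h * z l) • ∫ t in (0 : ℝ)..1, g t • (pderiv l u).1 (x + (t * h) • z) := by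
    simp only [Finset.smul_sum, ← intervalIntegral.integral_smul]
    rw [← intervalIntegral.integral_finsetSum]
    · refine intervalIntegral.integral_congr fun t _ => ?_
      refine Finset.sum_congr rfl fun l _ => ?_
      simp only [smul_smul]
      rw [mul_comm]
    · intro l _
      have h1 := (continuous_comp_ray (pderiv l u) x z h).const_smul (h * z l)
      have h2 : Continuous fun t => g t • (h * z l) • (pderiv l u).1 (x + (t * h) • z) :=
        hg.smul h1
      have h3 : Continuous fun t => (h * z l) • g t • (pderiv l u).1 (x + (t * h) • z) := by
        simpa only [smul_smul, mul_comm] using h2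
      exact h3.intervalIntegrable 0 1
  rw [e, Finset.mul_sum]
  refine (norm_sum_le _ _).trans (Finset.sum_le_sum fun l _ => ?_)
  rw [norm_smul, norm_mul, Real.norm_eq_abs, abs_of_nonneg hh]
  have h1 : ‖z l‖ ≤ 1 := (PiLp.norm_apply_le z l).trans hz
  gcongr
  exact mul_le_of_le_one_right hh h1

lemma norm_integral_ray_le (s : ℕ) : ∀ (i : ℕ) (p : Polynomial ℝ), ∃ C : ℝ, 0 ≤ C ∧
    ∀ (u : testSpace n R) (x z : EuclideanSpace ℝ (Fin n)) (h : ℝ), ‖z‖ ≤ 1 → 0 ≤ h →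
      ‖∫ t in (0 : ℝ)..1, (t ^ i * p.eval t) • u.1 (x + (t * h) • z)‖ ≤
        C * ∑ j ∈ Finset.range (s + 1), h ^ j * rayInt x z h (i + s) j u := by
  induction s with
  | zero =>
    intro i p
    obtain ⟨C, hC⟩ := (isCompact_Icc (a := (0 : ℝ)) (b := 1)).exists_bound_of_continuousOn
      p.continuous.continuousOn
    have hC0 : 0 ≤ C := (norm_nonneg _).trans (hC 0 (by simp))
    refine ⟨C, hC0, fun u x z h hz hh => ?_⟩
    simp only [zero_add, Finset.sum_range_one, pow_zero, one_mul, rayInt, add_zero, absLevel]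
    rw [← intervalIntegral.integral_const_mul]
    refine intervalIntegral.norm_integral_le_of_norm_le zero_le_one
      (Filter.Eventually.of_forall fun t ht => ?_)
      ((rayInt_intervalIntegrable x z h i 0 u).const_mul C)
    have ht' : t ∈ Set.Icc (0 : ℝ) 1 := ⟨ht.1.le, ht.2⟩
    rw [norm_smul, norm_mul, norm_pow, Real.norm_eq_abs, abs_of_nonneg ht'.1]
    calc t ^ i * ‖p.eval t‖ * ‖u.1 (x + (t * h) • z)‖ ≤ t ^ i * C * ‖u.1 (x + (t * h) • z)‖ := by
          have := ht'.1
          gcongr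
          exact hC t ht'
      _ = _ := by ring
  | succ s ih =>
    intro i p
    obtain ⟨q, r, hqr⟩ := integral_pow_smul_by_parts p i
    obtain ⟨C1, hC1, h1⟩ := ih (i + 1) q
    obtain ⟨C2, hC2, h2⟩ := ih (i + 1) r
    refine ⟨C1 + C2, by positivity, fun u x z h hz hh => ?_⟩
    rw [hqr _ _ (fun t => hasDerivAt_ray u x z h t) (continuous_ray_deriv u x z h)]
    have h3 := norm_integral_ray_deriv_le (fun t => t ^ (i + 1) * r.eval t)
      ((continuous_pow _).mul r.continuous) u (x := x) hz hh
    have hnn : ∀ j, 0 ≤ h ^ j * rayInt x z h (i + (s + 1)) j u := fun j =>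
      mul_nonneg (pow_nonneg hh j) (rayInt_nonneg x z h _ j u)
    have hi : i + 1 + s = i + (s + 1) := by ring
    have h4 : h * ∑ l, ‖∫ t in (0 : ℝ)..1, (t ^ (i + 1) * r.eval t) •
        (pderiv l u).1 (x + (t * h) • z)‖ ≤
        C2 * ∑ j ∈ Finset.range (s + 1 + 1), h ^ j * rayInt x z h (i + (s + 1)) j u := by
      calc _ ≤ h * ∑ l, C2 * ∑ j ∈ Finset.range (s + 1),
            h ^ j * rayInt x z h (i + 1 + s) j (pderiv l u) := by
            gcongr with l
            exact h2 (pderiv l u) x z h hz hh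
        _ = C2 * ∑ j ∈ Finset.range (s + 1),
            h ^ (j + 1) * rayInt x z h (i + (s + 1)) (j + 1) u := by
            simp only [rayInt_succ, hi, ← Finset.mul_sum]
            rw [Finset.sum_comm]
            simp only [Finset.mul_sum]
            refine Finset.sum_congr rfl fun j _ => Finset.sum_congr rfl fun l _ => ?_
            ring
        _ ≤ _ := by
            rw [Finset.sum_range_succ' _ (s + 1)]
            exact mul_le_mul_of_nonneg_left (le_add_of_nonneg_right (hnn 0)) hC2
    have h5 := h1 u x z h hz hh
    rw [hi] at h5
    have h6 : C1 * ∑ j ∈ Finset.range (s + 1), h ^ j * rayInt x z h (i + (s + 1)) j u ≤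
        C1 * ∑ j ∈ Finset.range (s + 1 + 1), h ^ j * rayInt x z h (i + (s + 1)) j u := by
      refine mul_le_mul_of_nonneg_left ?_ hC1
      rw [Finset.sum_range_succ _ (s + 1)]
      exact le_add_of_nonneg_right (hnn _)
    refine (norm_sub_le _ _).trans ?_
    rw [add_mul]
    exact add_le_add (h5.trans h6) (h3.trans h4)

/-- A function is controlled at a point by weighted integrals of its derivatives along a ray. -/
lemma norm_le_rayInt (n : ℕ) (R : ℝ) (s : ℕ) : ∃ C : ℝ, 0 ≤ C ∧
    ∀ (u : testSpace n R) (x z : EuclideanSpace ℝ (Fin n)) (h : ℝ), ‖z‖ ≤ 1 → 0 ≤ h →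
      ‖u.1 x‖ ≤ C * ∑ j ∈ Finset.range (s + 2), h ^ j * rayInt x z h s j u := by
  obtain ⟨C1, hC1, h1⟩ := norm_integral_ray_le (n := n) (R := R) s 0 1
  obtain ⟨C2, hC2, h2⟩ := norm_integral_ray_le (n := n) (R := R) s 0 (1 - Polynomial.X)
  refine ⟨C1 + C2, by positivity, fun u x z h hz hh => ?_⟩
  have hd : ∀ t, HasDerivAt (fun t : ℝ => (1 - t) • u.1 (x + (t * h) • z))
      ((1 - t) • (∑ l, (h * z l) • (pderiv l u).1 (x + (t * h) • z)) +
        (-1 : ℝ) • u.1 (x + (t * h) • z)) t := fun t =>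
    (((hasDerivAt_id t).const_sub 1)).smul (hasDerivAt_ray u x z h t)
  have hc1 := continuous_comp_ray u x z h
  have hc2 : Continuous fun t : ℝ => 1 - t := by fun_prop
  have hc3 : Continuous fun t : ℝ => (-1 : ℝ) • u.1 (x + (t * h) • z) :=
    hc1.const_smul (-1 : ℝ)
  have hc4 : Continuous fun t : ℝ =>
      (1 - t) • ∑ l, (h * z l) • (pderiv l u).1 (x + (t * h) • z) :=
    hc2.smul (continuous_ray_deriv u x z h)
  have e := intervalIntegral.integral_eq_sub_of_hasDerivAt (a := 0) (b := 1) (fun t _ => hd t)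
    ((hc4.add hc3).intervalIntegrable _ _)
  rw [intervalIntegral.integral_add
    (hc4.intervalIntegrable _ _) (hc3.intervalIntegrable _ _)] at e
  have h3 := norm_integral_ray_deriv_le (fun t => 1 - t) hc2 u (x := x) hz hh
  have h4 := h1 u x z h hz hh
  have hnn : ∀ j, 0 ≤ h ^ j * rayInt x z h s j u := fun j =>
    mul_nonneg (pow_nonneg hh j) (rayInt_nonneg x z h _ j u)
  have h5 : h * ∑ l, ‖∫ t in (0 : ℝ)..1, (1 - t) • (pderiv l u).1 (x + (t * h) • z)‖ ≤
        C2 * ∑ j ∈ Finset.range (s + 2), h ^ j * rayInt x z h s j u := by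
    calc _ ≤ h * ∑ l, C2 * ∑ j ∈ Finset.range (s + 1),
          h ^ j * rayInt x z h s j (pderiv l u) := by
          gcongr with l
          simpa using h2 (pderiv l u) x z h hz hh
      _ = C2 * ∑ j ∈ Finset.range (s + 1), h ^ (j + 1) * rayInt x z h s (j + 1) u := by
          simp only [rayInt_succ, ← Finset.mul_sum]
          rw [Finset.sum_comm]
          simp only [Finset.mul_sum]
          refine Finset.sum_congr rfl fun j _ => Finset.sum_congr rfl fun l _ => ?_
          ring
      _ ≤ _ := by
          rw [Finset.sum_range_succ' _ (s + 1)]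
          exact mul_le_mul_of_nonneg_left (le_add_of_nonneg_right (hnn 0)) hC2
  have h6 : C1 * ∑ j ∈ Finset.range (s + 1), h ^ j * rayInt x z h s j u ≤
      C1 * ∑ j ∈ Finset.range (s + 2), h ^ j * rayInt x z h s j u := by
    refine mul_le_mul_of_nonneg_left ?_ hC1
    rw [Finset.sum_range_succ _ (s + 1)]
    exact le_add_of_nonneg_right (hnn _)
  simp only [pow_zero, Polynomial.eval_one, mul_one, one_smul, zero_add] at h4
  have e2 : u.1 x = (∫ t in (0 : ℝ)..1, u.1 (x + (t * h) • z)) -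
      ∫ t in (0 : ℝ)..1, (1 - t) • ∑ l, (h * z l) • (pderiv l u).1 (x + (t * h) • z) := by
    rw [intervalIntegral.integral_smul] at e
    simp only [sub_self, zero_smul, sub_zero, one_smul, zero_mul, add_zero, neg_smul] at e
    linear_combination e
  rw [e2, add_mul]
  exact (norm_sub_le _ _).trans (add_le_add (h4.trans h6) (h3.trans h5))

end RayEstimate

section SupBound

variable {n : ℕ} {R : ℝ}

lemma abs_log_norm_sub_le {τ : ℝ} (hτ : 1 < τ) {x y : EuclideanSpace ℝ (Fin n)} (hx : 0 < ‖x‖)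
    (hy : 0 < ‖y‖) (hxy : ‖y - x‖ ≤ ‖x‖ / (2 * τ)) :
    |Real.log ‖x‖ - Real.log ‖y‖| ≤ τ⁻¹ := by
  have hτ0 : 0 < τ := by linarith
  have h1 : |‖y‖ - ‖x‖| ≤ ‖x‖ / (2 * τ) := (abs_norm_sub_norm_le y x).trans hxy
  have h2 : ‖x‖ / (2 * τ) ≤ ‖x‖ / 2 := by
    gcongr
    linarith
  obtain ⟨h3, h4⟩ := abs_le.1 h1
  have h5 : ‖x‖ / 2 ≤ ‖y‖ := by linarith
  rw [abs_le]
  constructor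
  · rw [neg_le, neg_sub, ← Real.log_div hy.ne' hx.ne']
    refine (Real.log_le_sub_one_of_pos (by positivity)).trans ?_
    rw [div_sub_one hx.ne', div_le_iff₀ hx]
    refine h4.trans ?_
    rw [div_eq_mul_inv, mul_comm, mul_inv]
    gcongr
    linarith [inv_pos.2 hτ0]
  · rw [← Real.log_div hx.ne' hy.ne']
    refine (Real.log_le_sub_one_of_pos (by positivity)).trans ?_
    rw [div_sub_one hy.ne', div_le_iff₀ hy]
    calc ‖x‖ - ‖y‖ ≤ ‖x‖ / (2 * τ) := by linarith
      _ = τ⁻¹ * (‖x‖ / 2) := by field_simp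
      _ ≤ τ⁻¹ * ‖y‖ := by gcongr

lemma abs_log_sub_log_le {p q : ℝ} (hp : 1 ≤ p) (hq : 1 ≤ q) :
    Real.log p - Real.log q ≤ |p - q| := by
  have hq0 : 0 < q := by linarith
  rw [← Real.log_div (by linarith) hq0.ne']
  refine (Real.log_le_sub_one_of_pos (by positivity)).trans ?_
  rw [div_sub_one hq0.ne']
  calc (p - q) / q ≤ |p - q| / q := by gcongr; exact le_abs_self _
    _ ≤ |p - q| := div_le_self (abs_nonneg _) hq

/-- The Carleman weights are comparable on balls of radius `r / (2τ)`. -/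
lemma abs_wt_le_abs_wt (hR : R ≤ Real.exp (-1)) {τ : ℝ} (hτ : 1 < τ) (j : ℕ) (a : ℝ)
    {x y : EuclideanSpace ℝ (Fin n)} (hx : x ∈ punctured n R) (hy : y ∈ punctured n R)
    (hxy : ‖y - x‖ ≤ ‖x‖ / (2 * τ)) :
    |wt τ j a (Real.log ‖x‖)| ≤ Real.exp (3 + |a| + j) * |wt τ j a (Real.log ‖y‖)| := by
  have hτ0 : 0 < τ := by linarith
  have hd := abs_log_norm_sub_le hτ (norm_pos_of_punctured hx) (norm_pos_of_punctured hy) hxy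
  have hp := log_le_neg_one hR hx
  have hq := log_le_neg_one hR hy
  set s := Real.log ‖x‖
  set t := Real.log ‖y‖
  have hd1 : |s - t| ≤ 1 := hd.trans (inv_le_one_of_one_le₀ hτ.le)
  have h1 : Real.exp (-τ * (s + Real.log (s ^ 2))) ≤
      Real.exp 3 * Real.exp (-τ * (t + Real.log (t ^ 2))) := by
    rw [← Real.exp_add, Real.exp_le_exp]
    have h2 := abs_log_sub_log_le (p := -t) (q := -s) (by linarith) (by linarith)
    have h3 : |-t - -s| = |s - t| := by congr 1; ring
    rw [h3, Real.log_neg_eq_log, Real.log_neg_eq_log] at h2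
    have h4 : τ * |s - t| ≤ 1 := by
      calc τ * |s - t| ≤ τ * τ⁻¹ := by gcongr
        _ = 1 := mul_inv_cancel₀ hτ0.ne'
    have h5 := neg_abs_le (s - t)
    rw [Real.log_pow, Real.log_pow]
    push_cast
    nlinarith
  have h2 : Real.exp (a * s) ≤ Real.exp |a| * Real.exp (a * t) := by
    rw [← Real.exp_add, Real.exp_le_exp]
    have : a * (s - t) ≤ |a| * 1 := by
      refine (le_abs_self _).trans ?_
      rw [abs_mul]
      gcongr
    linarith
  have h3 : |s⁻¹| ≤ Real.exp 1 * |t⁻¹| := by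
    have he : 2 ≤ Real.exp 1 := by linarith [Real.add_one_le_exp 1]
    rw [abs_inv, abs_inv, abs_of_neg (by linarith), abs_of_neg (by linarith), ← div_eq_mul_inv,
      inv_eq_one_div, div_le_div_iff₀ (by linarith) (by linarith)]
    have := (abs_le.1 hd1).2
    nlinarith
  have e : ∀ r, |wt τ j a r| =
      Real.exp (-τ * (r + Real.log (r ^ 2))) * Real.exp (a * r) * |r⁻¹| ^ j := by
    intro r
    rw [wt, abs_mul, abs_mul, Real.abs_exp, Real.abs_exp, abs_pow]
  rw [e, e, Real.exp_add, Real.exp_add]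
  have h4 : Real.exp (j : ℝ) = Real.exp 1 ^ j := by rw [← Real.exp_nat_mul, mul_one]
  rw [h4]
  calc _ ≤ (Real.exp 3 * Real.exp (-τ * (t + Real.log (t ^ 2)))) *
        (Real.exp |a| * Real.exp (a * t)) * (Real.exp 1 * |t⁻¹|) ^ j := by gcongr
    _ = _ := by rw [mul_pow]; ring

lemma measurable_carlW (m : ℕ) (τ : ℝ) (i : ℕ) : Measurable (carlW n m τ i) := by
  unfold carlW radial wt
  fun_prop

lemma eLpNorm_absLevel_le (g : EuclideanSpace ℝ (Fin n) → ℝ) (hg : IsMultiplier R g)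
    (hgm : Measurable g) {B : ℝ} (hB : 0 ≤ B) (j : ℕ) (u : testSpace n R)
    (hu : levelSq g hg j u ≤ B ^ 2) :
    eLpNorm (fun y => |g y| * absLevel j u y) 2 volume ≤ n ^ j * ENNReal.ofReal B := by
  induction j generalizing u with
  | zero =>
    have h1 : eLpNorm (fun y => |g y| * absLevel 0 u y) 2 volume =
        eLpNorm (mulOp g hg u).1 2 volume := by
      refine eLpNorm_congr_norm_ae (Filter.Eventually.of_forall fun y => ?_)
      simp [absLevel, mulOp_apply]
    rw [h1, eLpNorm_two_eq, pow_zero, one_mul]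
    exact ENNReal.ofReal_le_ofReal (abs_le_of_sq_le_sq' hu hB).2
  | succ j ih =>
    have h1 : (fun y => |g y| * absLevel (j + 1) u y) =
        ∑ l, fun y => |g y| * absLevel j (pderiv l u) y := by
      ext y
      simp [absLevel, Finset.mul_sum]
    rw [h1]
    refine (eLpNorm_sum_le (fun l _ => ?_) (by norm_num)).trans
      ((Finset.sum_le_sum fun l _ => ih _ ((levelSq_pderiv_le g hg j l u).trans hu)).trans_eq ?_)
    · exact ((hgm.abs).mul (continuous_absLevel j _).measurable).aestronglyMeasurable
    · simp [pow_succ]; ring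

lemma eLpNorm_comp_affine {f : EuclideanSpace ℝ (Fin n) → ℝ} (hf : Measurable f)
    (x : EuclideanSpace ℝ (Fin n)) {c : ℝ} (hc : 0 < c) :
    eLpNorm (fun z => f (x + c • z)) 2 volume =
      ENNReal.ofReal (c ^ (-(n / 2) : ℝ)) * eLpNorm f 2 volume := by
  have h0 : eLpNorm (fun z => f (x + c • z)) 2 volume =
      eLpNorm (fun z => f (c • z)) 2 volume := by
    have hmp := measurePreserving_add_left
      (volume : Measure (EuclideanSpace ℝ (Fin n))) (c⁻¹ • x)
    have := eLpNorm_comp_measurePreserving (p := 2) (g := fun z => f (c • z))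
      (hf.comp (measurable_const_smul c)).aestronglyMeasurable hmp
    rw [← this]
    congr 1
    ext z
    simp [smul_smul, hc.ne']
  have h1 : eLpNorm (fun z => f (c • z)) 2 volume = eLpNorm f 2 (Measure.map (c • ·) volume) :=
    (eLpNorm_map_measure hf.aestronglyMeasurable (measurable_const_smul c).aemeasurable).symm
  rw [h0, h1, Measure.map_addHaar_smul _ hc.ne', eLpNorm_smul_measure_of_ne_top (by norm_num)]
  rw [smul_eq_mul]
  congr 1
  rw [finrank_euclideanSpace_fin, abs_of_pos (by positivity),
    ENNReal.ofReal_rpow_of_pos (by positivity)]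
  congr 1
  rw [← Real.rpow_natCast, ← Real.rpow_neg hc.le, ← Real.rpow_mul hc.le]
  congr 1
  simp
  ring

/-- The `L²` average of a function over small balls along a ray. -/
lemma lintegral_ball_le {f : EuclideanSpace ℝ (Fin n) → ℝ} (hf : Measurable f)
    (x : EuclideanSpace ℝ (Fin n)) {c : ℝ} (hc : 0 < c) :
    ∫⁻ z in Metric.closedBall 0 1, ‖f (x + c • z)‖ₑ ≤
      ENNReal.ofReal (c ^ (-(n / 2) : ℝ)) * eLpNorm f 2 volume *
        volume (Metric.closedBall (0 : EuclideanSpace ℝ (Fin n)) 1) ^ (1 / 2 : ℝ) := by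
  have hm : Measurable fun z : EuclideanSpace ℝ (Fin n) => f (x + c • z) :=
    hf.comp (by fun_prop)
  rw [← eLpNorm_one_eq_lintegral_enorm, ← eLpNorm_comp_affine hf x hc]
  refine (eLpNorm_le_eLpNorm_mul_rpow_measure_univ (p := 1) (q := 2) (by norm_num)
    hm.aestronglyMeasurable).trans ?_
  rw [Measure.restrict_apply_univ]
  norm_num
  exact mul_le_mul_left (eLpNorm_mono_measure _ Measure.restrict_le_self) _

/-- A pointwise bound from `L²` bounds, by averaging over the rays in a ball. -/
lemma le_of_forall_ray_le (s : ℕ) (hs : (n : ℝ) / 2 < s + 1) : ∃ C : ℝ≥0∞, C ≠ ⊤ ∧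
    ∀ (k : ℕ) (f : ℕ → EuclideanSpace ℝ (Fin n) → ℝ), (∀ j, Measurable (f j)) →
    ∀ (x : EuclideanSpace ℝ (Fin n)) (h : ℝ), 0 < h → ∀ (A D B : ℝ≥0∞),
      (∀ j < k, eLpNorm (f j) 2 volume ≤ B) →
      (∀ z : EuclideanSpace ℝ (Fin n), ‖z‖ ≤ 1 → A ≤ D * ∑ j ∈ Finset.range k,
        ∫⁻ t in Set.Ioc (0 : ℝ) 1, ENNReal.ofReal (t ^ s) * ‖f j (x + (t * h) • z)‖ₑ) →
      A ≤ C * D * ENNReal.ofReal (h ^ (-(n / 2) : ℝ)) * (k * B) := by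
  set U := Metric.closedBall (0 : EuclideanSpace ℝ (Fin n)) 1 with hU
  have hV0 : volume U ≠ 0 := (Metric.measure_closedBall_pos volume _ one_pos).ne'
  have hVt : volume U ≠ ⊤ := measure_closedBall_lt_top.ne
  set I := ∫⁻ t in Set.Ioc (0 : ℝ) 1, ENNReal.ofReal (t ^ (s - n / 2 : ℝ)) with hI
  have hIt : I ≠ ⊤ := by
    have h1 : IntegrableOn (fun t : ℝ => t ^ (s - n / 2 : ℝ)) (Set.Ioc 0 1) :=
      (intervalIntegrable_iff_integrableOn_Ioc_of_le zero_le_one).1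
        (intervalIntegral.intervalIntegrable_rpow' (by linarith))
    exact h1.lintegral_lt_top.ne
  refine ⟨I * volume U ^ (1 / 2 : ℝ) / volume U, ?_, fun k f hf x h hh A D B hB hA => ?_⟩
  · exact ENNReal.div_ne_top (ENNReal.mul_ne_top hIt
      (ENNReal.rpow_ne_top_of_nonneg (by norm_num) hVt)) hV0
  have hmeas : ∀ j, Measurable fun q : EuclideanSpace ℝ (Fin n) × ℝ =>
      ENNReal.ofReal (q.2 ^ s) * ‖f j (x + (q.2 * h) • q.1)‖ₑ := fun j =>
    Measurable.mul (by fun_prop) ((hf j).comp (by fun_prop)).enorm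
  have hj : ∀ j < k, ∫⁻ z in U, ∫⁻ t in Set.Ioc (0 : ℝ) 1,
      ENNReal.ofReal (t ^ s) * ‖f j (x + (t * h) • z)‖ₑ ≤
      I * ENNReal.ofReal (h ^ (-(n / 2) : ℝ)) * B * volume U ^ (1 / 2 : ℝ) := by
    intro j hjk
    rw [lintegral_lintegral_swap (hmeas j).aemeasurable]
    have h1 : ∀ t ∈ Set.Ioc (0 : ℝ) 1, ∫⁻ z in U,
        ENNReal.ofReal (t ^ s) * ‖f j (x + (t * h) • z)‖ₑ ≤
        ENNReal.ofReal (t ^ (s - n / 2 : ℝ)) *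
          (ENNReal.ofReal (h ^ (-(n / 2) : ℝ)) * B * volume U ^ (1 / 2 : ℝ)) := by
      intro t ht
      have hth : 0 < t * h := mul_pos ht.1 hh
      rw [lintegral_const_mul' _ _ ENNReal.ofReal_ne_top]
      refine (mul_le_mul_right (lintegral_ball_le (hf j) x hth) _).trans ?_
      have e : ENNReal.ofReal (t ^ (s - n / 2 : ℝ)) * ENNReal.ofReal (h ^ (-(n / 2) : ℝ)) =
          ENNReal.ofReal (t ^ s) * ENNReal.ofReal ((t * h) ^ (-(n / 2) : ℝ)) := by
        rw [← ENNReal.ofReal_mul (Real.rpow_nonneg ht.1.le _),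
          ← ENNReal.ofReal_mul (pow_nonneg ht.1.le _), Real.mul_rpow ht.1.le hh.le,
          sub_eq_add_neg, Real.rpow_add ht.1, Real.rpow_natCast, mul_assoc]
      calc _ = ENNReal.ofReal (t ^ s) * ENNReal.ofReal ((t * h) ^ (-(n / 2) : ℝ)) *
            (eLpNorm (f j) 2 volume * volume U ^ (1 / 2 : ℝ)) := by ring
        _ ≤ ENNReal.ofReal (t ^ s) * ENNReal.ofReal ((t * h) ^ (-(n / 2) : ℝ)) *
            (B * volume U ^ (1 / 2 : ℝ)) := by gcongr; exact hB j hjk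
        _ = _ := by rw [← e]; ring
    refine (setLIntegral_mono' measurableSet_Ioc h1).trans_eq ?_
    rw [lintegral_mul_const _ (by fun_prop)]
    ring
  have h2 : A * volume U ≤ D * ∑ j ∈ Finset.range k,
      I * ENNReal.ofReal (h ^ (-(n / 2) : ℝ)) * B * volume U ^ (1 / 2 : ℝ) := by
    calc A * volume U = ∫⁻ z in U, A := by rw [setLIntegral_const]
      _ ≤ ∫⁻ z in U, D * ∑ j ∈ Finset.range k, ∫⁻ t in Set.Ioc (0 : ℝ) 1,
          ENNReal.ofReal (t ^ s) * ‖f j (x + (t * h) • z)‖ₑ :=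
        setLIntegral_mono' measurableSet_closedBall fun z hz => hA z (by simpa [hU] using hz)
      _ = D * ∑ j ∈ Finset.range k, ∫⁻ z in U, ∫⁻ t in Set.Ioc (0 : ℝ) 1,
          ENNReal.ofReal (t ^ s) * ‖f j (x + (t * h) • z)‖ₑ := by
        rw [lintegral_const_mul, lintegral_finsetSum]
        · exact fun j _ => (hmeas j).lintegral_prod_right'
        · exact Finset.measurable_sum _ fun j _ => (hmeas j).lintegral_prod_right'
      _ ≤ _ := by
        gcongr with j hjk
        exact hj j (Finset.mem_range.1 hjk)
  have h3 : A ≤ (D * ∑ j ∈ Finset.range k,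
      I * ENNReal.ofReal (h ^ (-(n / 2) : ℝ)) * B * volume U ^ (1 / 2 : ℝ)) / volume U :=
    (ENNReal.le_div_iff_mul_le (Or.inl hV0) (Or.inl hVt)).2 h2
  refine h3.trans_eq ?_
  rw [Finset.sum_const, Finset.card_range, nsmul_eq_mul, div_eq_mul_inv, div_eq_mul_inv (I * _)]
  ring

lemma ofReal_rayInt (x z : EuclideanSpace ℝ (Fin n)) (h : ℝ) (i j : ℕ) (u : testSpace n R) :
    ENNReal.ofReal (rayInt x z h i j u) = ∫⁻ t in Set.Ioc (0 : ℝ) 1,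
      ENNReal.ofReal (t ^ i * absLevel j u (x + (t * h) • z)) := by
  rw [rayInt, intervalIntegral.integral_of_le zero_le_one]
  refine ofReal_integral_eq_lintegral_ofReal
    ((intervalIntegrable_iff_integrableOn_Ioc_of_le zero_le_one).1
      (rayInt_intervalIntegrable x z h i j u)) ?_
  refine (ae_restrict_iff' measurableSet_Ioc).2 (Filter.Eventually.of_forall fun t ht => ?_)
  exact mul_nonneg (pow_nonneg ht.1.le _) (absLevel_nonneg j u _)

lemma abs_wt_mul_pow_le (hR : R ≤ Real.exp (-1)) (m : ℕ) {τ : ℝ} (hτ : 1 < τ) {k j : ℕ}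
    (hjk : j < k) {x y : EuclideanSpace ℝ (Fin n)} (hx : x ∈ punctured n R)
    (hy : y ∈ punctured n R) (hxy : ‖y - x‖ ≤ ‖x‖ / (2 * τ)) :
    |wt τ m 0 (Real.log ‖x‖)| * (‖x‖ / (2 * τ)) ^ j ≤
      Real.exp (3 + (k + n) + m) * ‖x‖ ^ (n / 2 : ℝ) * |carlW n m τ j y| := by
  have hτ0 : 0 < τ := by linarith
  have hx0 := norm_pos_of_punctured hx
  have h1 := abs_wt_le_abs_wt hR hτ m (j - n / 2) hx hy hxy
  have e1 : |wt τ m 0 (Real.log ‖x‖)| * ‖x‖ ^ j =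
      |wt τ m (j - n / 2) (Real.log ‖x‖)| * ‖x‖ ^ (n / 2 : ℝ) := by
    have e2 : ‖x‖ ^ j = Real.exp (Real.log ‖x‖ * j) := by
      rw [← Real.rpow_natCast, Real.rpow_def_of_pos hx0]
    rw [e2, Real.rpow_def_of_pos hx0, ← Real.abs_exp (Real.log ‖x‖ * j),
      ← Real.abs_exp (Real.log ‖x‖ * (n / 2)), ← abs_mul, ← abs_mul, mul_comm _ (j : ℝ),
      mul_comm _ ((n : ℝ) / 2), wt_mul_exp, wt_mul_exp]
    ring_nf
  have h2 : |(j : ℝ) - n / 2| ≤ k + n := by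
    have h3 : (j : ℝ) ≤ k := by exact_mod_cast hjk.le
    have h4 : (0 : ℝ) ≤ n := Nat.cast_nonneg n
    have h5 : (0 : ℝ) ≤ j := Nat.cast_nonneg j
    rw [abs_le]
    constructor <;> linarith
  have h3 : Real.exp (3 + |(j : ℝ) - n / 2| + m) ≤ Real.exp (3 + (k + n) + m) := by
    gcongr
  have h4 : ((2 * τ) ^ j)⁻¹ ≤ (τ ^ j)⁻¹ := by
    gcongr
    linarith
  rw [carlW_apply, abs_mul, abs_inv, abs_pow, abs_of_pos hτ0, div_pow, div_eq_mul_inv, ← mul_assoc,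
    e1]
  calc _ ≤ Real.exp (3 + (k + n) + m) * |wt τ m (j - n / 2) (Real.log ‖y‖)| *
        ‖x‖ ^ (n / 2 : ℝ) * (τ ^ j)⁻¹ := by
        gcongr
        exact h1.trans (by gcongr)
    _ = _ := by ring

/-- The uniform bound that follows from weighted `L²` bounds for sufficiently many derivatives. -/
theorem norm_wt_smul_le (m : ℕ) (hn : n + 2 < 4 * m) (hR : R ≤ Real.exp (-1)) :
    ∃ C : ℝ≥0∞, C ≠ ⊤ ∧ ∀ (hR1 : R ≤ 1) (τ : ℝ), 1 < τ → ∀ (B : ℝ), 0 ≤ B →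
      ∀ u : testSpace n R,
      (∀ j < 2 * m, levelSq _ (carlW_isMultiplier hR1 m τ j) j u ≤ B ^ 2) →
      ∀ x, ENNReal.ofReal (|wt τ m 0 (Real.log ‖x‖)| * ‖u.1 x‖) ≤
        C * ENNReal.ofReal (τ ^ (n / 2 : ℝ)) * ENNReal.ofReal B := by
  obtain ⟨C1, hC1, h1⟩ := norm_le_rayInt n R (2 * m - 2)
  obtain ⟨C2, hC2, h2⟩ := le_of_forall_ray_le (n := n) (2 * m - 2) (by
    have h3 : ((2 * m - 2 : ℕ) : ℝ) = 2 * m - 2 := by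
      rw [Nat.cast_sub (by omega)]; push_cast; ring
    have h4 : (n : ℝ) + 2 < 4 * m := by exact_mod_cast hn
    rw [h3]; linarith)
  set E := Real.exp (3 + ((2 * m : ℕ) + n) + m) with hE
  refine ⟨C2 * ENNReal.ofReal (C1 * E * 2 ^ (n / 2 : ℝ)) * ((2 * m : ℕ) * (n + 1) ^ (2 * m)),
    by finiteness, fun hR1 τ hτ B hB u hu x => ?_⟩
  have hτ0 : 0 < τ := by linarith
  by_cases hx : x ∈ punctured n R
  swap
  · rw [testSpace_apply_eq_zero u hx]; simp
  have hx0 := norm_pos_of_punctured hx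
  set h := ‖x‖ / (2 * τ) with hh
  have hh0 : 0 < h := by positivity
  set f : ℕ → EuclideanSpace ℝ (Fin n) → ℝ := fun j y => |carlW n m τ j y| * absLevel j u y
  have key := h2 (2 * m) f
    (fun j => (measurable_carlW m τ j).abs.mul (continuous_absLevel j u).measurable) x h hh0
    (ENNReal.ofReal (|wt τ m 0 (Real.log ‖x‖)| * ‖u.1 x‖))
    (ENNReal.ofReal (C1 * E * ‖x‖ ^ (n / 2 : ℝ))) ((n + 1) ^ (2 * m) * ENNReal.ofReal B) ?_ ?_
  · refine key.trans_eq ?_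
    have e : C1 * E * ‖x‖ ^ (n / 2 : ℝ) * h ^ (-(n / 2) : ℝ) =
        C1 * E * 2 ^ (n / 2 : ℝ) * τ ^ (n / 2 : ℝ) := by
      rw [hh, Real.rpow_neg (by positivity), Real.div_rpow (by positivity) (by positivity),
        Real.mul_rpow (by positivity) (by positivity)]
      field_simp
    rw [mul_assoc C2, ← ENNReal.ofReal_mul (by positivity), e, ENNReal.ofReal_mul (by positivity)]
    ring
  · intro j hj
    refine (eLpNorm_absLevel_le _ (carlW_isMultiplier hR1 m τ j) (measurable_carlW m τ j) hB j u
      (hu j hj)).trans ?_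
    refine mul_le_mul' ?_ le_rfl
    calc (n : ℝ≥0∞) ^ j ≤ (n + 1) ^ j := by gcongr; exact le_self_add
      _ ≤ _ := pow_le_pow_right₀ le_add_self hj.le
  · intro z hz
    have h3 := h1 u x z h hz hh0.le
    have h4 : |wt τ m 0 (Real.log ‖x‖)| * ‖u.1 x‖ ≤ |wt τ m 0 (Real.log ‖x‖)| *
        (C1 * ∑ j ∈ Finset.range (2 * m), h ^ j * rayInt x z h (2 * m - 2) j u) := by
      have e : 2 * m - 2 + 2 = 2 * m := by omega
      rw [e] at h3
      gcongr
    refine (ENNReal.ofReal_le_ofReal h4).trans ?_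
    have e : |wt τ m 0 (Real.log ‖x‖)| *
        (C1 * ∑ j ∈ Finset.range (2 * m), h ^ j * rayInt x z h (2 * m - 2) j u) =
        C1 * ∑ j ∈ Finset.range (2 * m),
          |wt τ m 0 (Real.log ‖x‖)| * h ^ j * rayInt x z h (2 * m - 2) j u := by
      simp only [mul_assoc, ← Finset.mul_sum]
      ring
    have hr : ∀ j, 0 ≤ rayInt x z h (2 * m - 2) j u := fun j => rayInt_nonneg x z h _ j u
    rw [e, mul_assoc C1, ENNReal.ofReal_mul hC1, ENNReal.ofReal_mul hC1, mul_assoc]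
    refine mul_le_mul_right ?_ _
    rw [ENNReal.ofReal_sum_of_nonneg fun j _ => mul_nonneg (by positivity) (hr j), Finset.mul_sum]
    refine Finset.sum_le_sum fun j hj => ?_
    rw [ENNReal.ofReal_mul (by positivity), ofReal_rayInt, ← lintegral_const_mul' _ _
      ENNReal.ofReal_ne_top, ← lintegral_const_mul' _ _ ENNReal.ofReal_ne_top]
    refine setLIntegral_mono' measurableSet_Ioc fun t ht => ?_
    have ht0 := ht.1.le
    have hT := absLevel_nonneg j u (x + (t * h) • z)
    rw [Real.enorm_eq_ofReal (mul_nonneg (abs_nonneg _) hT), ← ENNReal.ofReal_mul (by positivity),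
      ← ENNReal.ofReal_mul (by positivity), ← ENNReal.ofReal_mul (by positivity)]
    refine ENNReal.ofReal_le_ofReal ?_
    by_cases hy : x + (t * h) • z ∈ punctured n R
    · have h5 := abs_wt_mul_pow_le hR m hτ (Finset.mem_range.1 hj) hx hy (by
        rw [add_sub_cancel_left, norm_smul, norm_mul, Real.norm_of_nonneg ht0,
          Real.norm_of_nonneg hh0.le]
        calc t * h * ‖z‖ ≤ 1 * h * 1 := by gcongr; exact ht.2
          _ = _ := by ring)
      calc _ = t ^ (2 * m - 2) * absLevel j u (x + (t * h) • z) *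
            (|wt τ m 0 (Real.log ‖x‖)| * h ^ j) := by ring
        _ ≤ t ^ (2 * m - 2) * absLevel j u (x + (t * h) • z) *
            (E * ‖x‖ ^ (n / 2 : ℝ) * |carlW n m τ j (x + (t * h) • z)|) := by gcongr
        _ = _ := by ring
    · rw [absLevel_eq_zero j u hy]; simp

end SupBound

section Interpolation

lemma eLpNorm_le_interpolation {α E : Type*} [MeasurableSpace α] {μ : Measure α}
    [NormedAddCommGroup E] {f : α → E} (hf : AEStronglyMeasurable f μ) {p q r : ℝ≥0∞} {θ : ℝ}
    (h0 : 0 ≤ θ) (h1 : θ ≤ 1)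
    (h : r⁻¹ = ENNReal.ofReal θ * p⁻¹ + ENNReal.ofReal (1 - θ) * q⁻¹) :
    eLpNorm f r μ ≤ eLpNorm f p μ ^ θ * eLpNorm f q μ ^ (1 - θ) := by
  rcases h0.eq_or_lt with rfl | h0
  · have : r = q := by simpa using h
    simp [this]
  rcases h1.eq_or_lt with rfl | h1
  · have : r = p := by simpa using h
    simp [this]
  have h1' : 0 < 1 - θ := by linarith
  have hθ : ENNReal.ofReal θ ≠ 0 := by simpa using h0
  have hθ' : ENNReal.ofReal (1 - θ) ≠ 0 := by simpa using h1
  have e1 : (p / ENNReal.ofReal θ) * ENNReal.ofReal θ = p :=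
    ENNReal.div_mul_cancel hθ ENNReal.ofReal_ne_top
  have e2 : (q / ENNReal.ofReal (1 - θ)) * ENNReal.ofReal (1 - θ) = q :=
    ENNReal.div_mul_cancel hθ' ENNReal.ofReal_ne_top
  have : ENNReal.HolderTriple (p / ENNReal.ofReal θ) (q / ENNReal.ofReal (1 - θ)) r := by
    constructor
    rw [h, ENNReal.inv_div (Or.inl ENNReal.ofReal_ne_top) (Or.inl hθ),
      ENNReal.inv_div (Or.inl ENNReal.ofReal_ne_top) (Or.inl hθ'), div_eq_mul_inv, div_eq_mul_inv]
  have h3 := eLpNorm_smul_le_mul_eLpNorm (p := p / ENNReal.ofReal θ)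
    (q := q / ENNReal.ofReal (1 - θ)) (r := r) (μ := μ) (f := fun x => ‖f x‖ ^ (1 - θ))
    (φ := fun x => ‖f x‖ ^ θ)
    ((Real.continuous_rpow_const h1'.le).comp_aestronglyMeasurable hf.norm)
    ((Real.continuous_rpow_const h0.le).comp_aestronglyMeasurable hf.norm)
  rw [eLpNorm_norm_rpow f h0, eLpNorm_norm_rpow f h1', e1, e2] at h3
  refine (le_of_eq ?_).trans h3
  refine eLpNorm_congr_norm_ae (Filter.Eventually.of_forall fun x => ?_)
  rw [Pi.smul_apply', smul_eq_mul, ← Real.rpow_add_of_nonneg (norm_nonneg _) h0.le h1'.le]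
  simp

lemma mul_eLpNorm_le_of_interpolation {α E : Type*} [MeasurableSpace α] {μ : Measure α}
    [NormedAddCommGroup E] {f : α → E} (hf : AEStronglyMeasurable f μ) {p q r : ℝ≥0∞} {θ : ℝ}
    (h0 : 0 ≤ θ) (h1 : θ ≤ 1)
    (h : r⁻¹ = ENNReal.ofReal θ * p⁻¹ + ENNReal.ofReal (1 - θ) * q⁻¹) {C₁ C₂ F : ℝ≥0∞}
    {a b c τ : ℝ} (hτ : 1 < τ) (hc : c + (θ * a + (1 - θ) * b) ≤ 0)
    (hp : eLpNorm f p μ ≤ C₁ * ENNReal.ofReal (τ ^ a) * F)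
    (hq : eLpNorm f q μ ≤ C₂ * ENNReal.ofReal (τ ^ b) * F) :
    ENNReal.ofReal (τ ^ c) * eLpNorm f r μ ≤ C₁ ^ θ * C₂ ^ (1 - θ) * F := by
  have h1' : 0 ≤ 1 - θ := by linarith
  have hτ0 : 0 < τ := by linarith
  have e : ENNReal.ofReal (τ ^ c) *
      (ENNReal.ofReal (τ ^ a) ^ θ * ENNReal.ofReal (τ ^ b) ^ (1 - θ)) ≤ 1 := by
    rw [ENNReal.ofReal_rpow_of_nonneg (by positivity) h0,
      ENNReal.ofReal_rpow_of_nonneg (by positivity) h1', ← ENNReal.ofReal_mul (by positivity),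
      ← ENNReal.ofReal_mul (by positivity), ← Real.rpow_mul hτ0.le, ← Real.rpow_mul hτ0.le,
      ← Real.rpow_add hτ0, ← Real.rpow_add hτ0, ENNReal.ofReal_le_one]
    exact Real.rpow_le_one_of_one_le_of_nonpos hτ.le (by linarith)
  calc _ ≤ ENNReal.ofReal (τ ^ c) * ((C₁ * ENNReal.ofReal (τ ^ a) * F) ^ θ *
        (C₂ * ENNReal.ofReal (τ ^ b) * F) ^ (1 - θ)) := by
        gcongr
        exact (eLpNorm_le_interpolation hf h0 h1 h).trans (by gcongr)
    _ = C₁ ^ θ * C₂ ^ (1 - θ) * (ENNReal.ofReal (τ ^ c) *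
        (ENNReal.ofReal (τ ^ a) ^ θ * ENNReal.ofReal (τ ^ b) ^ (1 - θ))) *
          (F ^ θ * F ^ (1 - θ)) := by
        simp only [ENNReal.mul_rpow_of_nonneg _ _ h0, ENNReal.mul_rpow_of_nonneg _ _ h1']
        ring
    _ ≤ C₁ ^ θ * C₂ ^ (1 - θ) * 1 * (F ^ θ * F ^ (1 - θ)) := by gcongr
    _ = _ := by
        rw [← ENNReal.rpow_add_of_nonneg _ _ h0 h1', mul_one]
        simp

end Interpolation

section Translation

variable {n : ℕ}

lemma eLpNorm_weightedMeasure_zero {p : ℝ} (hp : 0 < p) (f : EuclideanSpace ℝ (Fin n) → ℂ) :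
    eLpNorm f (ENNReal.ofReal p) (weightedMeasure 0) =
      eLpNorm (fun x => (‖x‖ ^ (-(n / p) : ℝ)) • f x) (ENNReal.ofReal p) volume := by
  have hp' : ENNReal.ofReal p ≠ 0 := by simpa using hp
  rw [eLpNorm_eq_lintegral_rpow_enorm_toReal hp' ENNReal.ofReal_ne_top,
    eLpNorm_eq_lintegral_rpow_enorm_toReal hp' ENNReal.ofReal_ne_top, ENNReal.toReal_ofReal hp.le,
    weightedMeasure, lintegral_withDensity_eq_lintegral_mul_non_measurable _ (by fun_prop)
      (Filter.Eventually.of_forall fun x => ENNReal.ofReal_lt_top)]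
  congr 1
  refine lintegral_congr fun x => ?_
  have hx : 0 ≤ ‖x‖ ^ (-(n / p) : ℝ) := Real.rpow_nonneg (norm_nonneg _) _
  rw [Pi.mul_apply, sub_zero, enorm_smul, ENNReal.mul_rpow_of_nonneg _ _ hp.le,
    Real.enorm_eq_ofReal hx, ENNReal.ofReal_rpow_of_nonneg hx hp.le,
    ← Real.rpow_mul (norm_nonneg _), neg_mul, div_mul_cancel₀ _ hp.ne',
    Real.rpow_neg (norm_nonneg _), Real.rpow_natCast]

lemma eLpNorm_two_weightedMeasure_zero (f : EuclideanSpace ℝ (Fin n) → ℂ) :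
    eLpNorm f 2 (weightedMeasure 0) =
      eLpNorm (fun x => (‖x‖ ^ (-(n / 2) : ℝ)) • f x) 2 volume := by
  simpa using eLpNorm_weightedMeasure_zero (p := 2) (by norm_num) f

lemma eLpNorm_weightedMeasure_translate (x₀ : EuclideanSpace ℝ (Fin n)) (p : ℝ≥0∞)
    {f : EuclideanSpace ℝ (Fin n) → ℂ} :
    eLpNorm f p (weightedMeasure x₀) = eLpNorm (fun x => f (x + x₀)) p (weightedMeasure 0) := by
  have he : MeasurableEmbedding fun x : EuclideanSpace ℝ (Fin n) => x + x₀ :=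
    (MeasurableEquiv.addRight x₀).measurableEmbedding
  have h1 : weightedMeasure x₀ = Measure.map (· + x₀) (weightedMeasure 0) := by
    ext s hs
    rw [he.map_apply, weightedMeasure, weightedMeasure, withDensity_apply _ hs,
      withDensity_apply _ (he.measurable hs),
      ← (measurePreserving_add_right volume x₀).setLIntegral_comp_preimage_emb he]
    simp
  rw [h1, he.eLpNorm_map_measure]
  rfl

lemma eLpNorm_volume_translate (x₀ : EuclideanSpace ℝ (Fin n)) (p : ℝ≥0∞)
    {f : EuclideanSpace ℝ (Fin n) → ℂ} :
    eLpNorm f p volume = eLpNorm (fun x => f (x + x₀)) p volume := by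
  have he : MeasurableEmbedding fun x : EuclideanSpace ℝ (Fin n) => x + x₀ :=
    (MeasurableEquiv.addRight x₀).measurableEmbedding
  conv_lhs => rw [← (measurePreserving_add_right volume x₀).map_eq, he.eLpNorm_map_measure]
  rfl

lemma partialDeriv_translate (x₀ : EuclideanSpace ℝ (Fin n)) (i : Fin n)
    (u : EuclideanSpace ℝ (Fin n) → ℂ) :
    partialDeriv i (fun x => u (x + x₀)) = fun x => partialDeriv i u (x + x₀) := by
  ext x
  rw [partialDeriv, fderiv_comp_add_right]
  rfl

lemma multiDeriv_translate (x₀ : EuclideanSpace ℝ (Fin n)) (α : Fin n → ℕ)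
    (u : EuclideanSpace ℝ (Fin n) → ℂ) :
    multiDeriv α (fun x => u (x + x₀)) = fun x => multiDeriv α u (x + x₀) := by
  have h1 : ∀ (i : Fin n) (a : ℕ) (v : EuclideanSpace ℝ (Fin n) → ℂ),
      (partialDeriv i)^[a] (fun x => v (x + x₀)) = fun x => (partialDeriv i)^[a] v (x + x₀) := by
    intro i a
    induction a with
    | zero => exact fun v => rfl
    | succ a ih => intro v; rw [Function.iterate_succ_apply, partialDeriv_translate, ih]; rfl
  unfold multiDeriv
  induction List.finRange n with
  | nil => rfl
  | cons i L ih => rw [List.foldr_cons, ih, h1]; rfl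

lemma iterLaplacian_translate (x₀ : EuclideanSpace ℝ (Fin n)) (m : ℕ)
    (u : EuclideanSpace ℝ (Fin n) → ℂ) :
    iterLaplacian m (fun x => u (x + x₀)) = fun x => iterLaplacian m u (x + x₀) := by
  have h1 : ∀ v : EuclideanSpace ℝ (Fin n) → ℂ,
      Laplacian.laplacian (fun x => v (x + x₀)) = fun x => Laplacian.laplacian v (x + x₀) := by
    intro v
    rw [InnerProductSpace.laplacian_eq_iteratedFDeriv_stdOrthonormalBasis,
      InnerProductSpace.laplacian_eq_iteratedFDeriv_stdOrthonormalBasis]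
    ext x
    simp only [iteratedFDeriv_comp_add_right]
  unfold iterLaplacian
  induction m generalizing u with
  | zero => rfl
  | succ m ih => rw [Function.iterate_succ_apply, h1, ih]; rfl

lemma IsTestFunction.translate {x₀ : EuclideanSpace ℝ (Fin n)} {R : ℝ}
    {u : EuclideanSpace ℝ (Fin n) → ℂ} (hu : IsTestFunction x₀ R u) :
    IsTestFunction 0 R fun x => u (x + x₀) := by
  obtain ⟨h1, h2, h3⟩ := hu
  have e : tsupport (fun x => u (x + x₀)) = (· + x₀) ⁻¹' tsupport u :=
    tsupport_comp_eq_preimage u (Homeomorph.addRight x₀)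
  refine ⟨h1.comp (contDiff_id.add contDiff_const), h2.comp_homeomorph (Homeomorph.addRight x₀),
    fun x hx => ?_⟩
  rw [e] at hx
  have := h3 hx
  simpa [dist_eq_norm] using this

lemma weightedLower_translate (m j : ℕ) (x₀ : EuclideanSpace ℝ (Fin n)) (τ : ℝ)
    (f : EuclideanSpace ℝ (Fin n) → ℂ) :
    (fun x => weightedLower m j x₀ τ f (x + x₀)) = weightedLower m j 0 τ fun x => f (x + x₀) := by
  ext x
  simp [weightedLower]

lemma laplacianNorm_translate (m : ℕ) (x₀ : EuclideanSpace ℝ (Fin n)) (τ : ℝ)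
    (u : EuclideanSpace ℝ (Fin n) → ℂ) :
    laplacianNorm m x₀ τ u = laplacianNorm m 0 τ fun x => u (x + x₀) := by
  rw [laplacianNorm, laplacianNorm, eLpNorm_weightedMeasure_translate, iterLaplacian_translate]
  simp

lemma derivativeSum_translate (m : ℕ) (J : Finset ℕ) (x₀ : EuclideanSpace ℝ (Fin n)) (τ : ℝ)
    (u : EuclideanSpace ℝ (Fin n) → ℂ) :
    derivativeSum m J x₀ τ u = derivativeSum m J 0 τ fun x => u (x + x₀) := by
  simp only [derivativeSum, eLpNorm_weightedMeasure_translate x₀, weightedLower_translate,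
    multiDeriv_translate]

end Translation

section Conversion

variable {n : ℕ} {R : ℝ}

lemma coe_iterate_pderiv (i : Fin n) (a : ℕ) (u : testSpace n R) :
    ((pderiv i)^[a] u).1 = (partialDeriv i)^[a] u.1 := by
  induction a generalizing u with
  | zero => rfl
  | succ a ih => rw [Function.iterate_succ_apply, ih]; rfl

lemma levelSq_iterate_le (g : EuclideanSpace ℝ (Fin n) → ℝ) (hg : IsMultiplier R g) (i : Fin n)
    (a k : ℕ) (u : testSpace n R) :
    levelSq g hg k ((pderiv i)^[a] u) ≤ levelSq g hg (k + a) u := by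
  induction a generalizing u with
  | zero => rfl
  | succ a ih => exact (ih _).trans (levelSq_pderiv_le g hg (k + a) i u)

lemma exists_multiDeriv (α : Fin n → ℕ) (u : testSpace n R) : ∃ v : testSpace n R,
    v.1 = multiDeriv α u.1 ∧ ∀ (g : EuclideanSpace ℝ (Fin n) → ℝ) (hg : IsMultiplier R g),
      levelSq g hg 0 v ≤ levelSq g hg (∑ i, α i) u := by
  have h1 : ∀ L : List (Fin n), ∃ v : testSpace n R,
      v.1 = L.foldr (fun i f => (partialDeriv i)^[α i] f) u.1 ∧
      ∀ (g : EuclideanSpace ℝ (Fin n) → ℝ) (hg : IsMultiplier R g) (k : ℕ),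
        levelSq g hg k v ≤ levelSq g hg (k + (L.map α).sum) u := by
    intro L
    induction L with
    | nil => exact ⟨u, rfl, fun g hg k => le_rfl⟩
    | cons i L ih =>
      obtain ⟨v, hv, hle⟩ := ih
      refine ⟨(pderiv i)^[α i] v, by rw [coe_iterate_pderiv, hv]; rfl, fun g hg k => ?_⟩
      refine (levelSq_iterate_le g hg i _ k v).trans ((hle g hg _).trans_eq ?_)
      rw [List.map_cons, List.sum_cons, add_assoc]
  obtain ⟨v, hv, hle⟩ := h1 (List.finRange n)
  refine ⟨v, hv, fun g hg => (hle g hg 0).trans_eq ?_⟩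
  rw [zero_add, ← Fin.sum_univ_def]

lemma iterLaplacian_eq (m : ℕ) (u : testSpace n R) :
    iterLaplacian m u.1 = ((lap n R ^ m) u).1 := by
  have h1 : ∀ v : testSpace n R, Laplacian.laplacian v.1 = (lap n R v).1 := by
    intro v
    have hd : Differentiable ℝ (fderiv ℝ v.1) :=
      ((testSpace_contDiff v).fderiv_right (m := ∞) (by simp)).differentiable (by simp)
    rw [InnerProductSpace.laplacian_eq_iteratedFDeriv_orthonormalBasis _
      (EuclideanSpace.basisFun (Fin n) ℝ), lap_apply]
    ext x
    rw [Submodule.coe_sum, Finset.sum_apply]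
    refine Finset.sum_congr rfl fun i _ => ?_
    rw [iteratedFDeriv_two_apply]
    simp only [EuclideanSpace.basisFun_apply, Matrix.cons_val_zero, Matrix.cons_val_one]
    change _ = fderiv ℝ (fun y => fderiv ℝ v.1 y (EuclideanSpace.single i 1)) x _
    rw [fderiv_clm_apply (hd x) (differentiableAt_const _)]
    simp
  unfold iterLaplacian
  induction m generalizing u with
  | zero => rfl
  | succ m ih => rw [Function.iterate_succ_apply, h1, ih, pow_succ]; rfl

lemma rpow_smul_wt_smul {x : EuclideanSpace ℝ (Fin n)} (hx : x ∈ punctured n R) (τ : ℝ) (m : ℕ)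
    (a b : ℝ) (z : ℂ) : (‖x‖ ^ b) • wt τ m a (Real.log ‖x‖) • z =
      wt τ m (a + b) (Real.log ‖x‖) • z := by
  rw [smul_smul, mul_comm, Real.rpow_def_of_pos (norm_pos_of_punctured hx), mul_comm _ b,
    wt_mul_exp]

lemma weightedLower_apply {x : EuclideanSpace ℝ (Fin n)} (hx : x ∈ punctured n R) (m j : ℕ)
    (τ : ℝ) (f : EuclideanSpace ℝ (Fin n) → ℂ) :
    weightedLower m j 0 τ f x = wt τ m j (Real.log ‖x‖) • f x := by
  have e : Real.exp (j * Real.log ‖x‖) = ‖x‖ ^ j := by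
    rw [mul_comm, ← Real.rpow_def_of_pos (norm_pos_of_punctured hx), Real.rpow_natCast]
  rw [weightedLower, wt, e, sub_zero, phi, inv_pow]
  congr 1
  ring

lemma eLpNorm_weightedLower (m j : ℕ) (τ : ℝ) {p : ℝ} (hp : 0 < p) (u : testSpace n R) :
    eLpNorm (weightedLower m j 0 τ u.1) (ENNReal.ofReal p) (weightedMeasure 0) =
      eLpNorm (fun x => wt τ m (j - n / p) (Real.log ‖x‖) • u.1 x) (ENNReal.ofReal p) volume := by
  rw [eLpNorm_weightedMeasure_zero hp]
  congr 1
  ext x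
  by_cases hx : x ∈ punctured n R
  · rw [weightedLower_apply hx, rpow_smul_wt_smul hx, sub_eq_add_neg]
  · simp [weightedLower, testSpace_apply_eq_zero u hx]

lemma eLpNorm_two_weightedLower (m j : ℕ) (τ : ℝ) (u : testSpace n R) :
    eLpNorm (weightedLower m j 0 τ u.1) 2 (weightedMeasure 0) =
      eLpNorm (fun x => wt τ m (j - n / 2) (Real.log ‖x‖) • u.1 x) 2 volume := by
  simpa using eLpNorm_weightedLower m j τ (p := 2) (by norm_num) u

lemma eLpNorm_wt_smul (hR : R ≤ 1) (m j : ℕ) {τ : ℝ} (hτ : 0 < τ) (p : ℝ≥0∞)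
    (u : testSpace n R) :
    eLpNorm (fun x => wt τ m (j - n / 2) (Real.log ‖x‖) • u.1 x) p volume =
      ENNReal.ofReal (τ ^ j) * eLpNorm (mulOp _ (carlW_isMultiplier hR m τ j) u).1 p volume := by
  have e : (fun x => wt τ m (j - n / 2) (Real.log ‖x‖) • u.1 x) =
      (τ ^ j) • (mulOp _ (carlW_isMultiplier hR m τ j) u).1 := by
    ext x
    rw [Pi.smul_apply, mulOp_apply, carlW_apply, smul_smul,
      mul_inv_cancel_left₀ (pow_ne_zero _ hτ.ne')]
  rw [e, eLpNorm_const_smul, Real.enorm_eq_ofReal (by positivity)]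

lemma laplacianNorm_eq (hR : R ≤ 1) (m : ℕ) (τ : ℝ) (u : testSpace n R) :
    laplacianNorm m 0 τ u.1 =
      ENNReal.ofReal (lnorm (wtOp hR τ 0 (2 * m - n / 2) ((lap n R ^ m) u))) := by
  rw [← eLpNorm_two_eq, laplacianNorm, eLpNorm_two_weightedMeasure_zero]
  congr 1
  ext x
  rw [iterLaplacian_eq, wtOp, radOp_apply]
  by_cases hx : x ∈ punctured n R
  · have := weightedLower_apply hx 0 (2 * m) τ ((lap n R ^ m) u).1
    rw [weightedLower, sub_zero, pow_zero, inv_one, mul_one] at this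
    rw [sub_zero, this, rpow_smul_wt_smul hx, sub_eq_add_neg]
    push_cast
    rfl
  · simp [testSpace_apply_eq_zero _ hx]

lemma eLpNorm_weightedLower_multiDeriv_le (hR : R ≤ 1) (m j : ℕ) {τ : ℝ} (hτ : 0 < τ)
    {α : Fin n → ℕ} (hα : α ∈ multiIndices n j) (u : testSpace n R) {B : ℝ} (hB : 0 ≤ B)
    (hu : levelSq _ (carlW_isMultiplier hR m τ j) j u ≤ B ^ 2) :
    eLpNorm (weightedLower m j 0 τ (multiDeriv α u.1)) 2 (weightedMeasure 0) ≤
      ENNReal.ofReal (τ ^ j) * ENNReal.ofReal B := by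
  obtain ⟨v, hv, hle⟩ := exists_multiDeriv α u
  have hα' : ∑ i, α i = j := by simpa [multiIndices] using hα
  have h3 := (hle _ (carlW_isMultiplier hR m τ j)).trans ((by rw [hα'] : _ = _).trans_le hu)
  rw [← hv, eLpNorm_two_weightedLower, eLpNorm_wt_smul hR m j hτ,
    eLpNorm_two_eq]
  gcongr
  exact (abs_le_of_sq_le_sq' h3 hB).2

lemma derivativeSum_le (hR : R ≤ 1) (m : ℕ) {J : Finset ℕ} {τ : ℝ} (hτ : 0 < τ)
    (u : testSpace n R) {B : ℝ} (hB : 0 ≤ B)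
    (hu : ∀ j ∈ J, levelSq _ (carlW_isMultiplier hR m τ j) j u ≤ B ^ 2) :
    derivativeSum m J 0 τ u.1 ≤ (∑ j ∈ J, (multiIndices n j).card : ℕ) *
      ENNReal.ofReal (τ ^ (3 * m / 2 : ℝ) * B) := by
  rw [Nat.cast_sum, Finset.sum_mul]
  refine Finset.sum_le_sum fun j hj => ?_
  rw [← nsmul_eq_mul]
  refine Finset.sum_le_card_nsmul _ _ _ fun α hα => ?_
  refine (mul_le_mul_right
    (eLpNorm_weightedLower_multiDeriv_le hR m j hτ hα u hB (hu j hj)) _).trans_eq ?_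
  rw [← ENNReal.ofReal_mul (by positivity), ← ENNReal.ofReal_mul (by positivity), ← mul_assoc,
    ← Real.rpow_natCast, ← Real.rpow_add hτ]
  congr 3
  ring

lemma eLpNorm_volume_le (hR : R ≤ 1) (m : ℕ) (τ : ℝ) (u : testSpace n R) :
    eLpNorm (weightedLower m 0 0 τ u.1) 2 volume ≤
      eLpNorm (weightedLower m 0 0 τ u.1) 2 (weightedMeasure 0) := by
  rw [eLpNorm_two_weightedMeasure_zero]
  refine eLpNorm_mono fun x => ?_
  by_cases hx : x ∈ punctured n R
  · rw [norm_smul, Real.norm_of_nonneg (Real.rpow_nonneg (norm_nonneg _) _)]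
    refine le_mul_of_one_le_left (norm_nonneg _) ?_
    refine Real.one_le_rpow_of_pos_of_le_one_of_nonpos (norm_pos_of_punctured hx)
      ((norm_lt_of_punctured hx).le.trans hR) ?_
    rw [neg_nonpos]
    positivity
  · simp [weightedLower, testSpace_apply_eq_zero u hx]

lemma aestronglyMeasurable_weightedLower (m j : ℕ) (τ : ℝ) (u : testSpace n R)
    (μ : Measure (EuclideanSpace ℝ (Fin n))) :
    AEStronglyMeasurable (weightedLower m j 0 τ u.1) μ := by
  have h1 : Measurable u.1 := (testSpace_contDiff u).continuous.measurable
  refine Measurable.aestronglyMeasurable ?_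
  unfold weightedLower phi
  fun_prop

lemma eLpNorm_le_mul_eLpNorm_two (n : ℕ) (R : ℝ) {q : ℝ≥0∞} (h1 : 1 ≤ q) (hq : q ≤ 2) :
    ∃ V : ℝ≥0∞, V ≠ ⊤ ∧ ∀ u : testSpace n R,
      eLpNorm u.1 q volume ≤ V * eLpNorm u.1 2 volume := by
  set U := Metric.ball (0 : EuclideanSpace ℝ (Fin n)) R
  have hqt : q ≠ ⊤ := ne_top_of_le_ne_top (by norm_num) hq
  have hq0 : 0 < q.toReal := ENNReal.toReal_pos (zero_lt_one.trans_le h1).ne' hqt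
  have hq2 : q.toReal ≤ 2 := by simpa using ENNReal.toReal_mono (by norm_num) hq
  refine ⟨volume U ^ (1 / q.toReal - 1 / 2), ENNReal.rpow_ne_top_of_nonneg ?_
    measure_ball_lt_top.ne, fun u => ?_⟩
  · rw [sub_nonneg]
    gcongr
  have hs : ∀ p : ℝ≥0∞, eLpNorm u.1 p (volume.restrict U) = eLpNorm u.1 p volume := fun p =>
    eLpNorm_restrict_eq_of_support_subset fun x hx =>
      (testSpace_tsupport u (subset_tsupport _ hx)).1
  have h2 := eLpNorm_le_eLpNorm_mul_rpow_measure_univ hq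
    (testSpace_aestronglyMeasurable u (volume.restrict U))
  rw [hs, hs, Measure.restrict_apply_univ, mul_comm] at h2
  simpa using h2

end Conversion

section Endpoint

open scoped NNReal

variable {n : ℕ} {R : ℝ}

lemma energy_bound_laplacianNorm {m : ℕ} (hm : 1 ≤ m) (hn : 2 ≤ n) :
    ∃ C R₀ : ℝ, 0 < R₀ ∧ R₀ ≤ Real.exp (-1) ∧ ∀ (hR : R₀ ≤ 1) (τ : ℝ), 1 < τ →
      ∀ u : testSpace n R₀, ∃ B : ℝ, 0 ≤ B ∧
        (∀ j < 2 * m, levelSq _ (carlW_isMultiplier hR m τ j) j u ≤ B ^ 2) ∧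
        ENNReal.ofReal B = ENNReal.ofReal C * ENNReal.ofReal (τ ^ (-(3 * m / 2) : ℝ)) *
          laplacianNorm m 0 τ u.1 := by
  obtain ⟨C, R₀, hC, h0, hR, h⟩ := energy_bound hm hn
  refine ⟨C, R₀, h0, hR, fun hR τ hτ u => ⟨_, ?_, h hR τ hτ u, ?_⟩⟩
  · have := lnorm_nonneg (wtOp hR τ 0 (2 * m - n / 2) ((lap n R₀ ^ m) u))
    positivity
  · rw [laplacianNorm_eq hR, ENNReal.ofReal_mul (by positivity), ENNReal.ofReal_mul (by positivity),
      Real.rpow_neg (by positivity)]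

/-- A Carleman estimate from an energy estimate and an endpoint bound, by interpolation. -/
lemma carleman_of_endpoint {m : ℕ} (hm : 1 ≤ m) (hn : 2 ≤ n) {J : Finset ℕ}
    (hJ : ∀ j ∈ J, j < 2 * m)
    {ν : EuclideanSpace ℝ (Fin n) → Measure (EuclideanSpace ℝ (Fin n))}
    (hν : ∀ (x₀ : EuclideanSpace ℝ (Fin n)) (p : ℝ≥0∞) (f : EuclideanSpace ℝ (Fin n) → ℂ),
      eLpNorm f p (ν x₀) = eLpNorm (fun x => f (x + x₀)) p (ν 0))
    (hν2 : ∀ R ≤ (1 : ℝ), ∀ (u : testSpace n R) (τ : ℝ),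
      eLpNorm (weightedLower m 0 0 τ u.1) 2 (ν 0) ≤
        eLpNorm (weightedLower m 0 0 τ u.1) 2 (weightedMeasure 0))
    {p q : ℝ≥0∞} {θ c : ℝ} (h0 : 0 ≤ θ) (h1 : θ ≤ 1)
    (h : p⁻¹ = ENNReal.ofReal θ * 2⁻¹ + ENNReal.ofReal (1 - θ) * q⁻¹)
    (hc : c ≤ 3 * m / 2 - (1 - θ) * (2 * m - 1))
    (hend : ∀ R ≤ Real.exp (-1), ∃ D : ℝ≥0∞, D ≠ ⊤ ∧ ∀ (hR1 : R ≤ 1) (τ : ℝ), 1 < τ →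
      ∀ B : ℝ, 0 ≤ B → ∀ u : testSpace n R,
        (∀ j < 2 * m, levelSq _ (carlW_isMultiplier hR1 m τ j) j u ≤ B ^ 2) →
        eLpNorm (weightedLower m 0 0 τ u.1) q (ν 0) ≤
          D * ENNReal.ofReal (τ ^ (2 * m - 1 : ℝ)) * ENNReal.ofReal B) :
    ∃ C R₀ : ℝ, 0 < C ∧ 0 < R₀ ∧ R₀ < 1 ∧
      ∀ (x₀ : EuclideanSpace ℝ (Fin n)) (u : EuclideanSpace ℝ (Fin n) → ℂ),
        IsTestFunction x₀ R₀ u → ∀ τ : ℝ, 1 < τ →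
          ENNReal.ofReal (τ ^ c) * eLpNorm (weightedLower m 0 x₀ τ u) p (ν x₀) +
            derivativeSum m J x₀ τ u ≤ ENNReal.ofReal C * laplacianNorm m x₀ τ u := by
  obtain ⟨C₁, R₀, hR0, hRe, hE⟩ := energy_bound_laplacianNorm (n := n) hm hn
  obtain ⟨D, hD, hend⟩ := hend R₀ hRe
  have hRlt : R₀ < 1 := hRe.trans_lt (by simp)
  set N : ℕ := ∑ j ∈ J, (multiIndices n j).card
  have h1' : 0 ≤ 1 - θ := by linarith
  set K : ℝ≥0∞ := ENNReal.ofReal C₁ ^ θ * (D * ENNReal.ofReal C₁) ^ (1 - θ) +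
    N * ENNReal.ofReal C₁ with hK
  have hKt : K ≠ ⊤ := by
    refine ENNReal.add_ne_top.2 ⟨ENNReal.mul_ne_top
      (ENNReal.rpow_ne_top_of_nonneg h0 ENNReal.ofReal_ne_top)
      (ENNReal.rpow_ne_top_of_nonneg h1' (ENNReal.mul_ne_top hD ENNReal.ofReal_ne_top)), ?_⟩
    exact ENNReal.mul_ne_top (ENNReal.natCast_ne_top N) ENNReal.ofReal_ne_top
  refine ⟨K.toReal + 1, R₀, by positivity, hR0, hRlt, fun x₀ u hu τ hτ => ?_⟩
  have hτ0 : 0 < τ := by linarith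
  rw [hν, weightedLower_translate, derivativeSum_translate, laplacianNorm_translate]
  set v : testSpace n R₀ := ⟨fun x => u (x + x₀), hu.translate⟩
  change ENNReal.ofReal (τ ^ c) * eLpNorm (weightedLower m 0 0 τ v.1) p (ν 0) +
    derivativeSum m J 0 τ v.1 ≤ _ * laplacianNorm m 0 τ v.1
  obtain ⟨B, hB, hBv, hBF⟩ := hE hRlt.le τ hτ v
  set F := laplacianNorm m 0 τ v.1
  have h2 : eLpNorm (weightedLower m 0 0 τ v.1) 2 (ν 0) ≤
      ENNReal.ofReal C₁ * ENNReal.ofReal (τ ^ (-(3 * m / 2) : ℝ)) * F := by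
    refine (hν2 R₀ hRlt.le v τ).trans ?_
    rw [eLpNorm_two_weightedLower, eLpNorm_wt_smul hRlt.le m 0 hτ0, eLpNorm_two_eq, ← hBF,
      pow_zero, ENNReal.ofReal_one, one_mul]
    exact ENNReal.ofReal_le_ofReal (abs_le_of_sq_le_sq' (hBv 0 (by omega)) hB).2
  have h3 : eLpNorm (weightedLower m 0 0 τ v.1) q (ν 0) ≤
      D * ENNReal.ofReal C₁ * ENNReal.ofReal (τ ^ (2 * m - 1 - 3 * m / 2 : ℝ)) * F := by
    refine (hend hRlt.le τ hτ B hB v hBv).trans_eq ?_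
    rw [hBF, sub_eq_add_neg (2 * m - 1 : ℝ) (3 * m / 2), Real.rpow_add hτ0,
      ENNReal.ofReal_mul (by positivity)]
    ring
  have h4 := mul_eLpNorm_le_of_interpolation
    (aestronglyMeasurable_weightedLower m 0 τ v (ν 0)) h0 h1 h (c := c) hτ (by linarith) h2 h3
  have h5 : derivativeSum m J 0 τ v.1 ≤ N * ENNReal.ofReal C₁ * F := by
    refine (derivativeSum_le hRlt.le m hτ0 v hB fun j hj => hBv j (hJ j hj)).trans_eq ?_
    rw [ENNReal.ofReal_mul (by positivity), hBF]
    have e : ENNReal.ofReal (τ ^ (3 * m / 2 : ℝ)) *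
        ENNReal.ofReal (τ ^ (-(3 * m / 2) : ℝ)) = 1 := by
      rw [← ENNReal.ofReal_mul (by positivity), ← Real.rpow_add hτ0]
      simp
    calc _ = N * ENNReal.ofReal C₁ * F * (ENNReal.ofReal (τ ^ (3 * m / 2 : ℝ)) *
          ENNReal.ofReal (τ ^ (-(3 * m / 2) : ℝ))) := by ring
      _ = _ := by rw [e, mul_one]
  calc _ ≤ ENNReal.ofReal C₁ ^ θ * (D * ENNReal.ofReal C₁) ^ (1 - θ) * F +
        N * ENNReal.ofReal C₁ * F := add_le_add h4 h5
    _ = K * F := by rw [hK]; ring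
    _ ≤ _ := by
        gcongr
        rw [ENNReal.ofReal_add ENNReal.toReal_nonneg zero_le_one, ENNReal.ofReal_toReal hKt]
        exact le_self_add

lemma eLpNorm_wt_smul_le {m : ℕ} (hm : 1 ≤ m) (hn : 0 < n) {q : ℝ≥0} (hq1 : 1 ≤ q) (hq2 : q ≤ 2)
    (hq : (2 * m - 1 : ℝ) / n < (q : ℝ)⁻¹) (hR : R ≤ Real.exp (-1)) :
    ∃ D : ℝ≥0∞, D ≠ ⊤ ∧ ∀ (hR1 : R ≤ 1) (τ : ℝ), 1 < τ → ∀ B : ℝ, 0 ≤ B → ∀ u : testSpace n R,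
      (∀ j < 2 * m, levelSq _ (carlW_isMultiplier hR1 m τ j) j u ≤ B ^ 2) →
      eLpNorm (fun x => wt τ m (2 * m - 1 - n / 2) (Real.log ‖x‖) • u.1 x)
        (ENNReal.ofReal ((q : ℝ)⁻¹ - (2 * m - 1) / n)⁻¹) volume ≤
        D * ENNReal.ofReal (τ ^ (2 * m - 1 : ℝ)) * ENNReal.ofReal B := by
  have e1 : ((2 * m - 1 : ℕ) : ℝ) = 2 * m - 1 := by
    rw [Nat.cast_sub (by omega)]; push_cast; ring
  obtain ⟨C, hC⟩ := WeightFamily.sobolev_chain hn R (carlK n m) hq1 (2 * m - 1) 0 (2 * m - 1)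
    (by simp) (by rwa [e1])
  obtain ⟨V, hV, hVu⟩ := eLpNorm_le_mul_eLpNorm_two n R (q := q) (by exact_mod_cast hq1)
    (by exact_mod_cast hq2)
  refine ⟨C * ((n + 1) ^ (2 * m - 1) * V), by finiteness, fun hR1 τ hτ B hB u hu => ?_⟩
  have hτ0 : 0 < τ := by linarith
  have hw := carlW_family (n := n) hR m hτ
  have h1 := hC _ hw u
  have h2 := hw.chainSum_le hVu hB (2 * m - 1) 0 u fun j hj t ht => by
    obtain rfl : t = j := by omega
    exact hu t (by omega)
  have h3 := eLpNorm_wt_smul hR1 m (2 * m - 1) hτ0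
    (ENNReal.ofReal ((q : ℝ)⁻¹ - (2 * m - 1) / n)⁻¹) u
  rw [e1] at h1 h3
  rw [h3, ← Real.rpow_natCast, e1]
  calc _ ≤ ENNReal.ofReal (τ ^ (2 * m - 1 : ℝ)) *
        (C * ((n + 1) ^ (2 * m - 1) * (V * ENNReal.ofReal B))) := by
        gcongr
        exact h1.trans (mul_le_mul_right h2 _)
    _ = _ := by ring

lemma eLpNorm_top_weightedLower_le {m : ℕ} (hn : n + 2 < 4 * m) (hR : R ≤ Real.exp (-1)) :
    ∃ D : ℝ≥0∞, D ≠ ⊤ ∧ ∀ (hR1 : R ≤ 1) (τ : ℝ), 1 < τ → ∀ B : ℝ, 0 ≤ B → ∀ u : testSpace n R,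
      (∀ j < 2 * m, levelSq _ (carlW_isMultiplier hR1 m τ j) j u ≤ B ^ 2) →
      eLpNorm (weightedLower m 0 0 τ u.1) ⊤ volume ≤
        D * ENNReal.ofReal (τ ^ (2 * m - 1 : ℝ)) * ENNReal.ofReal B := by
  obtain ⟨D, hD, h⟩ := norm_wt_smul_le (n := n) m hn hR
  refine ⟨D, hD, fun hR1 τ hτ B hB u hu => ?_⟩
  rw [eLpNorm_exponent_top]
  refine eLpNormEssSup_le_of_ae_enorm_bound (Filter.Eventually.of_forall fun x => ?_)
  by_cases hx : x ∈ punctured n R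
  · have e : ‖weightedLower m 0 0 τ u.1 x‖ₑ =
        ENNReal.ofReal (|wt τ m 0 (Real.log ‖x‖)| * ‖u.1 x‖) := by
      rw [weightedLower_apply hx, ← ofReal_norm, norm_smul, Nat.cast_zero, Real.norm_eq_abs]
    rw [e]
    refine (h hR1 τ hτ B hB u hu x).trans ?_
    gcongr
    · exact hτ.le
    · have : (n : ℝ) + 2 < 4 * m := by exact_mod_cast hn
      linarith
  · simp [weightedLower, testSpace_apply_eq_zero u hx]

end Endpoint

lemma inv_ofReal_eq_interpolation {p q θ : ℝ} (hp : 0 < p) (hq : 0 < q) (h0 : 0 ≤ θ) (h1 : θ ≤ 1)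
    (h : p⁻¹ = θ * 2⁻¹ + (1 - θ) * q⁻¹) :
    (ENNReal.ofReal p)⁻¹ =
      ENNReal.ofReal θ * 2⁻¹ + ENNReal.ofReal (1 - θ) * (ENNReal.ofReal q)⁻¹ := by
  have h1' : 0 ≤ 1 - θ := by linarith
  have e2 : (2 : ℝ≥0∞)⁻¹ = ENNReal.ofReal 2⁻¹ := by
    rw [ENNReal.ofReal_inv_of_pos two_pos]; simp
  rw [e2, ← ENNReal.ofReal_inv_of_pos hp, ← ENNReal.ofReal_inv_of_pos hq,
    ← ENNReal.ofReal_mul h0, ← ENNReal.ofReal_mul h1', ← ENNReal.ofReal_add (by positivity)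
      (by positivity), h]

lemma weightedLower_zero_eq {n : ℕ} {R : ℝ} (m : ℕ) (τ : ℝ) (u : testSpace n R) :
    weightedLower m 0 0 τ u.1 = fun x => wt τ m 0 (Real.log ‖x‖) • u.1 x := by
  ext x
  by_cases hx : x ∈ punctured n R
  · rw [weightedLower_apply hx, Nat.cast_zero]
  · simp [weightedLower, testSpace_apply_eq_zero u hx]

/-- The case `n > 4m - 2`. -/
theorem carleman_high_dim {m n : ℕ} (hm : 1 ≤ m) (hn : 2 ≤ n) (hmn : 4 * m < n + 2) {p : ℝ}
    (hp2 : 2 ≤ p) (hp : p ≤ 2 * (n : ℝ) / ((n : ℝ) - 4 * (m : ℝ) + 2)) :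
    ∃ C R₀ : ℝ, 0 < C ∧ 0 < R₀ ∧ R₀ < 1 ∧
      ∀ (x₀ : EuclideanSpace ℝ (Fin n)) (u : EuclideanSpace ℝ (Fin n) → ℂ),
        IsTestFunction x₀ R₀ u → ∀ τ : ℝ, 1 < τ →
          ENNReal.ofReal (τ ^ ((3 * (m : ℝ) * p - (n : ℝ) * (p - 2)) / (2 * p))) *
              eLpNorm (weightedLower m 0 x₀ τ u) (ENNReal.ofReal p) (weightedMeasure x₀) +
            derivativeSum m (Finset.Icc 1 (2 * m - 1)) x₀ τ u ≤
          ENNReal.ofReal C * laplacianNorm m x₀ τ u := by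
  have hp0 : 0 < p := by linarith
  have hn0 : (0 : ℝ) < n := by exact_mod_cast (by omega : 0 < n)
  have hm1 : (1 : ℝ) ≤ m := by exact_mod_cast hm
  have hd : (0 : ℝ) < n - 4 * m + 2 := by
    have : (4 : ℝ) * m < n + 2 := by exact_mod_cast hmn
    linarith
  have hk : (0 : ℝ) < 2 * m - 1 := by linarith
  set d : ℝ := n - 4 * m + 2 with hd'
  have hq : ((2 : ℝ)⁻¹ - (2 * m - 1) / n) = d / (2 * n) := by
    rw [hd']; field_simp; ring
  have hnp : d / 2 ≤ n / p := by
    rw [le_div_iff₀ hd] at hp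
    rw [div_le_div_iff₀ two_pos hp0]
    linarith
  have hnp2 : (n : ℝ) / p ≤ n / 2 := by gcongr
  refine carleman_of_endpoint hm hn (ν := weightedMeasure)
    (q := ENNReal.ofReal ((2 : ℝ)⁻¹ - (2 * m - 1) / n)⁻¹) (θ := (n / p - d / 2) / (2 * m - 1))
    (fun j hj => by have := (Finset.mem_Icc.1 hj).2; omega)
    (fun x₀ p f => eLpNorm_weightedMeasure_translate x₀ p) (fun R hR u τ => le_rfl)
    (div_nonneg (by linarith) hk.le) (by rw [div_le_one hk]; linarith)
    (inv_ofReal_eq_interpolation hp0 (by rw [hq]; positivity) (div_nonneg (by linarith) hk.le)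
      (by rw [div_le_one hk]; linarith) ?_) ?_ fun R hR => ?_
  · rw [inv_inv, hq, show d = n - 2 * (2 * m - 1) by rw [hd']; ring]
    clear_value d
    generalize (2 * (m : ℝ) - 1) = k at hk ⊢
    field_simp
    ring
  · refine le_of_eq ?_
    rw [sub_mul, div_mul_cancel₀ _ hk.ne', hd']
    field_simp
    ring
  · obtain ⟨D, hD, h⟩ := eLpNorm_wt_smul_le (q := 2) hm (by omega : 0 < n) (by norm_num) le_rfl (by
      rw [NNReal.coe_ofNat, ← sub_pos, hq]; positivity) hR
    refine ⟨D, hD, fun hR1 τ hτ B hB u hu => ?_⟩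
    rw [eLpNorm_weightedLower m 0 τ (by rw [hq]; positivity)]
    have e : ((0 : ℕ) : ℝ) - n / ((2 : ℝ)⁻¹ - (2 * m - 1) / n)⁻¹ = 2 * m - 1 - n / 2 := by
      push_cast; field_simp; ring
    rw [e]
    exact h hR1 τ hτ B hB u hu

/-- The case `n = 4m - 2`. -/
theorem carleman_critical_dim {m n : ℕ} (hm : 1 ≤ m) (hn : 2 ≤ n) (hmn : n + 2 = 4 * m) {p : ℝ}
    (hp2 : 2 ≤ p) {ε : ℝ} (hε : 0 < ε) (hε1 : ε < 1) :
    ∃ C R₀ : ℝ, 0 < C ∧ 0 < R₀ ∧ R₀ < 1 ∧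
      ∀ (x₀ : EuclideanSpace ℝ (Fin n)) (u : EuclideanSpace ℝ (Fin n) → ℂ),
        IsTestFunction x₀ R₀ u → ∀ τ : ℝ, 1 < τ →
          ENNReal.ofReal (τ ^ ((4 * (m : ℝ) - 2) / p * (1 - ε) - ((m : ℝ) - 2) / 2)) *
              eLpNorm (weightedLower m 0 x₀ τ u) (ENNReal.ofReal p) volume +
            derivativeSum m (Finset.Icc 0 (2 * m - 1)) x₀ τ u ≤
          ENNReal.ofReal C * laplacianNorm m x₀ τ u := by
  have hp0 : 0 < p := by linarith
  have hm1 : (1 : ℝ) ≤ m := by exact_mod_cast hm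
  have hn' : (n : ℝ) = 4 * m - 2 := by
    have : (n : ℝ) + 2 = 4 * m := by exact_mod_cast hmn
    linarith
  have hk : (0 : ℝ) < 2 * m - 1 := by linarith
  have hs : (2 * m - 1 : ℝ) / n = 2⁻¹ := by
    rw [hn', show (4 * m - 2 : ℝ) = (2 * m - 1) * 2 by ring]
    field_simp
  have hq : 0 < (p - 2 + 2 * ε) / ε := div_pos (by linarith) hε
  have hq2 : 2 ≤ (p - 2 + 2 * ε) / ε := by rw [le_div_iff₀ hε]; linarith
  set q := (p - 2 + 2 * ε) / ε with hq'
  have hqi : q⁻¹ ≤ 2⁻¹ := inv_anti₀ two_pos hq2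
  have hqi0 : 0 < q⁻¹ := by positivity
  have hθ0 : 0 ≤ 2 * (1 - ε) / p := div_nonneg (by linarith) hp0.le
  have hθ1 : 2 * (1 - ε) / p ≤ 1 := by rw [div_le_one hp0]; linarith
  have hb : 0 < p - 2 + 2 * ε := by linarith
  refine carleman_of_endpoint hm hn (ν := fun _ => volume) (q := ENNReal.ofReal q)
    (θ := 2 * (1 - ε) / p) (fun j hj => by have := (Finset.mem_Icc.1 hj).2; omega)
    (fun x₀ p f => eLpNorm_volume_translate x₀ p) (fun R hR u τ => eLpNorm_volume_le hR m τ u)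
    hθ0 hθ1 (inv_ofReal_eq_interpolation hp0 hq hθ0 hθ1 ?_) ?_ fun R hR => ?_
  · rw [hq', inv_div]; field_simp; ring
  · refine le_of_eq ?_
    field_simp; ring
  · have hc : ((q⁻¹ + 2⁻¹)⁻¹.toNNReal : ℝ) = (q⁻¹ + 2⁻¹)⁻¹ :=
      Real.coe_toNNReal _ (by positivity)
    obtain ⟨D, hD, h⟩ := eLpNorm_wt_smul_le (q := (q⁻¹ + 2⁻¹)⁻¹.toNNReal) hm (by omega : 0 < n)
      (by
        rw [← NNReal.coe_le_coe, hc, NNReal.coe_one, one_le_inv₀ (by positivity)]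
        linarith)
      (by
        rw [← NNReal.coe_le_coe, hc, NNReal.coe_ofNat]
        exact inv_le_of_inv_le₀ two_pos (by linarith))
      (by rw [hc, inv_inv, hs]; linarith) hR
    refine ⟨D, hD, fun hR1 τ hτ B hB u hu => ?_⟩
    have h' := h hR1 τ hτ B hB u hu
    rw [hc, inv_inv, hs, add_sub_cancel_right, inv_inv,
      show (2 * m - 1 - n / 2 : ℝ) = 0 by rw [hn']; ring] at h'
    rw [weightedLower_zero_eq]
    exact h'

/-- The case `n < 4m - 2`. -/
theorem carleman_low_dim {m n : ℕ} (hm : 1 ≤ m) (hn : 2 ≤ n) (hmn : n + 2 < 4 * m) {p : ℝ≥0∞}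
    (hp2 : 2 ≤ p) :
    ∃ C R₀ : ℝ, 0 < C ∧ 0 < R₀ ∧ R₀ < 1 ∧
      ∀ (x₀ : EuclideanSpace ℝ (Fin n)) (u : EuclideanSpace ℝ (Fin n) → ℂ),
        IsTestFunction x₀ R₀ u → ∀ τ : ℝ, 1 < τ →
          ENNReal.ofReal (τ ^ ((4 * (m : ℝ) - 2) * (p⁻¹).toReal - ((m : ℝ) - 2) / 2)) *
              eLpNorm (weightedLower m 0 x₀ τ u) p volume +
            derivativeSum m (Finset.Icc 0 (2 * m - 1)) x₀ τ u ≤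
          ENNReal.ofReal C * laplacianNorm m x₀ τ u := by
  have hpi : p⁻¹ ≤ 2⁻¹ := ENNReal.inv_le_inv.2 hp2
  have hpt : p⁻¹ ≠ ⊤ := ne_top_of_le_ne_top (by simp) hpi
  have hpr : (p⁻¹).toReal ≤ 2⁻¹ := by
    simpa using ENNReal.toReal_mono (by simp) hpi
  refine carleman_of_endpoint hm hn (ν := fun _ => volume) (q := ⊤) (θ := 2 * (p⁻¹).toReal)
    (fun j hj => by have := (Finset.mem_Icc.1 hj).2; omega)
    (fun x₀ p f => eLpNorm_volume_translate x₀ p) (fun R hR u τ => eLpNorm_volume_le hR m τ u)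
    (by positivity) (by linarith) ?_ ?_ fun R hR => eLpNorm_top_weightedLower_le hmn hR
  · rw [ENNReal.ofReal_mul two_pos.le, ENNReal.ofReal_toReal hpt, ENNReal.ofReal_ofNat,
      ENNReal.inv_top, mul_zero, add_zero, mul_right_comm,
      ENNReal.mul_inv_cancel two_ne_zero (by simp), one_mul]
  · refine le_of_eq ?_
    ring

end Carleman

theorem theorem3 (m n : ℕ) (hm : 2 ≤ m) :
    -- Case I: `n > 4m - 2`
    (4 * m < n + 2 →
      ∀ p : ℝ, 2 ≤ p → p ≤ 2 * (n : ℝ) / ((n : ℝ) - 4 * (m : ℝ) + 2) →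
        ∃ C R₀ : ℝ, 0 < C ∧ 0 < R₀ ∧ R₀ < 1 ∧
          ∀ (x₀ : EuclideanSpace ℝ (Fin n)) (u : EuclideanSpace ℝ (Fin n) → ℂ),
            Carleman.IsTestFunction x₀ R₀ u → ∀ τ : ℝ, 1 < τ →
              ENNReal.ofReal (τ ^ ((3 * (m : ℝ) * p - (n : ℝ) * (p - 2)) / (2 * p))) *
                  eLpNorm (Carleman.weightedLower m 0 x₀ τ u) (ENNReal.ofReal p)
                    (Carleman.weightedMeasure x₀) +
                Carleman.derivativeSum m (Finset.Icc 1 (2 * m - 1)) x₀ τ u ≤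
              ENNReal.ofReal C * Carleman.laplacianNorm m x₀ τ u) ∧
    -- Case II: `n = 4m - 2`
    (n + 2 = 4 * m →
      ∀ p : ℝ, 2 ≤ p → ∀ ε : ℝ, 0 < ε → ε < 1 →
        ∃ C R₀ : ℝ, 0 < C ∧ 0 < R₀ ∧ R₀ < 1 ∧
          ∀ (x₀ : EuclideanSpace ℝ (Fin n)) (u : EuclideanSpace ℝ (Fin n) → ℂ),
            Carleman.IsTestFunction x₀ R₀ u → ∀ τ : ℝ, 1 < τ →
              ENNReal.ofReal
                    (τ ^ ((4 * (m : ℝ) - 2) / p * (1 - ε) - ((m : ℝ) - 2) / 2)) *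
                  eLpNorm (Carleman.weightedLower m 0 x₀ τ u) (ENNReal.ofReal p) volume +
                Carleman.derivativeSum m (Finset.Icc 0 (2 * m - 1)) x₀ τ u ≤
              ENNReal.ofReal C * Carleman.laplacianNorm m x₀ τ u) ∧
    -- Case III: `2 ≤ n < 4m - 2`; here `p = ∞` is allowed, and then `1 / p = 0`
    (2 ≤ n → n + 2 < 4 * m →
      ∀ p : ℝ≥0∞, 2 ≤ p →
        ∃ C R₀ : ℝ, 0 < C ∧ 0 < R₀ ∧ R₀ < 1 ∧
          ∀ (x₀ : EuclideanSpace ℝ (Fin n)) (u : EuclideanSpace ℝ (Fin n) → ℂ),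
            Carleman.IsTestFunction x₀ R₀ u → ∀ τ : ℝ, 1 < τ →
              ENNReal.ofReal
                    (τ ^ ((4 * (m : ℝ) - 2) * (p⁻¹).toReal - ((m : ℝ) - 2) / 2)) *
                  eLpNorm (Carleman.weightedLower m 0 x₀ τ u) p volume +
                Carleman.derivativeSum m (Finset.Icc 0 (2 * m - 1)) x₀ τ u ≤
              ENNReal.ofReal C * Carleman.laplacianNorm m x₀ τ u) := by
  refine ⟨fun h p hp2 hp => ?_, fun h p hp2 ε hε hε1 => ?_, fun hn h p hp2 => ?_⟩
  · exact Carleman.carleman_high_dim (by omega) (by omega) h hp2 hp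
  · exact Carleman.carleman_critical_dim (by omega) (by omega) h hp2 hε hε1
  · exact Carleman.carleman_low_dim (by omega) hn h hp2
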